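/- Let $\hbar>0$, $h=2\pi\hbar$, and $K(x)=\frac{\pm1}{4\pi|x|}$ on $\mathbb R^3$ (either sign). For a bounded operator $T$ on $L^2(\mathbb R^3)=L^2(\mathbb R^3;\mathbb C)$ put $\|T\|_{\mathcal L^2}=h^{3/2}\,(\operatorname{Tr}|T|^2)^{1/2}\in[0,\infty]$. For $A$ one of the unbounded operators $\partial_{x_j}$, $\frac{x_j}{i\hbar}$, or a multiplication operator, each on its natural domain, the commutator $[A,T]$ is the bounded operator $B$ such that $T$ maps the domain of $A$ into itself and $AT\psi=B\psi+TA\psi$ there; if there is no such $B$, every norm of $[A,T]$ below is $+\infty$. Put $$\|T\|_{\mathcal W^{1,2}}^2=\|T\|_{\mathcal L^2}^2+\sum_{j=1}^3\big\|[\partial_{x_j},T]\big\|_{\mathcal L^2}^2+\sum_{j=1}^3\big\|[\tfrac{x_j}{i\hbar},T]\big\|_{\mathcal L^2}^2,\qquad \|\boldsymbol\nabla_\xi T\|_{\mathcal W^{1,2}}^2=\sum_{k=1}^3\big\|[\tfrac{x_k}{i\hbar},T]\big\|_{\mathcal W^{1,2}}^2 .$$ For a self-adjoint trace class operator $\boldsymbol\rho$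 let $\rho=\operatorname{diag}(\boldsymbol\rho)$, $\rho(x)=h^3\boldsymbol\rho(x,x)$, be its spatial density, i.e. the integrable function with $\int_S\rho\,dx=h^3\operatorname{Tr}(\mathbf 1_S\boldsymbol\rho)$ for every Borel set $S\subseteq\mathbb R^3$, and let $V_{\boldsymbol\rho}$ be the operator of multiplication by $K*\rho$. Then there exists a constant $C>0$, independent of $\hbar$, of the sign of $K$ and of the operators, such that for all $\hbar>0$ and all self-adjoint trace class operators $\boldsymbol\rho$ and $\boldsymbol\mu$ on $L^2(\mathbb R^3)$, $$\frac1\hbar\,\big\|[V_{\boldsymbol\rho},\boldsymbol\mu]\big\|_{\mathcal L^2}\le C\,\|\rho\|_{L^2(\mathbb R^3)}\,\|\boldsymbol\nabla_\xi\boldsymbol\mu\|_{\mathcal W^{1,2}},$$ where the right-hand side may be $+\infty$, with the convention $0\cdot\infty=0$. -/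

import Mathlib

open MeasureTheory
open scoped ENNReal InnerProductSpace LineDeriv SchwartzMap ComplexConjugate

namespace Hartree

/-- The absolute value `|T| = √(T* T)` of a bounded operator. -/
noncomputable def opAbs {H : Type*} [NormedAddCommGroup H] [InnerProductSpace ℂ H] [CompleteSpace H]
    (T : H →L[ℂ] H) : H →L[ℂ] H := CFC.abs T

/-- The power `|T| ^ p`, given by the functional calculus. -/
noncomputable def opAbsPow {H : Type*} [NormedAddCommGroup H] [InnerProductSpace ℂ H]
    [CompleteSpace H] (T : H →L[ℂ] H) (p : ℝ) : H →L[ℂ] H := CFC.abs T ^ p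

/-- The position space `ℝ³`. -/
abbrev Space : Type := EuclideanSpace ℝ (Fin 3)

/-- The one-particle Hilbert space `L²(ℝ³; ℂ)`. -/
abbrev L2 : Type := Lp ℂ 2 (volume : Measure Space)

/-- The index set of an orthonormal basis of `L²(ℝ³)`, chosen once and for all. -/
noncomputable def basisIndex : Set L2 := (exists_hilbertBasis ℂ L2).choose

/-- An orthonormal basis of `L²(ℝ³)`, chosen once and for all; it only serves to write traces as
sums, and none of the traces below depends on the choice. -/
noncomputable def onb : HilbertBasis basisIndex ℂ L2 := (exists_hilbertBasis ℂ L2).choose_spec.choose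

/-- The trace `∑ i, ⟨e i, A e i⟩ ∈ [0, ∞]` of a positive bounded operator `A`. -/
noncomputable def posTrace (A : L2 →L[ℂ] L2) : ℝ≥0∞ :=
  ∑' i, ENNReal.ofReal (RCLike.re ⟪onb i, A (onb i)⟫_ℂ)

/-- `T` is trace class: `Tr |T| < ∞`, where `|T| = √(T* T)`. -/
def IsTraceClass (T : L2 →L[ℂ] L2) : Prop := posTrace (opAbs T) < ∞

/-- The rescaled Schatten norm `h ^ (3 / p) * (Tr |T| ^ p) ^ (1 / p)` with `h = 2 π ħ`. -/
noncomputable def schattenNorm (ħ p : ℝ) (T : L2 →L[ℂ] L2) : ℝ≥0∞ :=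
  ENNReal.ofReal (2 * Real.pi * ħ) ^ (3 / p) * posTrace (opAbsPow T p) ^ (1 / p)

/-- `n` is (a representative of) the spatial density `diag T`, that is `n x = h ^ 3 * T(x, x)` with
`h = 2 π ħ`. As the kernel `T(x, y)` of a trace class operator is only defined almost everywhere,
its restriction to the diagonal is understood in the usual way: `n` is the integrable function
such that `∫_S n = h ^ 3 * Tr (𝟙_S T)` for every measurable set `S`. -/
structure IsSpatialDensity (ħ : ℝ) (T : L2 →L[ℂ] L2) (n : Space → ℝ) : Prop where
  integrable : Integrable n
  trace : ∀ S : Set Space, MeasurableSet S →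
    HasSum (fun i => ((2 * Real.pi * ħ) ^ 3 : ℂ) * ∫ x in S, conj ((onb i : Space → ℂ) x) *
      (T (onb i) : Space → ℂ) x) ((∫ x in S, n x : ℝ) : ℂ)

/-- The mean-field potential `K * n` for the interaction potential `K x = σ / (4 π |x|)`. -/
noncomputable def meanField (σ : ℝ) (n : Space → ℝ) (x : Space) : ℝ :=
  ∫ y, σ / (4 * Real.pi * ‖x - y‖) * n y

/-- The graph of the operator of multiplication by `m`, on its natural domain
`{ψ ∈ L² | m ψ ∈ L²}`. -/
def mulGraph (m : Space → ℂ) (ψ ψ' : L2) : Prop :=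
  (ψ' : Space → ℂ) =ᵐ[volume] fun x => m x * (ψ : Space → ℂ) x

/-- The graph of the `j`-th partial derivative on its natural domain `{ψ ∈ L² | ∂ⱼ ψ ∈ L²}`,
where the derivative is the distributional one. -/
def derivGraph (j : Fin 3) (ψ ψ' : L2) : Prop :=
  ∂_{EuclideanSpace.single j (1 : ℝ)} (ψ : 𝓢'(Space, ℂ)) = (ψ' : 𝓢'(Space, ℂ))

/-- The bounded operator `B` is the commutator `[A, T]` of the (possibly unbounded) operator with
graph `A` and the bounded operator `T`: for all `ψ` in the domain of `A`, the vector `T ψ` is in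
the domain of `A` and `A T ψ = B ψ + T A ψ`. -/
def IsCommutator (A : L2 → L2 → Prop) (T B : L2 →L[ℂ] L2) : Prop :=
  ∀ ψ ψ' : L2, A ψ ψ' → A (T ψ) (B ψ + T ψ')

/-- The norm of `[A, T]` in the rescaled Hilbert–Schmidt class; it is `∞` if `[A, T]` is not a
bounded operator. (For a densely defined `A` there is at most one `B` in the infimum.) -/
noncomputable def commutatorNorm (ħ : ℝ) (A : L2 → L2 → Prop) (T : L2 →L[ℂ] L2) : ℝ≥0∞ :=
  ⨅ (B : L2 →L[ℂ] L2) (_ : IsCommutator A T B), schattenNorm ħ 2 B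

/-- The graph of multiplication by `x_k / (i ħ)`, the operator whose commutator with `T` is the
`k`-th component of the quantum gradient of `T` in the momentum variable. -/
def momentumGraph (ħ : ℝ) (k : Fin 3) : L2 → L2 → Prop :=
  mulGraph fun x => (x k : ℂ) / (Complex.I * ħ)

/-- The square of the quantum Sobolev norm of order one in the rescaled Hilbert–Schmidt class:
the squared norms of `T`, of `[∂_j, T]` and of `[x_j / (i ħ), T]` are summed. -/
noncomputable def sobolevNormSq (ħ : ℝ) (T : L2 →L[ℂ] L2) : ℝ≥0∞ :=
  schattenNorm ħ 2 T ^ 2 + ∑ j : Fin 3, commutatorNorm ħ (derivGraph j) T ^ 2 +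
    ∑ j : Fin 3, commutatorNorm ħ (momentumGraph ħ j) T ^ 2

/-- The quantum Sobolev norm of order one of the quantum gradient `[x / (i ħ), T]`, a vector of three
operators; it is `∞` if one of them is not a bounded operator. -/
noncomputable def momentumGradientSobolevNorm (ħ : ℝ) (T : L2 →L[ℂ] L2) : ℝ≥0∞ :=
  (∑ k : Fin 3, ⨅ (B : L2 →L[ℂ] L2) (_ : IsCommutator (momentumGraph ħ k) T B),
    sobolevNormSq ħ B) ^ (1 / 2 : ℝ)

theorem opAbs_decomp {H : Type*} [NormedAddCommGroup H] [InnerProductSpace ℂ H] [CompleteSpace H]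
    (T : H →L[ℂ] H) (hT : IsSelfAdjoint T) : ∃ P Q : H →L[ℂ] H,
      IsSelfAdjoint P ∧ IsSelfAdjoint Q ∧ T = P * P - Q * Q ∧ opAbs T = P * P + Q * Q := by
  refine ⟨CFC.sqrt T⁺, CFC.sqrt T⁻, (CFC.sqrt_nonneg _).isSelfAdjoint,
    (CFC.sqrt_nonneg _).isSelfAdjoint, ?_, ?_⟩
  · rw [CFC.sqrt_mul_sqrt_self _ (CFC.posPart_nonneg T),
      CFC.sqrt_mul_sqrt_self _ (CFC.negPart_nonneg T), CFC.posPart_sub_negPart T]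
  · rw [CFC.sqrt_mul_sqrt_self _ (CFC.posPart_nonneg T),
      CFC.sqrt_mul_sqrt_self _ (CFC.negPart_nonneg T), CFC.posPart_add_negPart T, opAbs]

theorem summable_of_traceClass {T P Q : L2 →L[ℂ] L2} (hT : IsTraceClass T)
    (hP : IsSelfAdjoint P) (hQ : IsSelfAdjoint Q) (h : opAbs T = P * P + Q * Q) :
    Summable (fun i => ‖P (onb i)‖ ^ 2) ∧ Summable (fun i => ‖Q (onb i)‖ ^ 2) := by
  have key : ∀ i, RCLike.re ⟪onb i, opAbs T (onb i)⟫_ℂ = ‖P (onb i)‖ ^ 2 + ‖Q (onb i)‖ ^ 2 := by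
    intro i
    have e1 : ∀ R : L2 →L[ℂ] L2, IsSelfAdjoint R →
        ⟪onb i, R (R (onb i))⟫_ℂ = ⟪R (onb i), R (onb i)⟫_ℂ := by
      intro R hR
      conv_lhs => rw [← ContinuousLinearMap.isSelfAdjoint_iff'.1 hR]
      rw [ContinuousLinearMap.adjoint_inner_right]
      simp [ContinuousLinearMap.isSelfAdjoint_iff'.1 hR]
    rw [h]
    simp only [add_apply, mul_apply_eq_comp, inner_add_right,
      map_add, e1 P hP, e1 Q hQ, inner_self_eq_norm_sq]
  have hs : Summable (fun i => ‖P (onb i)‖ ^ 2 + ‖Q (onb i)‖ ^ 2) := by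
    have h1 := hT
    unfold IsTraceClass posTrace at h1
    simp only [key] at h1
    have := ENNReal.summable_toReal h1.ne
    refine this.congr fun i => ?_
    rw [ENNReal.toReal_ofReal (by positivity)]
  exact ⟨hs.of_nonneg_of_le (fun i => by positivity) (fun i => by linarith [sq_nonneg ‖Q (onb i)‖]),
    hs.of_nonneg_of_le (fun i => by positivity) (fun i => by linarith [sq_nonneg ‖P (onb i)‖])⟩

theorem hasSum_trace {ι H : Type*} [NormedAddCommGroup H] [InnerProductSpace ℂ H] [CompleteSpace H]
    (b : HilbertBasis ι ℂ H) (X Y : H →L[ℂ] H) (hX : Summable fun i => ‖X (b i)‖ ^ 2)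
    (hY : Summable fun i => ‖Y (b i)‖ ^ 2) (hYs : IsSelfAdjoint Y) :
    HasSum (fun i => ⟪b i, X (Y (b i))⟫_ℂ) (∑' j, ⟪Y (b j), X (b j)⟫_ℂ) ∧
      Summable (fun j => ⟪Y (b j), X (b j)⟫_ℂ) := by
  have sq : ∀ Z : H →L[ℂ] H, Summable (fun i => ‖Z (b i)‖ ^ 2) →
      Summable (fun p : ι × ι => ‖⟪b p.2, Z (b p.1)⟫_ℂ‖ ^ 2) := by
    intro Z hZ
    have hs : ∀ j, HasSum (fun i => ‖⟪b i, Z (b j)⟫_ℂ‖ ^ 2) (‖Z (b j)‖ ^ 2) := by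
      intro j
      have := b.hasSum_inner_mul_inner (Z (b j)) (Z (b j))
      have := (RCLike.hasSum_re ℂ this)
      rw [inner_self_eq_norm_sq] at this
      convert this using 2 with i
      rw [← inner_conj_symm (b i), RCLike.mul_conj, ← RCLike.ofReal_pow, RCLike.ofReal_re,
        RCLike.norm_conj]
    rw [summable_prod_of_nonneg (fun p => by positivity)]
    exact ⟨fun j => (hs j).summable, hZ.congr fun j => ((hs j).tsum_eq).symm⟩
  have hF : Summable (fun p : ι × ι => ⟪Y (b p.1), b p.2⟫_ℂ * ⟪b p.2, X (b p.1)⟫_ℂ) := by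
    refine Summable.of_norm_bounded ((sq X hX).add (sq Y hY)) fun p => ?_
    rw [norm_mul, norm_inner_symm (Y (b p.1))]
    nlinarith [sq_nonneg (‖⟪b p.2, X (b p.1)⟫_ℂ‖ - ‖⟪b p.2, Y (b p.1)⟫_ℂ‖),
      sq_nonneg (‖⟪b p.2, X (b p.1)⟫_ℂ‖), sq_nonneg (‖⟪b p.2, Y (b p.1)⟫_ℂ‖)]
  have h1 : HasSum (fun j => ⟪Y (b j), X (b j)⟫_ℂ)
      (∑' p : ι × ι, ⟪Y (b p.1), b p.2⟫_ℂ * ⟪b p.2, X (b p.1)⟫_ℂ) :=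
    hF.hasSum.prod_fiberwise fun j => b.hasSum_inner_mul_inner (Y (b j)) (X (b j))
  refine ⟨?_, h1.summable⟩
  rw [h1.tsum_eq]
  have h2 := (Equiv.prodComm ι ι).hasSum_iff.2 hF.hasSum
  refine h2.prod_fiberwise fun i => ?_
  have := b.hasSum_inner_mul_inner (X.adjoint (b i)) (Y (b i))
  rw [ContinuousLinearMap.adjoint_inner_left] at this
  refine Eq.subst (motive := fun f => HasSum f _) (funext fun j => ?_) this
  change _ = ⟪Y (b j), b i⟫_ℂ * ⟪b i, X (b j)⟫_ℂ
  rw [ContinuousLinearMap.adjoint_inner_left, mul_comm]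
  congr 1
  conv_lhs => rw [← ContinuousLinearMap.isSelfAdjoint_iff'.1 hYs]
  rw [ContinuousLinearMap.adjoint_inner_right]

theorem countable_basisIndex : Countable basisIndex := by
  have : Fact ((2 : ℝ≥0∞) ≠ ∞) := ⟨by norm_num⟩
  have hd : ∀ i j, i ≠ j → ‖onb i - onb j‖ ^ 2 = 2 := by
    intro i j hij
    rw [@norm_sub_sq ℂ, onb.orthonormal.1, onb.orthonormal.1, onb.orthonormal.2 hij]
    norm_num
  refine Pairwise.countable_of_isOpen_disjoint (s := fun i => Metric.ball (onb i) (1 / 2))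
    (fun i j hij => Metric.ball_disjoint_ball ?_) (fun i => Metric.isOpen_ball)
    (fun i => ⟨onb i, Metric.mem_ball_self (by norm_num)⟩)
  rw [dist_eq_norm]
  nlinarith [hd i j hij, norm_nonneg (onb i - onb j)]

theorem densityAux (P : L2 →L[ℂ] L2) (hP : IsSelfAdjoint P)
    (hs : Summable fun i => ‖P (onb i)‖ ^ 2) :
    ∃ n : Space → ℝ, Integrable n ∧ ∀ S : Set Space, MeasurableSet S →
      HasSum (fun i => ∫ x in S, conj ((onb i : Space → ℂ) x) *
        ((P * P) (onb i) : Space → ℂ) x) ((∫ x in S, n x : ℝ) : ℂ) := by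
  have := countable_basisIndex
  set F : basisIndex → Space → ℝ := fun i x => ‖(P (onb i) : Space → ℂ) x‖ ^ 2 with hF
  have hint : ∀ i, Integrable (F i) := fun i =>
    (Lp.memLp (P (onb i))).integrable_norm_pow (by norm_num)
  have hnorm : ∀ i, ∫ x, F i x = ‖P (onb i)‖ ^ 2 := by
    intro i
    have h1 : (⟪P (onb i), P (onb i)⟫_ℂ) = ((∫ x, F i x : ℝ) : ℂ) := by
      rw [L2.inner_def, ← integral_complex_ofReal]
      refine integral_congr_ae (.of_forall fun x => ?_)
      simp [hF, inner_self_eq_norm_sq_to_K]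
    have h2 := inner_self_eq_norm_sq (𝕜 := ℂ) (P (onb i))
    rw [h1] at h2
    exact h2
  have hF0 : ∀ i x, 0 ≤ F i x := fun i x => by positivity
  have hfin : ∑' i, ∫⁻ x, ENNReal.ofReal (F i x) ≠ ∞ := by
    have : ∀ i, ∫⁻ x, ENNReal.ofReal (F i x) = ENNReal.ofReal (‖P (onb i)‖ ^ 2) := by
      intro i
      rw [← hnorm, ofReal_integral_eq_lintegral_ofReal (hint i) (.of_forall (hF0 i))]
    simp only [this]
    exact hs.tsum_ofReal_ne_top
  have hn : ∀ x, (∑' i, ENNReal.ofReal (F i x)).toReal = ∑' i, F i x := by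
    intro x
    rw [ENNReal.tsum_toReal_eq fun i => ENNReal.ofReal_ne_top]
    simp [ENNReal.toReal_ofReal (hF0 _ x)]
  refine ⟨fun x => ∑' i, F i x, ?_, fun S hS => ?_⟩
  · simp only [← hn]
    refine integrable_toReal_of_lintegral_ne_top ?_ ?_
    · exact AEMeasurable.tsum fun i => (hint i).aemeasurable.ennreal_ofReal
    · rwa [lintegral_tsum fun i => (hint i).aemeasurable.ennreal_ofReal]
  · set R := LpToLpRestrictCLM Space ℂ ℂ volume 2 S with hR
    have hinner : ∀ f g : L2, ⟪R f, R g⟫_ℂ =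
        ∫ x in S, conj ((f : Space → ℂ) x) * (g : Space → ℂ) x := by
      intro f g
      rw [L2.inner_def]
      refine integral_congr_ae ?_
      filter_upwards [LpToLpRestrictCLM_coeFn ℂ S f, LpToLpRestrictCLM_coeFn ℂ S g] with x h1 h2
      rw [h1, h2, RCLike.inner_apply, mul_comm]
    set X : L2 →L[ℂ] L2 := (R.adjoint ∘L R) ∘L P with hX
    have hXi : ∀ f g : L2, ⟪f, X g⟫_ℂ = ⟪R f, R (P g)⟫_ℂ := by
      intro f g
      simp only [hX, ContinuousLinearMap.comp_apply]
      rw [ContinuousLinearMap.adjoint_inner_right]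
    have hXs : Summable fun i => ‖X (onb i)‖ ^ 2 := by
      refine (hs.mul_left (‖R.adjoint ∘L R‖ ^ 2)).of_nonneg_of_le (fun i => by positivity)
        fun i => ?_
      rw [← mul_pow]
      exact pow_le_pow_left₀ (norm_nonneg _) ((R.adjoint ∘L R).le_opNorm _) 2
    obtain ⟨h1, h2⟩ := hasSum_trace onb X P hXs hs hP
    have e1 : ∀ i, ∫ x in S, conj ((onb i : Space → ℂ) x) *
        ((P * P) (onb i) : Space → ℂ) x = ⟪onb i, X (P (onb i))⟫_ℂ := by
      intro i
      rw [hXi, hinner]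
      rfl
    simp only [e1]
    convert h1 using 1
    have e2 : ∀ j, ⟪P (onb j), X (onb j)⟫_ℂ = ((∫ x in S, F j x : ℝ) : ℂ) := by
      intro j
      rw [hXi, hinner, ← integral_complex_ofReal]
      refine integral_congr_ae (.of_forall fun x => ?_)
      simp [hF, RCLike.conj_mul]
    simp only [e2]
    rw [← Complex.ofReal_tsum]
    congr 1
    refine (integral_tsum_of_summable_integral_norm (fun i => (hint i).integrableOn) ?_).symm
    refine hs.of_nonneg_of_le (fun i => integral_nonneg fun x => norm_nonneg _) fun i => ?_
    rw [← hnorm]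
    simp only [Real.norm_of_nonneg (hF0 i _)]
    exact setIntegral_le_integral (hint i) (.of_forall (hF0 i))

/-- Every self-adjoint trace class operator has a spatial density. -/
theorem exists_isSpatialDensity (ħ : ℝ) (T : L2 →L[ℂ] L2) (hT : IsSelfAdjoint T)
    (hT1 : IsTraceClass T) : ∃ n : Space → ℝ, IsSpatialDensity ħ T n := by
  obtain ⟨P, Q, hP, hQ, h, h'⟩ := opAbs_decomp T hT
  obtain ⟨sP, sQ⟩ := summable_of_traceClass hT1 hP hQ h'
  obtain ⟨p, hp, hpS⟩ := densityAux P hP sP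
  obtain ⟨q, hq, hqS⟩ := densityAux Q hQ sQ
  refine ⟨fun x => (2 * Real.pi * ħ) ^ 3 * (p x - q x), (hp.sub hq).const_mul _, fun S hS => ?_⟩
  rw [integral_const_mul, integral_sub hp.integrableOn hq.integrableOn]
  push_cast
  refine HasSum.mul_left _ ?_
  have hI : ∀ f g : L2, Integrable (fun x => conj ((f : Space → ℂ) x) * (g : Space → ℂ) x) := by
    intro f g
    refine (L2.integrable_inner (𝕜 := ℂ) f g).congr (.of_forall fun x => ?_)
    simp [mul_comm]
  have e : ∀ i, ∫ x in S, conj ((onb i : Space → ℂ) x) * (T (onb i) : Space → ℂ) x =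
      (∫ x in S, conj ((onb i : Space → ℂ) x) * ((P * P) (onb i) : Space → ℂ) x) -
        ∫ x in S, conj ((onb i : Space → ℂ) x) * ((Q * Q) (onb i) : Space → ℂ) x := by
    intro i
    rw [← integral_sub (hI _ _).integrableOn (hI _ _).integrableOn]
    refine integral_congr_ae (ae_restrict_of_ae ?_)
    rw [h]
    filter_upwards [Lp.coeFn_sub ((P * P) (onb i)) ((Q * Q) (onb i))] with x hx
    rw [← mul_sub]
    congr 1
  simp only [e]
  exact (hpS S hS).sub (hqS S hS)

/-- The spatial density is unique up to a null set. -/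
theorem IsSpatialDensity.ae_eq {ħ : ℝ} {T : L2 →L[ℂ] L2} {n n' : Space → ℝ}
    (h : IsSpatialDensity ħ T n) (h' : IsSpatialDensity ħ T n') : n =ᵐ[volume] n' :=
  Integrable.ae_eq_of_forall_setIntegral_eq n n' h.integrable h'.integrable fun S hS _ => by
    exact_mod_cast (h.trace S hS).unique (h'.trace S hS)

end Hartree

/-! Let m be the integral kernel of μ and V = K * n. The commutator [V, μ] has kernel (V(x) - V(y))
m(x, y), so its Hilbert–Schmidt norm is controlled by an L² norm on ℝ³ × ℝ³
(`isKernel_commutator_mulOp`, `IsKernel.hsSq_le`). Since |1/|x-z| - 1/|y-z|| ≤ |x-y| (|x-z|⁻² +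
|y-z|⁻²), one has |V(x) - V(y)| ≤ |x-y| (I(x) + I(y)) with the Riesz potential I = |n| * |·|⁻²
(`enorm_meanField_sub_le`). The factor |x-y| |m| / ħ is the Euclidean length of the vector of
kernels b_k of [x_k/(iħ), μ] (`exists_momentum_kernels`), and the powers of h agree on both sides.
It remains to bound ∫∫ I(x)² |b_k|² and ∫∫ I(y)² |b_k|².

Put y = x - r and freeze r. On kernels [∂_j, ·] acts as ∂_{x_j} + ∂_{y_j}, the derivative in x at
fixed r, so f(x) = b_k(x, x - r) is an H¹ function for almost every r. In weak form this says that
increments of b_k along (e_j, e_j) are integrals of the kernel of [∂_j, [x_k/(iħ), μ]]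
(`kernel_sub_shift_sq_le`).

What is needed is ∫ I² |f|² ≤ C ‖n‖₂² ‖f‖²_{H¹}, which also follows from the
Hardy–Littlewood–Sobolev and Sobolev inequalities. Here it rests on Hardy's inequality alone
(`lintegral_mul_inv_sq_le`). Set A = ∫ I² |f|² and u = I |f|². Moving |·|⁻² from |n| to u and using
Cauchy–Schwarz together with |·|⁻² * |·|⁻² ≤ C/|·| gives A² ≤ C ‖n‖₂² ∬ u(x) u(y)/|x-y|. A second
Cauchy–Schwarz bounds the square of the double integral by ‖f‖₂² H A², where H bounds ∫ |f|² |x-p|⁻²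
for every p. Cancelling A² gives the claim (`lintegral_mul_rieszPot_sq_le_of_bounded`). Integrating
over r and summing over k finishes the proof. -/

namespace Hartree

/-! ### Hilbert–Schmidt norms -/

/-- The squared Hilbert–Schmidt norm. -/
noncomputable def hsSq (T : L2 →L[ℂ] L2) : ℝ≥0∞ := ∑' i, ‖T (onb i)‖ₑ ^ 2

theorem opAbsPow_two {H : Type*} [NormedAddCommGroup H] [InnerProductSpace ℂ H] [CompleteSpace H]
    (T : H →L[ℂ] H) : opAbsPow T 2 = star T * T := by
  rw [opAbsPow, ← CFC.abs_mul_abs T, ← pow_two]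
  exact_mod_cast CFC.rpow_natCast (CFC.abs T) 2 (CFC.abs_nonneg T)

theorem posTrace_opAbsPow_two (T : L2 →L[ℂ] L2) : posTrace (opAbsPow T 2) = hsSq T := by
  rw [posTrace, hsSq, opAbsPow_two]
  congr 1 with i
  rw [mul_apply_eq_comp, ContinuousLinearMap.star_eq_adjoint,
    ContinuousLinearMap.adjoint_inner_right, inner_self_eq_norm_sq,
    ENNReal.ofReal_pow (norm_nonneg _), ofReal_norm]

theorem schattenNorm_two_sq (ħ : ℝ) (T : L2 →L[ℂ] L2) :
    schattenNorm ħ 2 T ^ 2 = ENNReal.ofReal (2 * Real.pi * ħ) ^ 3 * hsSq T := by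
  rw [schattenNorm, posTrace_opAbsPow_two, mul_pow, ← ENNReal.rpow_natCast,
    ← ENNReal.rpow_natCast, ← ENNReal.rpow_natCast, ← ENNReal.rpow_mul, ← ENNReal.rpow_mul]
  norm_num

/-! ### Square integrable kernels of Hilbert–Schmidt operators -/

/-- The tensor product `φ(x) conj ψ(y)`. -/
noncomputable def tensorFun (φ ψ : L2) (p : Space × Space) : ℂ := φ p.1 * conj (ψ p.2)

theorem memLp_tensorFun (φ ψ : L2) : MemLp (tensorFun φ ψ) 2 (volume : Measure (Space × Space)) := by
  have hm : AEStronglyMeasurable (tensorFun φ ψ) (volume : Measure (Space × Space)) :=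
    ((Lp.stronglyMeasurable φ).comp_measurable measurable_fst).mul
      (RCLike.continuous_conj.comp_stronglyMeasurable
        ((Lp.stronglyMeasurable ψ).comp_measurable measurable_snd)) |>.aestronglyMeasurable
  rw [memLp_two_iff_integrable_sq_norm hm]
  have := (Lp.memLp φ).integrable_norm_pow (by norm_num : (2 : ℕ) ≠ 0)
  have h2 := (Lp.memLp ψ).integrable_norm_pow (by norm_num : (2 : ℕ) ≠ 0)
  refine (this.mul_prod h2).congr (.of_forall fun p => ?_)
  simp [tensorFun, mul_pow]

noncomputable def tensor (φ ψ : L2) : Lp ℂ 2 (volume : Measure (Space × Space)) :=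
  (memLp_tensorFun φ ψ).toLp

theorem inner_tensor_left (φ ψ : L2) (k : Lp ℂ 2 (volume : Measure (Space × Space))) :
    ⟪tensor φ ψ, k⟫_ℂ = ∫ p, conj (φ p.1) * ψ p.2 * k p := by
  rw [L2.inner_def]
  refine integral_congr_ae ?_
  filter_upwards [(memLp_tensorFun φ ψ).coeFn_toLp] with p hp
  rw [tensor, hp]
  simp [tensorFun, mul_comm]

theorem inner_tensor (φ ψ φ' ψ' : L2) :
    ⟪tensor φ ψ, tensor φ' ψ'⟫_ℂ = ⟪φ, φ'⟫_ℂ * ⟪ψ', ψ⟫_ℂ := by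
  rw [inner_tensor_left, L2.inner_def, L2.inner_def, ← integral_prod_mul]
  refine integral_congr_ae ?_
  filter_upwards [(memLp_tensorFun φ' ψ').coeFn_toLp] with p hp
  rw [tensor, hp]
  simp [tensorFun]
  ring

theorem orthonormal_tensor :
    Orthonormal ℂ fun q : basisIndex × basisIndex => tensor (onb q.1) (onb q.2) := by
  classical
  rw [orthonormal_iff_ite]
  rintro ⟨i, j⟩ ⟨i', j'⟩
  rw [inner_tensor, orthonormal_iff_ite.1 onb.orthonormal, orthonormal_iff_ite.1 onb.orthonormal]
  by_cases h : i = i' <;> by_cases h' : j = j' <;> simp [h, h', eq_comm]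

/-- `k` is a square integrable kernel of `T`. -/
structure IsKernel (T : L2 →L[ℂ] L2) (k : Space × Space → ℂ) : Prop where
  measurable : Measurable k
  memLp : MemLp k 2 volume
  inner_eq : ∀ φ ψ : L2, ⟪φ, T ψ⟫_ℂ = ∫ p : Space × Space, conj (φ p.1) * ψ p.2 * k p

theorem tsum_enorm_inner_sq (v : L2) : ∑' i, ‖⟪onb i, v⟫_ℂ‖ₑ ^ 2 = ‖v‖ₑ ^ 2 := by
  have h := onb.hasSum_inner_mul_inner v v
  have h := RCLike.hasSum_re ℂ h
  rw [inner_self_eq_norm_sq] at h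
  have h' : HasSum (fun i => ‖⟪onb i, v⟫_ℂ‖ ^ 2) (‖v‖ ^ 2) := by
    convert h using 2 with i
    rw [← inner_conj_symm v, RCLike.conj_mul, ← RCLike.ofReal_pow, RCLike.ofReal_re]
  have := ENNReal.ofReal_tsum_of_nonneg (fun i => by positivity) h'.summable
  rw [h'.tsum_eq] at this
  simpa [ENNReal.ofReal_pow] using this.symm

theorem hsSq_eq_tsum_prod (T : L2 →L[ℂ] L2) :
    hsSq T = ∑' q : basisIndex × basisIndex, ‖⟪onb q.1, T (onb q.2)⟫_ℂ‖ₑ ^ 2 := by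
  rw [ENNReal.tsum_prod', ENNReal.tsum_comm]
  simp only [tsum_enorm_inner_sq, hsSq]

theorem enorm_sq_lp_eq_lintegral {α : Type*} [MeasurableSpace α] {ν : Measure α} (k : Lp ℂ 2 ν) :
    ‖k‖ₑ ^ 2 = ∫⁻ p, ‖k p‖ₑ ^ 2 ∂ν := by
  rw [Lp.enorm_def, eLpNorm_eq_lintegral_rpow_enorm_toReal (by norm_num) (by norm_num),
    ← ENNReal.rpow_natCast, ← ENNReal.rpow_mul]
  simp

/-- The kernel is the sum of ⟪e_i, T e_j⟫ e_i(x) conj e_j(y). Its coefficients are square summable,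
and the isometry attached to an orthonormal family gives both convergence and the norm, so
completeness of the tensor family is not needed. -/
theorem exists_isKernel {T : L2 →L[ℂ] L2} (hT : hsSq T ≠ ∞) :
    ∃ k, IsKernel T k ∧ ∫⁻ p, ‖k p‖ₑ ^ 2 = hsSq T := by
  set c : basisIndex × basisIndex → ℂ := fun q => ⟪onb q.1, T (onb q.2)⟫_ℂ with hc
  rw [hsSq_eq_tsum_prod] at hT
  have hs : Summable fun q => ‖c q‖ ^ 2 := by
    have := ENNReal.summable_toReal hT
    simpa using this
  have hm : Memℓp c 2 := by
    refine memℓp_gen ?_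
    simpa using hs
  set cl : lp (fun _ : basisIndex × basisIndex => ℂ) 2 := ⟨c, hm⟩ with hcl
  set V := orthonormal_tensor.orthogonalFamily with hV
  set K := V.linearIsometry cl with hK
  have hsum : HasSum (fun q : basisIndex × basisIndex => c q • tensor (onb q.1) (onb q.2)) K := by
    exact V.hasSum_linearIsometry cl
  refine ⟨K, ⟨(Lp.stronglyMeasurable K).measurable, Lp.memLp K, fun φ ψ => ?_⟩, ?_⟩
  · rw [← inner_tensor_left]
    have h1 := hsum.mapL (innerSL ℂ (tensor φ ψ))
    simp only [map_smul, innerSL_apply_apply, inner_tensor, smul_eq_mul] at h1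
    have h2 : HasSum (fun j => ⟪φ, T (onb j)⟫_ℂ * ⟪onb j, ψ⟫_ℂ) ⟪φ, T ψ⟫_ℂ := by
      have := onb.hasSum_inner_mul_inner (T.adjoint φ) ψ
      simpa only [ContinuousLinearMap.adjoint_inner_left] using this
    have h3 := (Equiv.prodComm basisIndex basisIndex).hasSum_iff.2 h1
    have h4 := h3.prod_fiberwise (g := fun j => ⟪φ, T (onb j)⟫_ℂ * ⟪onb j, ψ⟫_ℂ) fun j => by
      have := (onb.hasSum_inner_mul_inner φ (T (onb j))).mul_right ⟪onb j, ψ⟫_ℂ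
      refine this.congr_fun fun i => ?_
      simp [hc]
      ring
    exact h2.unique h4
  · rw [← enorm_sq_lp_eq_lintegral, hsSq_eq_tsum_prod, hK, LinearIsometry.enorm_map]
    have h1 := lp.norm_rpow_eq_tsum (p := 2) (by norm_num) cl
    have h2 := ENNReal.ofReal_tsum_of_nonneg (fun i => by positivity) hs
    simp only [ENNReal.toReal_ofNat, Real.rpow_ofNat] at h1
    have h3 : ‖cl‖ₑ ^ 2 = ENNReal.ofReal (‖cl‖ ^ 2) := by
      rw [ENNReal.ofReal_pow (norm_nonneg _), ofReal_norm]
    rw [h3, h1]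
    simpa [ENNReal.ofReal_pow] using h2

/-- The matrix entries of T are the coefficients of k along the orthonormal tensors, so Bessel's
inequality suffices. -/
theorem IsKernel.hsSq_le {T : L2 →L[ℂ] L2} {k : Space × Space → ℂ} (h : IsKernel T k) :
    hsSq T ≤ ∫⁻ p, ‖k p‖ₑ ^ 2 := by
  set K := h.memLp.toLp with hK
  have e : ∀ φ ψ, ⟪φ, T ψ⟫_ℂ = ⟪tensor φ ψ, K⟫_ℂ := by
    intro φ ψ
    rw [inner_tensor_left, h.inner_eq]
    refine integral_congr_ae ?_
    filter_upwards [h.memLp.coeFn_toLp] with p hp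
    rw [hK, hp]
  have e2 : ∫⁻ p, ‖k p‖ₑ ^ 2 = ‖K‖ₑ ^ 2 := by
    rw [enorm_sq_lp_eq_lintegral]
    refine lintegral_congr_ae ?_
    filter_upwards [h.memLp.coeFn_toLp] with p hp
    rw [hK, hp]
  rw [hsSq_eq_tsum_prod, e2]
  simp only [e]
  have h1 := orthonormal_tensor.tsum_inner_products_le K
  have h2 := ENNReal.ofReal_tsum_of_nonneg (fun i => by positivity)
    (orthonormal_tensor.inner_products_summable K)
  calc _ = ENNReal.ofReal (∑' q : basisIndex × basisIndex, ‖⟪tensor (onb q.1) (onb q.2), K⟫_ℂ‖ ^ 2) := by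
        rw [h2]; simp [ENNReal.ofReal_pow]
    _ ≤ ENNReal.ofReal (‖K‖ ^ 2) := ENNReal.ofReal_le_ofReal h1
    _ = _ := by rw [ENNReal.ofReal_pow (norm_nonneg _), ofReal_norm]

/-- Write T = P² - Q² with |T| = P² + Q². A finite trace of |T| makes P and Q Hilbert–Schmidt, and
composing with a bounded operator preserves this. -/
theorem hsSq_ne_top_of_isTraceClass {T : L2 →L[ℂ] L2} (hs : IsSelfAdjoint T)
    (hT : IsTraceClass T) : hsSq T ≠ ∞ := by
  obtain ⟨P, Q, hP, hQ, h, h'⟩ := opAbs_decomp T hs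
  obtain ⟨sP, sQ⟩ := summable_of_traceClass hT hP hQ h'
  have hsum : Summable fun i => ‖T (onb i)‖ ^ 2 := by
    refine ((sP.mul_left (2 * ‖P‖ ^ 2)).add (sQ.mul_left (2 * ‖Q‖ ^ 2))).of_nonneg_of_le
      (fun i => by positivity) fun i => ?_
    have h1 : ‖T (onb i)‖ ≤ ‖P‖ * ‖P (onb i)‖ + ‖Q‖ * ‖Q (onb i)‖ := by
      rw [h]
      refine (norm_sub_le _ _).trans (add_le_add ?_ ?_)
      exacts [P.le_opNorm _, Q.le_opNorm _]
    have h2 := pow_le_pow_left₀ (norm_nonneg _) h1 2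
    nlinarith [sq_nonneg (‖P‖ * ‖P (onb i)‖ - ‖Q‖ * ‖Q (onb i)‖)]
  have := hsum.tsum_ofReal_ne_top
  simpa [hsSq, ENNReal.ofReal_pow] using this

/-! ### Kernels of commutators with multiplication operators -/

/-- Cutting off to a product of balls makes g integrable. The sets on which the cut-off function
integrates to zero are then closed under complements and disjoint unions and contain the rectangles,
a π-system generating the product σ-algebra. -/
theorem ae_eq_zero_of_forall_setIntegral_prod_eq_zero {g : Space × Space → ℂ}
    (hg : ∀ R : ℝ, IntegrableOn g (Metric.ball 0 R ×ˢ Metric.ball 0 R))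
    (h : ∀ S T : Set Space, MeasurableSet S → MeasurableSet T → Bornology.IsBounded S →
      Bornology.IsBounded T → ∫ p in S ×ˢ T, g p = 0) : g =ᵐ[volume] 0 := by
  have key : ∀ n : ℕ, ∀ᵐ p ∂(volume : Measure (Space × Space)),
      p ∈ Metric.ball (0 : Space) n ×ˢ Metric.ball (0 : Space) n → g p = 0 := by
    intro n
    set D := Metric.ball (0 : Space) n ×ˢ Metric.ball (0 : Space) n with hD
    have hDm : MeasurableSet D := Metric.isOpen_ball.measurableSet.prod Metric.isOpen_ball.measurableSet
    have hi : Integrable (D.indicator g) := (hg n).integrable_indicator hDm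
    have hz : D.indicator g =ᵐ[volume] 0 := by
      refine hi.ae_eq_zero_of_forall_setIntegral_eq_zero fun U hU _ => ?_
      clear * - hU hi hDm h hD
      induction U, hU using MeasurableSpace.induction_on_inter generateFrom_prod.symm isPiSystem_prod with
      | empty => simp
      | basic t ht =>
        obtain ⟨S, hS, T, hT, rfl⟩ := ht
        rw [setIntegral_indicator hDm, hD, Set.prod_inter_prod]
        exact h _ _ (MeasurableSet.inter hS Metric.isOpen_ball.measurableSet)
          (MeasurableSet.inter hT Metric.isOpen_ball.measurableSet)
          (Metric.isBounded_ball.subset Set.inter_subset_right)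
          (Metric.isBounded_ball.subset Set.inter_subset_right)
      | compl t ht ih =>
        -- The whole cut-off domain is itself a bounded rectangle, which settles complements.
        have h0 : ∫ p, D.indicator g p = 0 := by
          rw [integral_indicator hDm]
          exact h _ _ Metric.isOpen_ball.measurableSet Metric.isOpen_ball.measurableSet
            Metric.isBounded_ball Metric.isBounded_ball
        have := integral_add_compl ht hi
        rw [ih, h0, zero_add] at this
        exact this
      | iUnion f hd hf ih =>
        rw [integral_iUnion hf hd hi.integrableOn]
        simp [ih]
    filter_upwards [hz] with p hp hpD
    rwa [Set.indicator_of_mem hpD] at hp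
  have := ae_all_iff.2 key
  filter_upwards [this] with p hp
  obtain ⟨n, hn⟩ := exists_nat_gt (max ‖p.1‖ ‖p.2‖)
  exact hp n ⟨by simpa using (le_max_left _ _).trans_lt hn, by simpa using (le_max_right _ _).trans_lt hn⟩

theorem integrable_tensor_mul {k : Space × Space → ℂ} (hk : MemLp k 2 volume) (φ ψ : L2) :
    Integrable fun p : Space × Space => conj (φ p.1) * ψ p.2 * k p := by
  have := L2.integrable_inner (𝕜 := ℂ) (tensor φ ψ) hk.toLp
  refine this.congr ?_
  filter_upwards [(memLp_tensorFun φ ψ).coeFn_toLp, hk.coeFn_toLp] with p h1 h2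
  rw [tensor, h1, h2]
  simp [tensorFun, mul_comm]

theorem memLp_indicator_of_bounded {a : Space → ℂ} (ha : Measurable a)
    (hb : ∀ R : ℝ, ∃ M, ∀ x ∈ Metric.ball (0 : Space) R, ‖a x‖ ≤ M) {S : Set Space}
    (hS : MeasurableSet S) (hSb : Bornology.IsBounded S) : MemLp (S.indicator a) 2 volume := by
  obtain ⟨R, hR⟩ := hSb.subset_ball 0
  obtain ⟨M, hM⟩ := hb R
  rw [memLp_indicator_iff_restrict hS]
  have : IsFiniteMeasure (volume.restrict S) := ⟨by
    rw [Measure.restrict_apply_univ]; exact hSb.measure_lt_top⟩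
  refine MemLp.of_bound ha.aestronglyMeasurable M ?_
  filter_upwards [ae_restrict_mem hS] with x hx using hM x (hR hx)

/-- Indicators of bounded sets lie in the domain of multiplication by the locally bounded `a`.
Applying the commutator identity to one of them, pairing with another and moving `a` across the
inner product identifies the integrals of the two kernels over all bounded rectangles. -/
theorem IsCommutator.kernel_eq {a : Space → ℂ} (ha : Measurable a)
    (hb : ∀ R : ℝ, ∃ M, ∀ x ∈ Metric.ball (0 : Space) R, ‖a x‖ ≤ M) {T B : L2 →L[ℂ] L2}
    {m b : Space × Space → ℂ} (hB : IsCommutator (mulGraph a) T B) (hm : IsKernel T m)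
    (hbk : IsKernel B b) : b =ᵐ[volume] fun p => (a p.1 - a p.2) * m p := by
  have hab : ∀ R : ℝ, IntegrableOn (fun p : Space × Space => b p - (a p.1 - a p.2) * m p)
      (Metric.ball 0 R ×ˢ Metric.ball 0 R) := by
    intro R
    obtain ⟨M, hM⟩ := hb R
    have hD : volume (Metric.ball (0 : Space) R ×ˢ Metric.ball (0 : Space) R) ≠ ∞ := by
      exact (Metric.isBounded_ball.prod Metric.isBounded_ball).measure_lt_top.ne
    have i1 : ∀ {k : Space × Space → ℂ}, MemLp k 2 volume →
        IntegrableOn k (Metric.ball 0 R ×ˢ Metric.ball 0 R) := by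
      intro k hk
      have : IsFiniteMeasure ((volume : Measure (Space × Space)).restrict
        (Metric.ball 0 R ×ˢ Metric.ball 0 R)) := ⟨by
          rw [Measure.restrict_apply_univ]; exact hD.lt_top⟩
      exact (hk.restrict _).integrable (by norm_num)
    refine (i1 hbk.memLp).sub ?_
    refine Integrable.bdd_mul (c := M + M) (i1 hm.memLp)
      (((ha.comp measurable_fst).sub (ha.comp measurable_snd)).aestronglyMeasurable) ?_
    filter_upwards [ae_restrict_mem (Metric.isOpen_ball.measurableSet.prod
      Metric.isOpen_ball.measurableSet)] with p hp
    exact (norm_sub_le _ _).trans (add_le_add (hM _ hp.1) (hM _ hp.2))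
  have h0 : (fun p : Space × Space => b p - (a p.1 - a p.2) * m p) =ᵐ[volume] 0 := by
    refine ae_eq_zero_of_forall_setIntegral_prod_eq_zero hab fun S T' hS hT hSb hTb => ?_
    have hc : ∀ R : ℝ, ∃ M, ∀ x ∈ Metric.ball (0 : Space) R, ‖(1 : ℂ)‖ ≤ M := fun _ => ⟨1, by simp⟩
    have hca : ∀ R : ℝ, ∃ M, ∀ x ∈ Metric.ball (0 : Space) R, ‖conj (a x)‖ ≤ M := by
      simpa using hb
    have hac : Measurable fun x => conj (a x) := RCLike.continuous_conj.measurable.comp ha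
    have mφ := memLp_indicator_of_bounded measurable_const hc hS hSb
    have mψ := memLp_indicator_of_bounded measurable_const hc hT hTb
    have mφ' := memLp_indicator_of_bounded hac hca hS hSb
    have mψ' := memLp_indicator_of_bounded ha hb hT hTb
    have hgraph : mulGraph a mψ.toLp mψ'.toLp := by
      filter_upwards [mψ.coeFn_toLp, mψ'.coeFn_toLp] with x h1 h2
      rw [h1, h2]
      by_cases hx : x ∈ T' <;> simp [hx]
    have hg := hB _ _ hgraph
    have e1 : ⟪mφ.toLp, B mψ.toLp + T mψ'.toLp⟫_ℂ = ⟪mφ'.toLp, T mψ.toLp⟫_ℂ := by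
      rw [L2.inner_def, L2.inner_def]
      refine integral_congr_ae ?_
      filter_upwards [mφ.coeFn_toLp, mφ'.coeFn_toLp, hg] with x h1 h2 h3
      rw [h1, h2, h3]
      by_cases hx : x ∈ S <;> simp [hx, mul_comm]
    have key : ∀ {k : Space × Space → ℂ} {u v : Space → ℂ} (hk : MemLp k 2 volume)
        (mu : MemLp (S.indicator u) 2 volume) (mv : MemLp (T'.indicator v) 2 volume),
        (∫ p : Space × Space, conj ((MemLp.toLp _ mu : L2) p.1) * (MemLp.toLp _ mv : L2) p.2 * k p =
          ∫ p in S ×ˢ T', conj (u p.1) * v p.2 * k p) ∧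
        IntegrableOn (fun p => conj (u p.1) * v p.2 * k p) (S ×ˢ T') := by
      intro k u v hk mu mv
      have e : (fun p : Space × Space => conj ((MemLp.toLp _ mu : L2) p.1) * (MemLp.toLp _ mv : L2) p.2 * k p) =ᵐ[volume]
          (S ×ˢ T').indicator fun p => conj (u p.1) * v p.2 * k p := by
        have q1 := Measure.quasiMeasurePreserving_fst (μ := (volume : Measure Space))
          (ν := (volume : Measure Space)) |>.ae_eq_comp mu.coeFn_toLp
        have q2 := Measure.quasiMeasurePreserving_snd (μ := (volume : Measure Space))
          (ν := (volume : Measure Space)) |>.ae_eq_comp mv.coeFn_toLp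
        filter_upwards [q1, q2] with p h1 h2
        simp only [Function.comp_apply] at h1 h2
        rw [h1, h2]
        by_cases hx : p.1 ∈ S <;> by_cases hy : p.2 ∈ T' <;> simp [hx, hy, Set.indicator]
      refine ⟨?_, ?_⟩
      · rw [integral_congr_ae e, integral_indicator (hS.prod hT)]
      · rw [← integrable_indicator_iff (hS.prod hT)]
        exact (integrable_tensor_mul hk _ _).congr e
    rw [inner_add_right, hbk.inner_eq, hm.inner_eq, hm.inner_eq, (key hbk.memLp mφ mψ).1,
      (key hm.memLp mφ mψ').1, (key hm.memLp mφ' mψ).1] at e1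
    have j1 := (key hbk.memLp mφ mψ).2
    have j2 := (key hm.memLp mφ mψ').2
    have j3 := (key hm.memLp mφ' mψ).2
    rw [← sub_eq_zero] at e1
    have j12 := integral_sub (j1.add j2) j3
    simp only [Pi.add_apply] at j12
    rw [← e1, ← integral_add j1 j2, ← j12]
    congr 1 with p
    simp
    ring
  filter_upwards [h0] with p hp
  simpa [sub_eq_zero] using hp

theorem memLp_bounded_mul {V : Space → ℝ} (hV : Measurable V) {M : ℝ} (hM : ∀ x, |V x| ≤ M)
    {α : Type*} [MeasurableSpace α] {ν : Measure α} {f : α → ℂ} (hf : MemLp f 2 ν) {π : α → Space}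
    (hπ : Measurable π) : MemLp (fun x => (V (π x) : ℂ) * f x) 2 ν := by
  refine hf.of_le_mul (c := M) ((Complex.measurable_ofReal.comp
    (hV.comp hπ)).aestronglyMeasurable.mul hf.1) (.of_forall fun x => ?_)
  rw [norm_mul, Complex.norm_real, Real.norm_eq_abs]
  exact mul_le_mul_of_nonneg_right (hM _) (norm_nonneg _)

/-- Multiplication by a bounded function. -/
noncomputable def mulOp {V : Space → ℝ} (hV : Measurable V) {M : ℝ} (hM : ∀ x, |V x| ≤ M) :
    L2 →L[ℂ] L2 :=
  LinearMap.mkContinuous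
    { toFun := fun f => (memLp_bounded_mul hV hM (Lp.memLp f) measurable_id).toLp
      map_add' := fun f g => by
        rw [← MemLp.toLp_add]
        refine MemLp.toLp_congr _ _ ?_
        filter_upwards [Lp.coeFn_add f g] with x hx
        rw [Pi.add_apply, hx, Pi.add_apply, mul_add]
      map_smul' := fun c f => by
        rw [RingHom.id_apply, ← MemLp.toLp_const_smul]
        refine MemLp.toLp_congr _ _ ?_
        filter_upwards [Lp.coeFn_smul c f] with x hx
        simp [hx, mul_left_comm] } M fun f => by
      refine Lp.norm_le_mul_norm_of_ae_le_mul ?_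
      filter_upwards [(memLp_bounded_mul hV hM (Lp.memLp f) measurable_id).coeFn_toLp] with x hx
      refine (congrArg norm hx).le.trans ?_
      rw [norm_mul, Complex.norm_real]
      exact mul_le_mul_of_nonneg_right (hM _) (norm_nonneg _)

theorem coeFn_mulOp {V : Space → ℝ} (hV : Measurable V) {M : ℝ} (hM : ∀ x, |V x| ≤ M) (f : L2) :
    mulOp hV hM f =ᵐ[volume] fun x => (V x : ℂ) * f x :=
  (memLp_bounded_mul hV hM (Lp.memLp f) measurable_id).coeFn_toLp

theorem inner_mulOp {V : Space → ℝ} (hV : Measurable V) {M : ℝ} (hM : ∀ x, |V x| ≤ M) (f g : L2) :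
    ⟪f, mulOp hV hM g⟫_ℂ = ⟪mulOp hV hM f, g⟫_ℂ := by
  rw [L2.inner_def, L2.inner_def]
  refine integral_congr_ae ?_
  filter_upwards [coeFn_mulOp hV hM f, coeFn_mulOp hV hM g] with x h1 h2
  rw [h1, h2]
  simp
  ring

theorem isCommutator_mulOp {V : Space → ℝ} (hV : Measurable V) {M : ℝ} (hM : ∀ x, |V x| ≤ M)
    (T : L2 →L[ℂ] L2) :
    IsCommutator (mulGraph fun x => (V x : ℂ)) T (mulOp hV hM * T - T * mulOp hV hM) := by
  intro ψ ψ' h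
  have e : ψ' = mulOp hV hM ψ := Lp.ext (h.trans (coeFn_mulOp hV hM ψ).symm)
  have e2 : (mulOp hV hM * T - T * mulOp hV hM) ψ + T ψ' = mulOp hV hM (T ψ) := by
    simp [e]
  rw [e2]
  exact coeFn_mulOp hV hM (T ψ)

theorem isKernel_commutator_mulOp {V : Space → ℝ} (hV : Measurable V) {M : ℝ}
    (hM : ∀ x, |V x| ≤ M) {T : L2 →L[ℂ] L2} {m : Space × Space → ℂ} (hm : IsKernel T m) :
    IsKernel (mulOp hV hM * T - T * mulOp hV hM) fun p => ((V p.1 - V p.2 : ℝ) : ℂ) * m p := by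
  have h1 := memLp_bounded_mul hV hM hm.memLp measurable_fst
  have h2 := memLp_bounded_mul hV hM hm.memLp measurable_snd
  refine ⟨?_, ?_, fun φ ψ => ?_⟩
  · exact (Complex.measurable_ofReal.comp
      ((hV.comp measurable_fst).sub (hV.comp measurable_snd))).mul hm.measurable
  · refine (memLp_congr_ae (.of_forall fun p => ?_)).1 (h1.sub h2)
    simp [sub_mul]
  · have e : ⟪φ, (mulOp hV hM * T - T * mulOp hV hM) ψ⟫_ℂ =
        ⟪mulOp hV hM φ, T ψ⟫_ℂ - ⟪φ, T (mulOp hV hM ψ)⟫_ℂ := by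
      rw [← inner_mulOp, ← inner_sub_right]
      rfl
    rw [e, hm.inner_eq, hm.inner_eq, ← integral_sub (integrable_tensor_mul hm.memLp _ _)
      (integrable_tensor_mul hm.memLp _ _)]
    refine integral_congr_ae ?_
    have q1 := Measure.quasiMeasurePreserving_fst (μ := (volume : Measure Space))
      (ν := (volume : Measure Space)) |>.ae_eq_comp (coeFn_mulOp hV hM φ)
    have q2 := Measure.quasiMeasurePreserving_snd (μ := (volume : Measure Space))
      (ν := (volume : Measure Space)) |>.ae_eq_comp (coeFn_mulOp hV hM ψ)
    filter_upwards [q1, q2] with p g1 g2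
    simp only [Function.comp_apply] at g1 g2
    rw [g1, g2]
    simp
    ring

/-! ### Cauchy–Schwarz and square integrability via lower integrals -/

theorem lintegral_mul_sq_le {α : Type*} [MeasurableSpace α] {ν : Measure α} {f g : α → ℝ≥0∞}
    (hf : AEMeasurable f ν) (hg : AEMeasurable g ν) :
    (∫⁻ x, f x * g x ∂ν) ^ 2 ≤ (∫⁻ x, f x ^ 2 ∂ν) * ∫⁻ x, g x ^ 2 ∂ν := by
  have h := ENNReal.lintegral_mul_le_Lp_mul_Lq ν Real.HolderConjugate.two_two hf hg
  have h2 := pow_le_pow_left₀ zero_le h 2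
  refine h2.trans (le_of_eq ?_)
  rw [mul_pow, ← ENNReal.rpow_natCast, ← ENNReal.rpow_natCast, ← ENNReal.rpow_mul,
    ← ENNReal.rpow_mul]
  norm_num

theorem enorm_integral_sq_le {α : Type*} [MeasurableSpace α] {ν : Measure α} {f : α → ℂ}
    (hf : AEStronglyMeasurable f ν) :
    ‖∫ x, f x ∂ν‖ₑ ^ 2 ≤ ν Set.univ * ∫⁻ x, ‖f x‖ₑ ^ 2 ∂ν := by
  have h := lintegral_mul_sq_le (ν := ν) (f := fun _ => 1) aemeasurable_const hf.enorm
  simp only [one_mul, one_pow, lintegral_const] at h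
  exact (pow_le_pow_left₀ zero_le (enorm_integral_le_lintegral_enorm f) 2).trans h

theorem memLp_two_of_lintegral {α : Type*} [MeasurableSpace α] {ν : Measure α} {f : α → ℂ}
    (hf : AEStronglyMeasurable f ν) (h : ∫⁻ x, ‖f x‖ₑ ^ 2 ∂ν ≠ ∞) : MemLp f 2 ν := by
  refine ⟨hf, ?_⟩
  rw [eLpNorm_lt_top_iff_lintegral_rpow_enorm_lt_top (by norm_num) (by norm_num)]
  simpa using h.lt_top

theorem lintegral_sq_ne_top {α : Type*} [MeasurableSpace α] {ν : Measure α} {f : α → ℂ}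
    (h : MemLp f 2 ν) : ∫⁻ x, ‖f x‖ₑ ^ 2 ∂ν ≠ ∞ := by
  have := h.2
  rw [eLpNorm_lt_top_iff_lintegral_rpow_enorm_lt_top (by norm_num) (by norm_num)] at this
  simpa using this.ne

/-! ### Differentiability in L² of translations of Schwartz functions -/

section Schwartz

variable (e : Space)

/-- The mean value inequality is applied twice along the segment. The weight in x makes the Taylor
remainder O(t²) in L², not just pointwise. -/
theorem exists_taylor_bound (φ : 𝓢(Space, ℂ)) : ∃ C : ℝ, 0 ≤ C ∧ ∀ t : ℝ, |t| ≤ 1 → ∀ x : Space,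
    ‖φ (x - t • e) - φ x + t * ∂_{e} φ x‖ ≤ C * t ^ 2 * (1 + ‖x‖) ^ (-2 : ℝ) := by
  set χ : 𝓢(Space, ℂ) := ∂_{e} (∂_{e} φ) with hχ
  obtain ⟨M, hM0, hM⟩ : ∃ M : ℝ, 0 ≤ M ∧ ∀ y, (1 + ‖y‖) ^ 2 * ‖χ y‖ ≤ M := by
    have h := χ.one_add_le_sup_seminorm_apply (𝕜 := ℝ) (m := (2, 0)) (k := 2) (n := 0) le_rfl le_rfl
    simp only [norm_iteratedFDeriv_zero] at h
    exact ⟨_, (by positivity : 0 ≤ (1 + ‖(0 : Space)‖) ^ 2 * ‖χ 0‖).trans (h 0), h⟩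
  refine ⟨M * (1 + ‖e‖) ^ 2, by positivity, fun t ht x => ?_⟩
  set A := M * (1 + ‖e‖) ^ 2 * (1 + ‖x‖) ^ (-2 : ℝ) with hA
  have hA0 : 0 ≤ A := by positivity
  have hχA : ∀ s : ℝ, |s| ≤ 1 → ‖χ (x - s • e)‖ ≤ A := by
    intro s hs
    -- Moves the decay of the second derivative from x - s e back to x, at the cost of a factor
    -- depending on e only.
    have h1 : 1 + ‖x‖ ≤ (1 + ‖e‖) * (1 + ‖x - s • e‖) := by
      have : ‖x‖ ≤ ‖x - s • e‖ + ‖s • e‖ := by simpa using norm_add_le (x - s • e) (s • e)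
      rw [norm_smul, Real.norm_eq_abs] at this
      nlinarith [norm_nonneg e, norm_nonneg (x - s • e), mul_nonneg (norm_nonneg e) (norm_nonneg (x - s • e)),
        mul_le_mul_of_nonneg_right hs (norm_nonneg e)]
    have h2 := pow_le_pow_left₀ (by positivity) h1 2
    have h3 := hM (x - s • e)
    have h4 : 0 < (1 + ‖x‖) ^ 2 := by positivity
    have h5 : (1 + ‖x‖) ^ (-2 : ℝ) = ((1 + ‖x‖) ^ 2)⁻¹ := by
      rw [Real.rpow_neg (by positivity)]; norm_cast
    rw [hA, h5, ← div_eq_mul_inv, le_div_iff₀ h4]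
    calc ‖χ (x - s • e)‖ * (1 + ‖x‖) ^ 2 ≤ ‖χ (x - s • e)‖ * ((1 + ‖e‖) * (1 + ‖x - s • e‖)) ^ 2 := by
          gcongr
      _ = ((1 + ‖x - s • e‖) ^ 2 * ‖χ (x - s • e)‖) * (1 + ‖e‖) ^ 2 := by ring
      _ ≤ _ := by gcongr
  have hder : ∀ (f : 𝓢(Space, ℂ)) (s : ℝ), HasDerivAt (fun s : ℝ => f (x - s • e))
      (-(∂_{e} f (x - s • e))) s := by
    intro f s
    have h1 : HasDerivAt (fun s : ℝ => x - s • e) (-e) s := by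
      simpa using ((hasDerivAt_id s).smul_const e).const_sub x
    have h2 := (f.hasFDerivAt (x - s • e)).comp_hasDerivAt s h1
    rw [map_neg] at h2
    exact h2
  set I := Set.Icc (-|t|) |t| with hI
  have hIc : Convex ℝ I := convex_Icc _ _
  have h0I : (0 : ℝ) ∈ I := ⟨by simp, by simp⟩
  have htI : t ∈ I := ⟨neg_abs_le t, le_abs_self t⟩
  have hI1 : ∀ s ∈ I, |s| ≤ |t| := fun s hs => abs_le.2 hs
  have step1 : ∀ s ∈ I, ‖-(∂_{e} φ (x - s • e)) + ∂_{e} φ x‖ ≤ A * |t| := by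
    intro s hs
    have := hIc.norm_image_sub_le_of_norm_hasDerivWithin_le (C := A)
      (f := fun s : ℝ => ∂_{e} φ (x - s • e)) (f' := fun s => -(χ (x - s • e)))
      (fun s _ => (hder _ s).hasDerivWithinAt)
      (fun s hs => by rw [norm_neg]; exact hχA s ((hI1 s hs).trans ht)) h0I hs
    simp only [zero_smul, sub_zero, Real.norm_eq_abs] at this
    rw [← norm_neg, neg_add, neg_neg, ← sub_eq_add_neg]
    exact this.trans (mul_le_mul_of_nonneg_left (hI1 s hs) hA0)
  have := hIc.norm_image_sub_le_of_norm_hasDerivWithin_le (C := A * |t|)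
      (f := fun s : ℝ => φ (x - s • e) + s * ∂_{e} φ x)
      (f' := fun s => -(∂_{e} φ (x - s • e)) + ∂_{e} φ x)
      (fun s _ => by
        refine HasDerivAt.hasDerivWithinAt ((hder _ s).add ?_)
        simpa using (Complex.ofRealCLM.hasDerivAt (x := s)).mul_const (∂_{e} φ x))
      step1 h0I htI
  simp only [zero_smul, sub_zero, Complex.ofReal_zero, zero_mul, add_zero, Real.norm_eq_abs] at this
  calc _ = ‖φ (x - t • e) + t * ∂_{e} φ x - φ x‖ := by congr 1; ring
    _ ≤ A * |t| * |t| := this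
    _ = _ := by rw [mul_assoc, abs_mul_abs_self, hA]; ring

theorem memLp_one_add_norm : MemLp (fun x : Space => (1 + ‖x‖) ^ (-2 : ℝ)) 2 volume := by
  have hc : Continuous fun x : Space => (1 + ‖x‖) ^ (-2 : ℝ) :=
    (continuous_const.add continuous_norm).rpow_const fun x => Or.inl (ne_of_gt (by positivity : 0 < 1 + ‖x‖))
  rw [memLp_two_iff_integrable_sq hc.aestronglyMeasurable]
  -- The squared weight has exponent 4, which exceeds the dimension 3.
  have := integrable_one_add_norm (E := Space) (μ := volume) (r := 4) (by simp; norm_num)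
  refine this.congr (.of_forall fun x => ?_)
  simp only
  rw [← Real.rpow_natCast, ← Real.rpow_mul (by positivity)]
  norm_num

/-- The Schwartz function `φ(· - t e)`, as an element of `L²`. -/
noncomputable def shiftLp (φ : 𝓢(Space, ℂ)) (t : ℝ) : L2 :=
  (φ.compSubConstCLM ℂ (t • e)).toLp 2

theorem coeFn_shiftLp (φ : 𝓢(Space, ℂ)) (t : ℝ) :
    shiftLp e φ t =ᵐ[volume] fun x => φ (x - t • e) :=
  (φ.compSubConstCLM ℂ (t • e)).coeFn_toLp 2

theorem hasDerivAt_shiftLp_zero (φ : 𝓢(Space, ℂ)) :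
    HasDerivAt (shiftLp e φ) (-(∂_{e} φ).toLp 2) 0 := by
  obtain ⟨C, hC, h⟩ := exists_taylor_bound e φ
  have hbound : ∀ t : ℝ, |t| ≤ 1 → ‖shiftLp e φ t - shiftLp e φ 0 + t • (∂_{e} φ).toLp 2‖ ≤
      C * t ^ 2 * ‖memLp_one_add_norm.toLp‖ := by
    intro t ht
    refine Lp.norm_le_mul_norm_of_ae_le_mul ?_
    filter_upwards [memLp_one_add_norm.coeFn_toLp,
      Lp.coeFn_add (shiftLp e φ t - shiftLp e φ 0) (t • (∂_{e} φ).toLp 2),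
      Lp.coeFn_sub (shiftLp e φ t) (shiftLp e φ 0), Lp.coeFn_smul t ((∂_{e} φ).toLp 2),
      coeFn_shiftLp e φ t, coeFn_shiftLp e φ 0, (∂_{e} φ).coeFn_toLp 2] with x h1 h2 h3 h4 h5 h6 h7
    rw [h1, h2, Pi.add_apply, h3, Pi.sub_apply, h4, Pi.smul_apply, h5, h6, h7,
      Real.norm_of_nonneg (by positivity)]
    simpa using h t ht x
  have hO : (fun t => shiftLp e φ t - shiftLp e φ 0 + t • (∂_{e} φ).toLp 2) =O[nhds 0]
      fun t : ℝ => ‖t - 0‖ ^ 2 := by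
    refine Asymptotics.IsBigO.of_bound (C * ‖memLp_one_add_norm.toLp‖) ?_
    filter_upwards [Metric.closedBall_mem_nhds (0 : ℝ) one_pos] with t ht
    have := hbound t (by simpa using ht)
    simp only [sub_zero, norm_pow, Real.norm_eq_abs, sq_abs]
    linarith
  have h1 := (hO.hasFDerivAt (by norm_num)).hasDerivAt
  have h2 := ((hasDerivAt_id (0 : ℝ)).smul_const ((∂_{e} φ).toLp 2 : L2))
  have h3 := (h1.sub h2).add_const (shiftLp e φ 0)
  refine (h3.congr_deriv (by simp)).congr_of_eventuallyEq (.of_forall fun t => ?_)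
  simp

theorem shiftLp_add (φ : 𝓢(Space, ℂ)) (t s : ℝ) :
    shiftLp e φ (t + s) = shiftLp e (φ.compSubConstCLM ℂ (t • e)) s := by
  rw [shiftLp, shiftLp, SchwartzMap.compSubConstCLM_comp, add_smul]

theorem lineDeriv_compSubConst (φ : 𝓢(Space, ℂ)) (a : Space) :
    ∂_{e} (φ.compSubConstCLM ℂ a) = (∂_{e} φ).compSubConstCLM ℂ a := by
  ext x
  rw [SchwartzMap.compSubConstCLM_apply, SchwartzMap.lineDerivOp_apply_eq_fderiv,
    SchwartzMap.lineDerivOp_apply_eq_fderiv]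
  have : (φ.compSubConstCLM ℂ a : Space → ℂ) = fun x => φ (x - a) := rfl
  rw [this, fderiv_comp_sub]

/-- By the group law of translations, the derivative at t is the derivative at 0 for the function
already translated by t e. -/
theorem hasDerivAt_shiftLp (φ : 𝓢(Space, ℂ)) (t : ℝ) :
    HasDerivAt (shiftLp e φ) (-shiftLp e (∂_{e} φ) t) t := by
  have h := hasDerivAt_shiftLp_zero e (φ.compSubConstCLM ℂ (t • e))
  rw [lineDeriv_compSubConst] at h
  have h2 := HasDerivAt.comp_sub_const (x := t) (a := t) (by simpa using h)
  refine h2.congr_of_eventuallyEq (.of_forall fun s => ?_)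
  simp [← shiftLp_add]

theorem continuous_shiftLp (φ : 𝓢(Space, ℂ)) : Continuous (shiftLp e φ) :=
  continuous_iff_continuousAt.2 fun t => (hasDerivAt_shiftLp e φ t).continuousAt

end Schwartz

/-! ### Commutators with derivatives and increments of kernels -/

theorem derivGraph_toLp (j : Fin 3) (ψ : 𝓢(Space, ℂ)) :
    derivGraph j (ψ.toLp 2) ((∂_{EuclideanSpace.single j (1 : ℝ)} ψ).toLp 2) := by
  rw [derivGraph, Lp.toTemperedDistribution_toLp_eq, Lp.toTemperedDistribution_toLp_eq,
    TemperedDistribution.lineDerivOp_toTemperedDistributionCLM_eq]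

theorem inner_toLp (φ : 𝓢(Space, ℂ)) (f : L2) : ⟪φ.toLp 2, f⟫_ℂ = ∫ x, conj (φ x) * f x := by
  rw [L2.inner_def]
  refine integral_congr_ae ?_
  filter_upwards [φ.coeFn_toLp 2] with x hx
  rw [hx]
  simp [mul_comm]

theorem derivGraph.inner_eq {j : Fin 3} {f g : L2} (h : derivGraph j f g) (φ : 𝓢(Space, ℂ)) :
    ⟪φ.toLp 2, g⟫_ℂ = -⟪(∂_{EuclideanSpace.single j (1 : ℝ)} φ).toLp 2, f⟫_ℂ := by
  set e : Space := EuclideanSpace.single j (1 : ℝ) with he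
  set L : ℂ →L[ℝ] ℂ := Complex.conjCLE.toContinuousLinearMap with hL
  -- The distributional pairing is bilinear whereas the inner product conjugates its first argument,
  -- so the test function has to be conj φ.
  set χ : 𝓢(Space, ℂ) := φ.postcompCLM L with hχ
  have h1 : ∀ x, χ x = conj (φ x) := fun x => rfl
  have h2 : ∀ x, (∂_{e} χ) x = conj ((∂_{e} φ) x) := by
    intro x
    rw [SchwartzMap.lineDerivOp_apply_eq_fderiv, SchwartzMap.lineDerivOp_apply_eq_fderiv]
    have := (L.hasFDerivAt (x := φ x)).comp x (φ.hasFDerivAt x)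
    have h3 : (χ : Space → ℂ) = L ∘ φ := rfl
    rw [h3, this.fderiv]
    rfl
  have h3 := DFunLike.congr_fun h χ
  rw [TemperedDistribution.lineDerivOp_apply_apply, Lp.toTemperedDistribution_apply,
    Lp.toTemperedDistribution_apply] at h3
  rw [inner_toLp, inner_toLp, ← integral_neg]
  simp only [smul_eq_mul, h1] at h3
  rw [← h3]
  congr 1 with x
  rw [← h2, he]
  simp

/-- The product rule yields -⟪∂φ_t, B ψ_t⟫ - ⟪φ_t, B ∂ψ_t⟫, and the weak form of ∂(Bψ) = Cψ + B∂ψ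
collapses it to one term. This turns the commutator with an unbounded operator into an ordinary
derivative along translations. -/
theorem hasDerivAt_inner_shiftLp {j : Fin 3} {B C : L2 →L[ℂ] L2}
    (hC : IsCommutator (derivGraph j) B C) (φ ψ : 𝓢(Space, ℂ)) (t : ℝ) :
    HasDerivAt (fun t => ⟪shiftLp (EuclideanSpace.single j (1 : ℝ)) φ t,
        B (shiftLp (EuclideanSpace.single j (1 : ℝ)) ψ t)⟫_ℂ)
      ⟪shiftLp (EuclideanSpace.single j (1 : ℝ)) φ t,
        C (shiftLp (EuclideanSpace.single j (1 : ℝ)) ψ t)⟫_ℂ t := by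
  set e : Space := EuclideanSpace.single j (1 : ℝ) with he
  have h1 := hasDerivAt_shiftLp e φ t
  have h2 := ((B.restrictScalars ℝ).hasFDerivAt).comp_hasDerivAt t (hasDerivAt_shiftLp e ψ t)
  have h3 := h1.inner ℂ h2
  refine h3.congr_deriv ?_
  have h4 := hC _ _ (derivGraph_toLp j (ψ.compSubConstCLM ℂ (t • e)))
  have h5 := h4.inner_eq (φ.compSubConstCLM ℂ (t • e))
  rw [← he, lineDeriv_compSubConst, lineDeriv_compSubConst, inner_add_right] at h5
  change ⟪shiftLp e φ t, C (shiftLp e ψ t)⟫_ℂ + ⟪shiftLp e φ t, B (shiftLp e (∂_{e} ψ) t)⟫_ℂ =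
    -⟪shiftLp e (∂_{e} φ) t, B (shiftLp e ψ t)⟫_ℂ at h5
  simp only [ContinuousLinearMap.coe_restrictScalars', map_neg, inner_neg_right, inner_neg_left,
    Function.comp_apply]
  linear_combination -h5

theorem norm_tensor (φ ψ : L2) : ‖tensor φ ψ‖ = ‖φ‖ * ‖ψ‖ := by
  have h := inner_self_eq_norm_sq (𝕜 := ℂ) (tensor φ ψ)
  rw [inner_tensor, inner_self_eq_norm_sq_to_K, inner_self_eq_norm_sq_to_K] at h
  have h2 : (‖φ‖ * ‖ψ‖) ^ 2 = ‖tensor φ ψ‖ ^ 2 := by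
    rw [← h, mul_pow]; norm_cast
  exact ((pow_left_inj₀ (by positivity) (norm_nonneg _) two_ne_zero).1 h2).symm

theorem tensor_sub_left (φ φ' ψ : L2) : tensor (φ - φ') ψ = tensor φ ψ - tensor φ' ψ := by
  rw [tensor, tensor, tensor, ← MemLp.toLp_sub]
  refine MemLp.toLp_congr _ _ ?_
  have q1 := Measure.quasiMeasurePreserving_fst (μ := (volume : Measure Space))
    (ν := (volume : Measure Space)) |>.ae_eq_comp (Lp.coeFn_sub φ φ')
  filter_upwards [q1] with p hp
  simp only [Function.comp_apply, Pi.sub_apply] at hp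
  simp only [tensorFun, Pi.sub_apply, hp, sub_mul]

theorem tensor_sub_right (φ ψ ψ' : L2) : tensor φ (ψ - ψ') = tensor φ ψ - tensor φ ψ' := by
  rw [tensor, tensor, tensor, ← MemLp.toLp_sub]
  refine MemLp.toLp_congr _ _ ?_
  have q1 := Measure.quasiMeasurePreserving_snd (μ := (volume : Measure Space))
    (ν := (volume : Measure Space)) |>.ae_eq_comp (Lp.coeFn_sub ψ ψ')
  filter_upwards [q1] with p hp
  simp only [Function.comp_apply, Pi.sub_apply] at hp
  simp only [tensorFun, Pi.sub_apply, hp, map_sub, mul_sub]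

theorem continuous_tensor_left (ψ : L2) : Continuous fun φ => tensor φ ψ :=
  (LipschitzWith.of_dist_le_mul (K := ‖ψ‖₊) fun φ φ' => by
    rw [dist_eq_norm, dist_eq_norm, ← tensor_sub_left, norm_tensor, mul_comm]; rfl).continuous

theorem continuous_tensor_right (φ : L2) : Continuous fun ψ => tensor φ ψ :=
  (LipschitzWith.of_dist_le_mul (K := ‖φ‖₊) fun ψ ψ' => by
    rw [dist_eq_norm, dist_eq_norm, ← tensor_sub_right, norm_tensor]; rfl).continuous

theorem dense_schwartz (P : L2 → Prop) (hP : IsClosed {f | P f})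
    (h : ∀ φ : 𝓢(Space, ℂ), P (φ.toLp 2)) (f : L2) : P f :=
  (SchwartzMap.denseRange_toLpCLM (E := Space) (F := ℂ) (p := 2) (μ := volume)
    (by norm_num)).induction_on f hP h

theorem integrableOn_of_memLp_two {k : Space × Space → ℂ} (hk : MemLp k 2 volume)
    {D : Set (Space × Space)} (hD : Bornology.IsBounded D) : IntegrableOn k D := by
  have : IsFiniteMeasure ((volume : Measure (Space × Space)).restrict D) := ⟨by
      rw [Measure.restrict_apply_univ]; exact hD.measure_lt_top⟩
  exact (hk.restrict _).integrable (by norm_num)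

/-- The tensor product is continuous in each factor and Schwartz functions are dense, so k is
orthogonal to all tensors, in particular to indicators of bounded rectangles. -/
theorem ae_eq_zero_of_schwartz {k : Space × Space → ℂ} (hk : MemLp k 2 volume)
    (h : ∀ φ ψ : 𝓢(Space, ℂ), ∫ p : Space × Space, conj (φ p.1) * ψ p.2 * k p = 0) :
    k =ᵐ[volume] 0 := by
  have e : ∀ φ ψ : L2, ⟪tensor φ ψ, hk.toLp⟫_ℂ = ∫ p, conj (φ p.1) * ψ p.2 * k p := by
    intro φ ψ
    rw [inner_tensor_left]
    refine integral_congr_ae ?_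
    filter_upwards [hk.coeFn_toLp] with p hp
    rw [hp]
  have hz : ∀ φ ψ : L2, ⟪tensor φ ψ, hk.toLp⟫_ℂ = 0 := by
    refine dense_schwartz _ ?_ fun φ => dense_schwartz _ ?_ fun ψ => ?_
    · simp only [Set.ofPred_forall]
      refine isClosed_iInter fun ψ => ?_
      exact isClosed_eq ((continuous_tensor_left ψ).inner continuous_const) continuous_const
    · exact isClosed_eq ((continuous_tensor_right _).inner continuous_const) continuous_const
    · rw [e, ← h φ ψ]
      refine integral_congr_ae ?_
      have q1 := Measure.quasiMeasurePreserving_fst (μ := (volume : Measure Space))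
        (ν := (volume : Measure Space)) |>.ae_eq_comp (φ.coeFn_toLp 2)
      have q2 := Measure.quasiMeasurePreserving_snd (μ := (volume : Measure Space))
        (ν := (volume : Measure Space)) |>.ae_eq_comp (ψ.coeFn_toLp 2)
      filter_upwards [q1, q2] with p h1 h2
      simp only [Function.comp_apply] at h1 h2
      rw [h1, h2]
  refine ae_eq_zero_of_forall_setIntegral_prod_eq_zero
    (fun R => integrableOn_of_memLp_two hk (Metric.isBounded_ball.prod Metric.isBounded_ball))
    fun S T hS hT hSb hTb => ?_
  rw [← hz (indicatorConstLp 2 hS hSb.measure_lt_top.ne 1)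
    (indicatorConstLp 2 hT hTb.measure_lt_top.ne 1), e, ← integral_indicator (hS.prod hT)]
  refine integral_congr_ae ?_
  have q1 := Measure.quasiMeasurePreserving_fst (μ := (volume : Measure Space))
    (ν := (volume : Measure Space)) |>.ae_eq_comp
      (indicatorConstLp_coeFn (p := 2) (hs := hS) (hμs := hSb.measure_lt_top.ne) (c := (1 : ℂ)))
  have q2 := Measure.quasiMeasurePreserving_snd (μ := (volume : Measure Space))
    (ν := (volume : Measure Space)) |>.ae_eq_comp
      (indicatorConstLp_coeFn (p := 2) (hs := hT) (hμs := hTb.measure_lt_top.ne) (c := (1 : ℂ)))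
  filter_upwards [q1, q2] with p h1 h2
  simp only [Function.comp_apply] at h1 h2
  rw [h1, h2]
  by_cases hx : p.1 ∈ S <;> by_cases hy : p.2 ∈ T <;> simp [hx, hy, Set.indicator]

instance : (volume : Measure (Space × Space)).IsAddHaarMeasure :=
  inferInstanceAs ((volume : Measure Space).prod (volume : Measure Space)).IsAddHaarMeasure

theorem IsKernel.inner_shiftLp {T : L2 →L[ℂ] L2} {k : Space × Space → ℂ} (hk : IsKernel T k)
    (e : Space) (φ ψ : 𝓢(Space, ℂ)) (s : ℝ) :
    ⟪shiftLp e φ s, T (shiftLp e ψ s)⟫_ℂ =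
      ∫ p : Space × Space, conj (φ p.1) * ψ p.2 * k (p + s • (e, e)) := by
  rw [hk.inner_eq, ← integral_add_right_eq_self _ (s • (e, e))]
  refine integral_congr_ae ?_
  have mp : MeasurePreserving (fun p : Space × Space => p + s • (e, e)) volume volume :=
    measurePreserving_add_right _ _
  have q1 := (Measure.quasiMeasurePreserving_fst (μ := (volume : Measure Space))
    (ν := (volume : Measure Space))).comp mp.quasiMeasurePreserving |>.ae_eq_comp
      (coeFn_shiftLp e φ s)
  have q2 := (Measure.quasiMeasurePreserving_snd (μ := (volume : Measure Space))
    (ν := (volume : Measure Space))).comp mp.quasiMeasurePreserving |>.ae_eq_comp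
      (coeFn_shiftLp e ψ s)
  filter_upwards [q1, q2] with p h1 h2
  simp only [Function.comp_apply] at h1 h2
  rw [h1, h2]
  simp

/-- For almost every p, b(p + t ee) - b(p) is the integral of c(p + s ee) over 0 < s ≤ t, and
Cauchy–Schwarz in s gives the bound. Translating both test functions by s e translates the kernel by
s (e, e), so the identity, once tested, is the fundamental theorem of calculus for s ↦ ⟪φ_s, B ψ_s⟫.
-/
theorem kernel_sub_shift_sq_le {j : Fin 3} {B C : L2 →L[ℂ] L2} {b c : Space × Space → ℂ}
    (hC : IsCommutator (derivGraph j) B C) (hb : IsKernel B b) (hc : IsKernel C c) {t : ℝ}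
    (ht : 0 < t) {ee : Space × Space}
    (hee : ee = (EuclideanSpace.single j (1 : ℝ), EuclideanSpace.single j (1 : ℝ))) :
    ∀ᵐ p : Space × Space, ‖b (p + t • ee) - b p‖ₑ ^ 2 ≤
      ENNReal.ofReal t * ∫⁻ s in Set.Ioc 0 t, ‖c (p + s • ee)‖ₑ ^ 2 := by
  set ν := (volume : Measure ℝ).restrict (Set.Ioc 0 t) with hν
  have hν1 : ν Set.univ = ENNReal.ofReal t := by simp [hν]
  have hmeas : Measurable fun q : (Space × Space) × ℝ => c (q.1 + q.2 • ee) :=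
    hc.measurable.comp (measurable_fst.add (measurable_snd.smul_const ee))
  have hshift : ∀ s : ℝ, MeasurePreserving (fun p : Space × Space => p + s • ee) volume volume :=
    fun s => measurePreserving_add_right _ _
  set Nc := ∫⁻ p, ‖c p‖ₑ ^ 2 with hNc
  have hNc_ne : Nc ≠ ∞ := lintegral_sq_ne_top hc.memLp
  have hNs : ∀ s : ℝ, ∫⁻ p : Space × Space, ‖c (p + s • ee)‖ₑ ^ 2 = Nc := fun s =>
    lintegral_add_right_eq_self (fun p => ‖c p‖ₑ ^ 2) (s • ee)
  have hc2 : MemLp (fun q : (Space × Space) × ℝ => c (q.1 + q.2 • ee)) 2 (volume.prod ν) := by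
    refine memLp_two_of_lintegral hmeas.aestronglyMeasurable ?_
    rw [lintegral_prod_symm _ (hmeas.enorm.pow_const 2).aemeasurable]
    simp only [hNs, lintegral_const, hν1]
    exact ENNReal.mul_ne_top hNc_ne ENNReal.ofReal_ne_top
  set D : Space × Space → ℂ := fun p => ∫ s, c (p + s • ee) ∂ν with hD
  have hDm : StronglyMeasurable D := hmeas.stronglyMeasurable.integral_prod_right
  have hDle : ∀ p, ‖D p‖ₑ ^ 2 ≤ ENNReal.ofReal t * ∫⁻ s, ‖c (p + s • ee)‖ₑ ^ 2 ∂ν := by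
    intro p
    rw [← hν1]
    exact enorm_integral_sq_le (hmeas.comp measurable_prodMk_left).aestronglyMeasurable
  have hD2 : MemLp D 2 volume := by
    refine memLp_two_of_lintegral hDm.aestronglyMeasurable
      (ne_top_of_le_ne_top ?_ (lintegral_mono hDle))
    rw [lintegral_const_mul _ (hmeas.enorm.pow_const 2).lintegral_prod_right',
      lintegral_lintegral_swap (hmeas.enorm.pow_const 2).aemeasurable]
    simp only [hNs, lintegral_const, hν1]
    exact ENNReal.mul_ne_top ENNReal.ofReal_ne_top (ENNReal.mul_ne_top hNc_ne ENNReal.ofReal_ne_top)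
  have hbt : MemLp (fun p => b (p + t • ee)) 2 volume := hb.memLp.comp_measurePreserving (hshift t)
  -- All three terms are square integrable, so testing against products of Schwartz functions is
  -- enough; Fubini exchanges the s-integral with the pairing.
  have hz : (fun p => b (p + t • ee) - b p - D p) =ᵐ[volume] 0 := by
    refine ae_eq_zero_of_schwartz ((hbt.sub hb.memLp).sub hD2) fun φ ψ => ?_
    have hφψ : MemLp (fun p : Space × Space => conj (φ p.1) * ψ p.2) 2 volume := by
      have := memLp_tensorFun (φ.toLp 2) (ψ.toLp 2)
      have q1 := Measure.quasiMeasurePreserving_fst (μ := (volume : Measure Space))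
        (ν := (volume : Measure Space)) |>.ae_eq_comp (φ.coeFn_toLp 2)
      have q2 := Measure.quasiMeasurePreserving_snd (μ := (volume : Measure Space))
        (ν := (volume : Measure Space)) |>.ae_eq_comp (ψ.coeFn_toLp 2)
      refine (memLp_congr_norm (((RCLike.continuous_conj.comp (φ.continuous.comp
        continuous_fst)).mul (ψ.continuous.comp continuous_snd)).aestronglyMeasurable)
        this.1 ?_).2 this
      filter_upwards [q1, q2] with p h1 h2
      simp only [Function.comp_apply] at h1 h2
      simp [tensorFun, h1, h2]
    have i1 : Integrable fun p : Space × Space => conj (φ p.1) * ψ p.2 * b (p + t • ee) :=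
      hφψ.integrable_mul hbt
    have i2 : Integrable fun p : Space × Space => conj (φ p.1) * ψ p.2 * b p :=
      hφψ.integrable_mul hb.memLp
    have i3 : Integrable fun p : Space × Space => conj (φ p.1) * ψ p.2 * D p :=
      hφψ.integrable_mul hD2
    have i4 : Integrable (fun q : (Space × Space) × ℝ =>
        conj (φ q.1.1) * ψ q.1.2 * c (q.1 + q.2 • ee)) (volume.prod ν) :=
      (hφψ.comp_fst ν).integrable_mul hc2
    have hftc := intervalIntegral.integral_eq_sub_of_hasDerivAt (a := 0) (b := t)
      (fun s _ => hasDerivAt_inner_shiftLp hC φ ψ s) (by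
        refine Continuous.intervalIntegrable ?_ _ _
        exact (continuous_shiftLp _ φ).inner (C.continuous.comp (continuous_shiftLp _ ψ)))
    simp only [hb.inner_shiftLp, hc.inner_shiftLp, ← hee] at hftc
    rw [intervalIntegral.integral_of_le ht.le, ← integral_integral_swap i4] at hftc
    simp only [integral_const_mul] at hftc
    simp only [mul_sub]
    have h12 := integral_sub (i1.sub i2) i3
    simp only [Pi.sub_apply] at h12
    rw [h12, integral_sub i1 i2, hftc]
    simp
  filter_upwards [hz] with p hp
  have : b (p + t • ee) - b p = D p := by simpa [sub_eq_zero] using hp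
  rw [this]
  exact hDle p

/-! ### Hardy's inequality from difference quotients -/

open Filter Topology

/-- With p = (b - a)/t and X = (a + b)u this is pX ≤ 2p² + X²/8 followed by (a + b)² ≤ 2(a² + b²).
The weights are chosen so that Hardy's argument can absorb the last term. -/
theorem sq_sub_sq_mul_div_le {a b d u t : ℝ} (ht : 0 < t) (hd : |a - b| ≤ d) :
    (b ^ 2 - a ^ 2) * u / t ≤ 2 / t ^ 2 * d ^ 2 + 1 / 4 * (a ^ 2 * u ^ 2 + b ^ 2 * u ^ 2) := by
  set p := (b - a) / t with hp
  have h1 : (b ^ 2 - a ^ 2) * u / t = p * ((a + b) * u) := by rw [hp]; ring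
  have h2 : p ^ 2 ≤ d ^ 2 / t ^ 2 := by
    rw [hp, div_pow]
    refine div_le_div_of_nonneg_right ?_ (by positivity)
    rw [← sq_abs (b - a), abs_sub_comm]
    exact pow_le_pow_left₀ (abs_nonneg _) hd 2
  have h3 : 2 / t ^ 2 * d ^ 2 = 2 * (d ^ 2 / t ^ 2) := by ring
  rw [h1, h3]
  nlinarith [sq_nonneg (4 * p - (a + b) * u), sq_nonneg ((a - b) * u)]

/-- Integration by parts without a weak derivative of f: the difference quotient of φ is shifted
onto |f|², estimated by `sq_sub_sq_mul_div_le`, and n → ∞ is taken by dominated convergence. The two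
terms of weight 1/4 merge into one of weight 1/2. -/
theorem integral_mul_lineDeriv_le {f : Space → ℂ} (hf : MemLp f 2 volume) {e : Space} {Γ : ℝ}
    {τ : ℕ → ℝ} (hτ : Tendsto τ atTop (𝓝 0)) (hτ0 : ∀ n, 0 < τ n)
    (hfd : ∀ n, ∫ x, ‖f (x + τ n • e) - f x‖ ^ 2 ≤ τ n ^ 2 * Γ)
    {φ φ' : Space → ℝ} (hφ : Continuous φ) (hd : ∀ x s, HasDerivAt (fun s : ℝ => φ (x + s • e)) (φ' (x + s • e)) s)
    {M L : ℝ} (hM : ∀ x, |φ x| ≤ M) (hL : ∀ x, |φ' x| ≤ L) :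
    ∫ x, ‖f x‖ ^ 2 * φ' x ≤ 2 * Γ + 1 / 2 * ∫ x, ‖f x‖ ^ 2 * φ x ^ 2 := by
  set w : Space → ℝ := fun x => ‖f x‖ ^ 2 with hw
  have hwi : Integrable w := hf.integrable_norm_pow (by norm_num)
  have hlip : ∀ x s, |φ (x + s • e) - φ x| ≤ L * |s| := by
    intro x s
    have := convex_univ.norm_image_sub_le_of_norm_hasDerivWithin_le (C := L)
      (f := fun s : ℝ => φ (x + s • e)) (f' := fun s => φ' (x + s • e)) (x := 0) (y := s)
      (fun s _ => (hd x s).hasDerivWithinAt) (fun s _ => hL _) trivial trivial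
    simpa using this
  have hb : ∀ {ψ : Space → ℝ} {K : ℝ}, Continuous ψ → (∀ x, |ψ x| ≤ K) →
      Integrable fun x => w x * ψ x := fun {ψ K} hψ hK =>
    hwi.mul_bdd (c := K) hψ.aestronglyMeasurable (.of_forall fun x => hK x)
  have hbs : ∀ {ψ : Space → ℝ} {K : ℝ} (a : Space), Continuous ψ → (∀ x, |ψ x| ≤ K) →
      Integrable fun x => w (x + a) * ψ x := fun {ψ K} a hψ hK =>
    (hwi.comp_add_right a).mul_bdd (c := K) hψ.aestronglyMeasurable (.of_forall fun x => hK x)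
  have hshift : ∀ (ψ : Space → ℝ) (a : Space), ∫ x, w (x + a) * ψ x = ∫ x, w x * ψ (x - a) := by
    intro ψ a
    rw [← integral_add_right_eq_self (fun x => w x * ψ (x - a)) a]
    simp
  have hM2 : ∀ x, |φ x ^ 2| ≤ M ^ 2 := fun x => by
    rw [abs_pow]; exact pow_le_pow_left₀ (abs_nonneg _) (hM x) 2
  have hφ2 : Continuous fun x => φ x ^ 2 := hφ.pow 2
  have hsub : ∀ a : Space, Continuous fun x => φ (x - a) := fun a => hφ.comp (continuous_sub_right a)
  have step : ∀ n, ∫ x, w x * ((φ x - φ (x - τ n • e)) / τ n) ≤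
      2 * Γ + 1 / 4 * ((∫ x, w x * φ (x - τ n • e) ^ 2) + ∫ x, w x * φ x ^ 2) := by
    intro n
    set t := τ n with ht
    have ht0 : 0 < t := hτ0 n
    have e1 : ∫ x, w x * ((φ x - φ (x - t • e)) / t) = ∫ x, (w x - w (x + t • e)) * φ x / t := by
      have h1 : ∀ x, w x * ((φ x - φ (x - t • e)) / t) = (w x * φ x - w x * φ (x - t • e)) / t :=
        fun x => by ring
      have h2 : ∀ x, (w x - w (x + t • e)) * φ x / t = (w x * φ x - w (x + t • e) * φ x) / t :=
        fun x => by ring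
      simp only [h1, h2, integral_div]
      rw [integral_sub (hb hφ hM) (hb (hsub _) fun x => hM _), integral_sub (hb hφ hM) (hbs _ hφ hM),
        hshift]
    have e2 : (∫ x, w x * φ (x - t • e) ^ 2) = ∫ x, w (x + t • e) * φ x ^ 2 :=
      (hshift (fun x => φ x ^ 2) _).symm
    have hΔ : Integrable fun x => ‖f (x + t • e) - f x‖ ^ 2 :=
      ((hf.comp_measurePreserving (measurePreserving_add_right _ (t • e))).sub hf).integrable_norm_pow
        (by norm_num)
    have hS : Integrable fun x => w (x + t • e) * φ x ^ 2 + w x * φ x ^ 2 :=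
      (hbs _ hφ2 hM2).add (hb hφ2 hM2)
    have hD : Integrable fun x => (w x - w (x + t • e)) * φ x / t := by
      refine (((hb hφ hM).sub (hbs (t • e) hφ hM)).div_const t).congr (.of_forall fun x => ?_)
      simp [sub_mul]
    rw [e1, e2]
    calc ∫ x, (w x - w (x + t • e)) * φ x / t
        ≤ ∫ x, (2 / t ^ 2 * ‖f (x + t • e) - f x‖ ^ 2 +
            1 / 4 * (w (x + t • e) * φ x ^ 2 + w x * φ x ^ 2)) := by
          refine integral_mono hD ((hΔ.const_mul _).add (hS.const_mul _)) fun x => ?_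
          exact sq_sub_sq_mul_div_le ht0 (abs_norm_sub_norm_le _ _)
      _ = 2 / t ^ 2 * (∫ x, ‖f (x + t • e) - f x‖ ^ 2) +
            1 / 4 * ((∫ x, w (x + t • e) * φ x ^ 2) + ∫ x, w x * φ x ^ 2) := by
          rw [integral_add (hΔ.const_mul _) (hS.const_mul _),
            integral_const_mul, integral_const_mul, integral_add (hbs _ hφ2 hM2) (hb hφ2 hM2)]
      _ ≤ _ := by
          have := mul_le_mul_of_nonneg_left (hfd n) (by positivity : 0 ≤ 2 / t ^ 2)
          have h3 : 2 / t ^ 2 * (t ^ 2 * Γ) = 2 * Γ := by field_simp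
          linarith
  have hτe : Tendsto (fun n => τ n • e) atTop (𝓝 0) := by
    simpa using hτ.smul_const e
  have lim1 : Tendsto (fun n => ∫ x, w x * ((φ x - φ (x - τ n • e)) / τ n)) atTop
      (𝓝 (∫ x, w x * φ' x)) := by
    refine tendsto_integral_of_dominated_convergence (fun x => w x * L) (fun n => ?_)
      (hwi.mul_const L) (fun n => .of_forall fun x => ?_) (.of_forall fun x => ?_)
    · exact hwi.1.mul ((hφ.sub (hsub _)).div_const _).aestronglyMeasurable
    · rw [norm_mul, Real.norm_of_nonneg (by positivity)]
      refine mul_le_mul_of_nonneg_left ?_ (by positivity)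
      rw [Real.norm_eq_abs, abs_div, abs_of_pos (hτ0 n), div_le_iff₀ (hτ0 n), abs_sub_comm]
      have := hlip x (-τ n)
      rwa [abs_neg, abs_of_pos (hτ0 n), neg_smul, ← sub_eq_add_neg] at this
    · refine Tendsto.const_mul _ ?_
      have h1 := (hd x 0).tendsto_slope
      simp only [zero_smul, add_zero] at h1
      have h2 : Tendsto (fun n => -τ n) atTop (𝓝[≠] 0) := by
        refine tendsto_nhdsWithin_iff.2 ⟨by simpa using hτ.neg, .of_forall fun n => ?_⟩
        simpa using (hτ0 n).ne'
      refine (h1.comp h2).congr fun n => ?_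
      simp only [Function.comp_apply, slope_def_field, zero_smul, add_zero, neg_smul, sub_zero,
        ← sub_eq_add_neg]
      rw [div_neg, ← neg_div, neg_sub]
  have lim2 : Tendsto (fun n => ∫ x, w x * φ (x - τ n • e) ^ 2) atTop (𝓝 (∫ x, w x * φ x ^ 2)) := by
    refine tendsto_integral_of_dominated_convergence (fun x => w x * M ^ 2) (fun n => ?_)
      (hwi.mul_const _) (fun n => .of_forall fun x => ?_) (.of_forall fun x => ?_)
    · exact hwi.1.mul ((hsub _).pow 2).aestronglyMeasurable
    · rw [norm_mul, Real.norm_of_nonneg (by positivity)]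
      exact mul_le_mul_of_nonneg_left (hM2 _) (by positivity)
    · refine Tendsto.const_mul _ (Tendsto.pow ?_ 2)
      have : Tendsto (fun n => x - τ n • e) atTop (𝓝 (x - 0)) := hτe.const_sub x
      rw [sub_zero] at this
      exact (hφ.tendsto x).comp this
  have := le_of_tendsto_of_tendsto' lim1 (((lim2.add_const _).const_mul (1 / 4)).const_add (2 * Γ)) step
  linarith

/-- The components of y/(|y|² + ε), a bounded regularization of the vector field y/|y|² that proves
Hardy's inequality. -/
theorem hasDerivAt_coord_div (y : Space) (j : Fin 3) {ε : ℝ} (hε : 0 < ε) (s : ℝ) :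
    HasDerivAt (fun s : ℝ => (y + s • EuclideanSpace.single j (1 : ℝ)) j /
        (‖y + s • EuclideanSpace.single j (1 : ℝ)‖ ^ 2 + ε))
      (1 / (‖y + s • EuclideanSpace.single j (1 : ℝ)‖ ^ 2 + ε) -
        2 * (y + s • EuclideanSpace.single j (1 : ℝ)) j ^ 2 /
          (‖y + s • EuclideanSpace.single j (1 : ℝ)‖ ^ 2 + ε) ^ 2) s := by
  set e : Space := EuclideanSpace.single j (1 : ℝ) with he
  have h1 : HasDerivAt (fun s : ℝ => y + s • e) e s := by
    simpa using ((hasDerivAt_id s).smul_const e).const_add y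
  have h2 : HasDerivAt (fun s : ℝ => (y + s • e) j) 1 s := by
    have := (EuclideanSpace.proj (𝕜 := ℝ) j).hasFDerivAt.comp_hasDerivAt s h1
    refine this.congr_deriv ?_
    simp [he]
  have h3 := (h1.norm_sq).add_const ε
  have h4 : ⟪y + s • e, e⟫_ℝ = (y + s • e) j := by
    rw [he, EuclideanSpace.inner_single_right]; simp
  rw [h4] at h3
  have h0 : ‖y + s • e‖ ^ 2 + ε ≠ 0 := by positivity
  refine (h2.div h3 h0).congr_deriv ?_
  field_simp

theorem sq_coord_le (y : Space) (j : Fin 3) : y j ^ 2 ≤ ‖y‖ ^ 2 := by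
  rw [EuclideanSpace.real_norm_sq_eq]
  exact Finset.single_le_sum (f := fun i => y i ^ 2) (fun i _ => sq_nonneg _) (Finset.mem_univ j)

/-- Regularized Hardy inequality, for functions with bounded difference quotients. -/
theorem integral_div_le {f : Space → ℂ} (hf : MemLp f 2 volume) {Γ : Fin 3 → ℝ}
    {τ : ℕ → ℝ} (hτ : Tendsto τ atTop (𝓝 0)) (hτ0 : ∀ n, 0 < τ n)
    (hfd : ∀ j n, ∫ x, ‖f (x + τ n • EuclideanSpace.single j (1 : ℝ)) - f x‖ ^ 2 ≤ τ n ^ 2 * Γ j)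
    (p : Space) {ε : ℝ} (hε : 0 < ε) (hε1 : ε ≤ 1) :
    ∫ x, ‖f x‖ ^ 2 * (1 / (‖x - p‖ ^ 2 + ε)) ≤ 4 * ∑ j, Γ j := by
  set w : Space → ℝ := fun x => ‖f x‖ ^ 2 with hw
  have hwi : Integrable w := hf.integrable_norm_pow (by norm_num)
  set q : Space → ℝ := fun x => ‖x - p‖ ^ 2 + ε with hq
  have hq0 : ∀ x, 0 < q x := fun x => by positivity
  have hqc : Continuous q := ((continuous_id.sub continuous_const).norm.pow 2).add continuous_const
  have hxc : ∀ j : Fin 3, Continuous fun x : Space => (x - p) j := fun j =>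
    (EuclideanSpace.proj (𝕜 := ℝ) j).continuous.comp (continuous_id.sub continuous_const)
  have hle : ∀ j x, (x - p) j ^ 2 ≤ q x := fun j x => by
    have := sq_coord_le (x - p) j
    simp only [hq]; linarith
  have hqε : ∀ x, ε ≤ q x := fun x => by simp only [hq]; nlinarith [sq_nonneg ‖x - p‖]
  have hb1 : ∀ j x, |(x - p) j / q x| ≤ 1 / ε := by
    intro j x
    rw [abs_div, abs_of_pos (hq0 x), div_le_div_iff₀ (hq0 x) hε]
    have h1 : |(x - p) j| ^ 2 ≤ ‖x - p‖ ^ 2 := by rw [sq_abs]; exact sq_coord_le _ _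
    simp only [hq]
    -- The smallness ε ≤ 1 makes the crude bound 1/ε valid; it serves integrability only and drops
    -- out of the result.
    nlinarith [sq_nonneg (|(x - p) j| - 1), abs_nonneg ((x - p) j), sq_nonneg (ε - |(x - p) j|)]
  have hb2 : ∀ j x, |1 / q x - 2 * (x - p) j ^ 2 / q x ^ 2| ≤ 1 / ε := by
    intro j x
    have h1 : 2 * (x - p) j ^ 2 / q x ^ 2 = 2 * ((x - p) j ^ 2 / q x) * (1 / q x) := by
      field_simp
    have h2 : (x - p) j ^ 2 / q x ≤ 1 := (div_le_one (hq0 x)).2 (hle j x)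
    have h3 : 0 ≤ (x - p) j ^ 2 / q x := div_nonneg (sq_nonneg _) (hq0 x).le
    have h4 : 1 / q x ≤ 1 / ε := one_div_le_one_div_of_le hε (hqε x)
    have h5 : 0 < 1 / q x := one_div_pos.2 (hq0 x)
    rw [h1, abs_le]
    constructor <;> nlinarith
  have key : ∀ j, ∫ x, w x * (1 / q x - 2 * (x - p) j ^ 2 / q x ^ 2) ≤
      2 * Γ j + 1 / 2 * ∫ x, w x * ((x - p) j / q x) ^ 2 := by
    intro j
    refine integral_mul_lineDeriv_le hf hτ hτ0 (hfd j) (φ := fun x => (x - p) j / q x)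
      (φ' := fun x => 1 / q x - 2 * (x - p) j ^ 2 / q x ^ 2)
      ((hxc j).div hqc fun x => (hq0 x).ne') (fun x s => ?_) (hb1 j) (hb2 j)
    have := hasDerivAt_coord_div (x - p) j hε s
    simpa only [hq, add_sub_right_comm] using this
  have hb : ∀ {ψ : Space → ℝ} {K : ℝ}, Continuous ψ → (∀ x, |ψ x| ≤ K) →
      Integrable fun x => w x * ψ x := fun {ψ K} hψ hK =>
    hwi.mul_bdd (c := K) hψ.aestronglyMeasurable (.of_forall fun x => hK x)
  have hi1 : ∀ j, Integrable fun x => w x * (1 / q x - 2 * (x - p) j ^ 2 / q x ^ 2) := fun j =>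
    hb ((continuous_const.div hqc fun x => (hq0 x).ne').sub
      ((continuous_const.mul ((hxc j).pow 2)).div (hqc.pow 2) fun x => (pow_pos (hq0 x) 2).ne')) (hb2 j)
  have hi2 : ∀ j, Integrable fun x => w x * ((x - p) j / q x) ^ 2 := fun j =>
    hb (K := (1 / ε) ^ 2) (((hxc j).div hqc fun x => (hq0 x).ne').pow 2) fun x => by
      rw [abs_pow]; exact pow_le_pow_left₀ (abs_nonneg _) (hb1 j x) 2
  have hi3 : Integrable fun x => w x * (1 / q x) :=
    hb (K := 1 / ε) (continuous_const.div hqc fun x => (hq0 x).ne') fun x => by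
      rw [abs_of_pos (one_div_pos.2 (hq0 x))]; exact one_div_le_one_div_of_le hε (hqε x)
  have hsum := Finset.sum_le_sum fun j (_ : j ∈ Finset.univ) => key j
  rw [Finset.sum_add_distrib, ← Finset.mul_sum, ← Finset.mul_sum, ← integral_finsetSum _ fun j _ => hi1 j,
    ← integral_finsetSum _ fun j _ => hi2 j] at hsum
  have hn : ∀ x : Space, ‖x - p‖ ^ 2 = ∑ j, (x - p) j ^ 2 := fun x =>
    EuclideanSpace.real_norm_sq_eq _
  -- In dimension 3 the divergence of the field is 3/q - 2|x-p|²/q² = 1/q + 2ε/q², hence at least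
  -- 1/q.
  have l1 : ∫ x, w x * (1 / q x) ≤ ∫ x, ∑ j, w x * (1 / q x - 2 * (x - p) j ^ 2 / q x ^ 2) := by
    refine integral_mono hi3 (integrable_finsetSum _ fun j _ => hi1 j) fun x => ?_
    simp only
    rw [← Finset.mul_sum]
    refine mul_le_mul_of_nonneg_left ?_ (by positivity)
    have hs : ∑ j, (1 / q x - 2 * (x - p) j ^ 2 / q x ^ 2) =
        ((3 : ℕ) : ℝ) * (1 / q x) - 2 * ‖x - p‖ ^ 2 / q x ^ 2 := by
      rw [hn, Finset.sum_sub_distrib, Finset.mul_sum, Finset.sum_div]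
      simp
    rw [hs]
    rw [div_le_iff₀ (hq0 x)]
    have h1 : ‖x - p‖ ^ 2 = q x - ε := by simp [hq]
    rw [h1]
    have h2 : ε / q x ≥ 0 := div_nonneg hε.le (hq0 x).le
    have h3 : (((3 : ℕ) : ℝ) * (1 / q x) - 2 * (q x - ε) / q x ^ 2) * q x = 1 + 2 * (ε / q x) := by
      have := (hq0 x).ne'
      field_simp
      push_cast
      ring
    rw [h3]; linarith
  -- The squared length of the field is at most 1/q. With `l1` the inequality reads Y ≤ 2 ∑ Γ + Y/2
  -- for the finite integral Y = ∫ w/q, whence the constant 4.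
  have l2 : ∫ x, ∑ j, w x * ((x - p) j / q x) ^ 2 ≤ ∫ x, w x * (1 / q x) := by
    refine integral_mono (integrable_finsetSum _ fun j _ => hi2 j) hi3 fun x => ?_
    simp only
    rw [← Finset.mul_sum]
    refine mul_le_mul_of_nonneg_left ?_ (by positivity)
    simp only [div_pow]
    rw [← Finset.sum_div, ← hn, div_le_div_iff₀ (pow_pos (hq0 x) 2) (hq0 x)]
    have : ‖x - p‖ ^ 2 ≤ q x := by simp only [hq]; linarith
    nlinarith [hq0 x]
  linarith

/-- Hardy's inequality around an arbitrary point `p`. -/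
theorem lintegral_mul_inv_sq_le {f : Space → ℂ} (hfm : Measurable f) (hf : MemLp f 2 volume) {Γ : Fin 3 → ℝ}
    {τ : ℕ → ℝ} (hτ : Tendsto τ atTop (𝓝 0)) (hτ0 : ∀ n, 0 < τ n)
    (hfd : ∀ j n, ∫ x, ‖f (x + τ n • EuclideanSpace.single j (1 : ℝ)) - f x‖ ^ 2 ≤ τ n ^ 2 * Γ j)
    (p : Space) : ∫⁻ x, ‖f x‖ₑ ^ 2 * (‖x - p‖ₑ⁻¹) ^ 2 ≤ ENNReal.ofReal (4 * ∑ j, Γ j) := by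
  set ε : ℕ → ℝ := fun n => 1 / ((n : ℝ) + 1) with hε
  have hε0 : ∀ n, 0 < ε n := fun n => by positivity
  have hε1 : ∀ n, ε n ≤ 1 := fun n => by
    rw [hε]; simp only; rw [div_le_one (by positivity)]; linarith [(Nat.cast_nonneg n : (0 : ℝ) ≤ n)]
  have hεt : Tendsto ε atTop (𝓝 0) := tendsto_one_div_add_atTop_nhds_zero_nat
  have hwi : Integrable fun x => ‖f x‖ ^ 2 := hf.integrable_norm_pow (by norm_num)
  have hqc : ∀ n, Continuous fun x => 1 / (‖x - p‖ ^ 2 + ε n) := fun n =>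
    continuous_const.div (((continuous_id.sub continuous_const).norm.pow 2).add continuous_const)
      fun x => by have := hε0 n; positivity
  have hb : ∀ n, ∫⁻ x, ENNReal.ofReal (‖f x‖ ^ 2 * (1 / (‖x - p‖ ^ 2 + ε n))) ≤
      ENNReal.ofReal (4 * ∑ j, Γ j) := by
    intro n
    have := hε0 n
    rw [← ofReal_integral_eq_lintegral_ofReal]
    · exact ENNReal.ofReal_le_ofReal (integral_div_le hf hτ hτ0 hfd p (hε0 n) (hε1 n))
    · refine hwi.mul_bdd (c := 1 / ε n) (hqc n).aestronglyMeasurable (.of_forall fun x => ?_)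
      rw [Real.norm_of_nonneg (by positivity)]
      exact one_div_le_one_div_of_le this (by nlinarith [sq_nonneg ‖x - p‖])
    · exact .of_forall fun x => by positivity
  have hlim : ∀ᵐ x : Space, ‖f x‖ₑ ^ 2 * (‖x - p‖ₑ⁻¹) ^ 2 ≤
      liminf (fun n => ENNReal.ofReal (‖f x‖ ^ 2 * (1 / (‖x - p‖ ^ 2 + ε n)))) atTop := by
    have : ∀ᵐ x : Space, x ≠ p := by simp [ae_iff]
    filter_upwards [this] with x hx
    have hx0 : 0 < ‖x - p‖ := norm_pos_iff.2 (sub_ne_zero.2 hx)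
    have h1 : Tendsto (fun n => ENNReal.ofReal (‖f x‖ ^ 2 * (1 / (‖x - p‖ ^ 2 + ε n)))) atTop
        (𝓝 (ENNReal.ofReal (‖f x‖ ^ 2 * (1 / (‖x - p‖ ^ 2 + 0))))) := by
      refine ENNReal.tendsto_ofReal (Tendsto.const_mul _ (Tendsto.div tendsto_const_nhds
        (hεt.const_add _) ?_))
      positivity
    rw [h1.liminf_eq, ENNReal.ofReal_mul (by positivity), ENNReal.ofReal_pow (norm_nonneg _),
      ofReal_norm, add_zero, one_div, ENNReal.ofReal_inv_of_pos (by positivity),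
      ENNReal.ofReal_pow (norm_nonneg _), ofReal_norm, ENNReal.inv_pow]
  -- Fatou's lemma removes the regularization.
  calc _ ≤ ∫⁻ x, liminf (fun n => ENNReal.ofReal (‖f x‖ ^ 2 * (1 / (‖x - p‖ ^ 2 + ε n)))) atTop :=
        lintegral_mono_ae hlim
    _ ≤ liminf (fun n => ∫⁻ x, ENNReal.ofReal (‖f x‖ ^ 2 * (1 / (‖x - p‖ ^ 2 + ε n)))) atTop :=
        lintegral_liminf_le fun n => ((hfm.norm.pow_const 2).mul (hqc n).measurable).ennreal_ofReal
    _ ≤ _ := liminf_le_of_frequently_le' (Frequently.of_forall hb)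

/-! ### Radial integrals and the composition of two kernels |x|⁻² -/

/-- The constant in the integrals of `|x|⁻²` near the origin and of `|x|⁻⁴` away from it. -/
noncomputable def radialConst : ℝ := 3 * (volume : Measure Space).real (Metric.ball 0 1)

theorem lintegral_radial {g : ℝ → ℝ} (hg : ∀ y, 0 ≤ g y)
    (hi : IntegrableOn (fun y => y ^ 2 * g y) (Set.Ioi 0)) :
    ∫⁻ x : Space, ENNReal.ofReal (g ‖x‖) =
      ENNReal.ofReal (radialConst * ∫ y in Set.Ioi (0 : ℝ), y ^ 2 * g y) := by
  have hfr : Module.finrank ℝ Space = 3 := by simp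
  have h1 : Integrable (fun x : Space => g ‖x‖) := by
    rw [integrable_fun_norm_addHaar (volume : Measure Space) (f := g), hfr]
    simpa using hi
  rw [← ofReal_integral_eq_lintegral_ofReal h1 (.of_forall fun x => hg _),
    integral_fun_norm_addHaar (volume : Measure Space) g, hfr]
  simp [radialConst, mul_assoc]

theorem lintegral_ball_inv_sq {ρ : ℝ} (hρ : 0 < ρ) :
    ∫⁻ x in Metric.ball (0 : Space) ρ, (‖x‖ₑ⁻¹) ^ 2 = ENNReal.ofReal (radialConst * ρ) := by
  set g : ℝ → ℝ := (Set.Iio ρ).indicator fun y => (y ^ 2)⁻¹ with hg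
  have e : (Set.Ioi (0 : ℝ)).EqOn (fun y => y ^ 2 * g y) ((Set.Ioo 0 ρ).indicator fun _ => 1) := by
    intro y hy
    have hy : 0 < y := hy
    by_cases h : y < ρ
    · simp [hg, h, hy, Set.indicator]
      field_simp
    · simp [hg, h, Set.indicator]
  have hi : IntegrableOn (fun y => y ^ 2 * g y) (Set.Ioi 0) := by
    rw [integrableOn_congr_fun e measurableSet_Ioi]
    refine Integrable.integrableOn ?_
    rw [integrable_indicator_iff measurableSet_Ioo]
    exact integrableOn_const (by simp) (by simp)
  have h := lintegral_radial (g := g) (fun y => Set.indicator_nonneg (fun y _ => by positivity) y) hi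
  rw [setIntegral_congr_fun measurableSet_Ioi e, setIntegral_indicator measurableSet_Ioo,
    Set.inter_eq_right.2 Set.Ioo_subset_Ioi_self] at h
  simp only [integral_const, MeasurableSet.univ, measureReal_restrict_apply, Set.univ_inter,
    Real.volume_real_Ioo_of_le hρ.le, sub_zero, smul_eq_mul, mul_one] at h
  rw [← h, ← lintegral_indicator Metric.isOpen_ball.measurableSet]
  refine lintegral_congr_ae ?_
  have : ∀ᵐ x : Space, x ≠ 0 := by simp [ae_iff]
  filter_upwards [this] with x hx
  have hx0 : 0 < ‖x‖ := norm_pos_iff.2 hx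
  by_cases h : ‖x‖ < ρ
  · simp [hg, Set.indicator, h, ENNReal.ofReal_inv_of_pos (pow_pos hx0 2), ENNReal.ofReal_pow,
      ENNReal.inv_pow]
  · simp [hg, Set.indicator, h]

theorem lintegral_compl_ball_inv_pow {ρ : ℝ} (hρ : 0 < ρ) :
    ∫⁻ x in (Metric.ball (0 : Space) ρ)ᶜ, (‖x‖ₑ⁻¹) ^ 4 = ENNReal.ofReal (radialConst / ρ) := by
  set g : ℝ → ℝ := (Set.Ici ρ).indicator fun y => (y ^ 4)⁻¹ with hg
  have e : (Set.Ioi (0 : ℝ)).EqOn (fun y => y ^ 2 * g y)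
      ((Set.Ici ρ).indicator fun y => y ^ (-2 : ℝ)) := by
    intro y hy
    have hy : 0 < y := hy
    by_cases h : ρ ≤ y
    · simp [hg, h, Set.indicator]
      field_simp
    · simp [hg, h, Set.indicator]
  have hi' : IntegrableOn (fun y : ℝ => y ^ (-2 : ℝ)) (Set.Ici ρ) := by
    rw [integrableOn_Ici_iff_integrableOn_Ioi]
    exact integrableOn_Ioi_rpow_of_lt (by norm_num) hρ
  have hi : IntegrableOn (fun y => y ^ 2 * g y) (Set.Ioi 0) := by
    rw [integrableOn_congr_fun e measurableSet_Ioi]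
    exact Integrable.integrableOn ((integrable_indicator_iff measurableSet_Ici).2 hi')
  have h := lintegral_radial (g := g) (fun y => Set.indicator_nonneg (fun y _ => by positivity) y) hi
  have hval : ∫ y in Set.Ici ρ, y ^ (-2 : ℝ) = 1 / ρ := by
    rw [integral_Ici_eq_integral_Ioi, integral_Ioi_rpow_of_lt (by norm_num) hρ]
    norm_num
    rw [Real.rpow_neg_one]
  have hsub : Set.Ioi (0 : ℝ) ∩ Set.Ici ρ = Set.Ici ρ :=
    Set.inter_eq_right.2 fun y hy => lt_of_lt_of_le hρ hy
  rw [setIntegral_congr_fun measurableSet_Ioi e, setIntegral_indicator measurableSet_Ici, hsub,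
    hval, mul_one_div] at h
  rw [← h, ← lintegral_indicator Metric.isOpen_ball.measurableSet.compl]
  refine lintegral_congr_ae ?_
  have : ∀ᵐ x : Space, x ≠ 0 := by simp [ae_iff]
  filter_upwards [this] with x hx
  have hx0 : 0 < ‖x‖ := norm_pos_iff.2 hx
  by_cases h : ρ ≤ ‖x‖
  · simp [hg, Set.indicator, h, ENNReal.ofReal_inv_of_pos (pow_pos hx0 4), ENNReal.ofReal_pow,
      ENNReal.inv_pow]
  · simp [hg, Set.indicator, h]

theorem radialConst_pos : 0 < radialConst :=
  mul_pos (by norm_num) (ENNReal.toReal_pos (Metric.measure_ball_pos _ _ one_pos).ne'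
    measure_ball_lt_top.ne)

theorem measurable_inv_enorm_sub {α : Type*} [MeasurableSpace α] {f g : α → Space}
    (hf : Measurable f) (hg : Measurable g) : Measurable fun x => ‖f x - g x‖ₑ⁻¹ :=
  (hf.sub hg).enorm.inv

/-- Let R = |x-y|/2. The balls of radius R about x and y are disjoint, so on each one factor is at
most R⁻² and the other integrates to κR, where κ is `radialConst`. Off both balls the product is at
most |x-z|⁻⁴ + |y-z|⁻⁴, each term contributing at most κ/R. The total is 4κ/R = 8κ/|x-y|. -/
theorem lintegral_inv_sq_mul_inv_sq_le (x y : Space) :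
    ∫⁻ z, (‖x - z‖ₑ⁻¹) ^ 2 * (‖y - z‖ₑ⁻¹) ^ 2 ≤ ENNReal.ofReal (8 * radialConst) * ‖x - y‖ₑ⁻¹ := by
  have hC := radialConst_pos
  -- On the diagonal the right side is ∞, because the constant is positive.
  rcases eq_or_ne x y with rfl | hxy
  · rw [sub_self, enorm_zero, ENNReal.inv_zero, ENNReal.mul_top]
    · exact le_top
    · simpa using hC
  set R := ‖x - y‖ / 2 with hR
  have hd : 0 < ‖x - y‖ := norm_pos_iff.2 (sub_ne_zero.2 hxy)
  have hR0 : 0 < R := by positivity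
  set B := Metric.ball (0 : Space) R with hB
  have hBm : MeasurableSet B := Metric.isOpen_ball.measurableSet
  set r := (ENNReal.ofReal R)⁻¹ with hr
  set A : Space → ℝ≥0∞ := B.indicator fun w => (‖w‖ₑ⁻¹) ^ 2 with hA
  set D : Space → ℝ≥0∞ := Bᶜ.indicator fun w => (‖w‖ₑ⁻¹) ^ 4 with hD
  have hAm : Measurable A := (measurable_enorm.inv.pow_const 2).indicator hBm
  have hDm : Measurable D := (measurable_enorm.inv.pow_const 4).indicator hBm.compl
  have hge : ∀ w : Space, w ∉ B → ‖w‖ₑ⁻¹ ≤ r := by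
    intro w hw
    rw [hr, ENNReal.inv_le_inv, ← ofReal_norm]
    exact ENNReal.ofReal_le_ofReal (by simpa [hB] using hw)
  have hpt : ∀ z, (‖x - z‖ₑ⁻¹) ^ 2 * (‖y - z‖ₑ⁻¹) ^ 2 ≤
      r ^ 2 * A (x - z) + r ^ 2 * A (y - z) + (D (x - z) + D (y - z)) := by
    intro z
    by_cases h1 : x - z ∈ B
    · have h2 : y - z ∉ B := by
        intro h2
        have t1 : ‖x - z‖ < R := by simpa [hB] using h1
        have t2 : ‖y - z‖ < R := by simpa [hB] using h2
        have := norm_sub_le (x - z) (y - z)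
        rw [sub_sub_sub_cancel_right] at this
        linarith
      refine le_trans ?_ (le_add_right (le_add_right le_rfl))
      rw [hA, Set.indicator_of_mem h1, mul_comm]
      gcongr
      exact hge _ h2
    · by_cases h2 : y - z ∈ B
      · refine le_trans ?_ (le_add_right (le_add_left le_rfl))
        rw [hA, Set.indicator_of_mem h2]
        gcongr
        exact hge _ h1
      · refine le_trans ?_ (le_add_left le_rfl)
        rw [hD, Set.indicator_of_mem h1, Set.indicator_of_mem h2]
        rcases le_total (‖x - z‖ₑ⁻¹) (‖y - z‖ₑ⁻¹) with h | h
        · refine le_trans ?_ (le_add_left le_rfl)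
          calc _ ≤ (‖y - z‖ₑ⁻¹) ^ 2 * (‖y - z‖ₑ⁻¹) ^ 2 := by gcongr
            _ = _ := by ring
        · refine le_trans ?_ (le_add_right le_rfl)
          calc _ ≤ (‖x - z‖ₑ⁻¹) ^ 2 * (‖x - z‖ₑ⁻¹) ^ 2 := by gcongr
            _ = _ := by ring
  have iA : ∀ u : Space, ∫⁻ z, A (u - z) = ENNReal.ofReal (radialConst * R) := by
    intro u
    rw [lintegral_sub_left_eq_self, lintegral_indicator hBm, lintegral_ball_inv_sq hR0]
  have iD : ∀ u : Space, ∫⁻ z, D (u - z) = ENNReal.ofReal (radialConst / R) := by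
    intro u
    rw [lintegral_sub_left_eq_self, lintegral_indicator hBm.compl, lintegral_compl_ball_inv_pow hR0]
  have mA : ∀ u : Space, Measurable fun z => A (u - z) := fun u => hAm.comp (measurable_const.sub measurable_id)
  have mD : ∀ u : Space, Measurable fun z => D (u - z) := fun u => hDm.comp (measurable_const.sub measurable_id)
  have mAA : Measurable fun z => r ^ 2 * A (x - z) + r ^ 2 * A (y - z) :=
    ((mA x).const_mul _).add ((mA y).const_mul _)
  refine (lintegral_mono hpt).trans (le_of_eq ?_)
  rw [lintegral_add_left mAA, lintegral_add_left ((mA x).const_mul _), lintegral_add_left (mD x),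
    lintegral_const_mul _ (mA x), lintegral_const_mul _ (mA y), iA, iA, iD, iD, hr,
    ← ENNReal.ofReal_inv_of_pos hR0, ← ENNReal.ofReal_pow (by positivity),
    ← ENNReal.ofReal_mul (by positivity), ← ENNReal.ofReal_add (by positivity) (by positivity),
    ← ENNReal.ofReal_add (by positivity) (by positivity),
    ← ENNReal.ofReal_add (by positivity) (by positivity), ← ofReal_norm,
    ← ENNReal.ofReal_inv_of_pos hd, ← ENNReal.ofReal_mul (by positivity)]
  congr 1
  rw [hR]
  field_simp
  norm_num

/-! ### Weighted L² bound for the Riesz potential -/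

/-- The Riesz potential `∫ N(z) |x - z|⁻² dz`. -/
noncomputable def rieszPot (N : Space → ℝ≥0∞) (x : Space) : ℝ≥0∞ := ∫⁻ z, N z * (‖x - z‖ₑ⁻¹) ^ 2

theorem measurable_rieszPot {N : Space → ℝ≥0∞} (hN : Measurable N) : Measurable (rieszPot N) :=
  Measurable.lintegral_prod_right' (f := fun p : Space × Space => N p.2 * (‖p.1 - p.2‖ₑ⁻¹) ^ 2)
    ((hN.comp measurable_snd).mul ((measurable_inv_enorm_sub measurable_fst measurable_snd).pow_const 2))

theorem lintegral_ball_sub (x : Space) :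
    ∫⁻ z in Metric.ball x 1, (‖x - z‖ₑ⁻¹) ^ 2 = ENNReal.ofReal radialConst := by
  have h := lintegral_ball_inv_sq one_pos
  rw [mul_one, ← lintegral_indicator Metric.isOpen_ball.measurableSet,
    ← lintegral_sub_left_eq_self _ x] at h
  rw [← h, ← lintegral_indicator Metric.isOpen_ball.measurableSet]
  congr 1 with z
  have : x - z ∈ Metric.ball (0 : Space) 1 ↔ z ∈ Metric.ball x 1 := by
    rw [mem_ball_zero_iff, Metric.mem_ball, dist_eq_norm, norm_sub_rev]
  by_cases hz : z ∈ Metric.ball x 1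
  · rw [Set.indicator_of_mem hz, Set.indicator_of_mem (this.2 hz)]
  · rw [Set.indicator_of_notMem hz, Set.indicator_of_notMem (mt this.1 hz)]

theorem inv_enorm_le_one {x z : Space} (hz : z ∉ Metric.ball x 1) : ‖x - z‖ₑ⁻¹ ≤ 1 := by
  rw [ENNReal.inv_le_one, ← ofReal_norm, ENNReal.one_le_ofReal, ← dist_eq_norm, dist_comm]
  simpa using hz

/-- Split at the unit ball about x. The bound is qualitative: it gives the finiteness needed before
cancelling powers of an integral. -/
theorem rieszPot_le {N : Space → ℝ≥0∞} {M : ℝ≥0∞} (hM : ∀ z, N z ≤ M) (x : Space) :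
    rieszPot N x ≤ M * ENNReal.ofReal radialConst + ∫⁻ z, N z := by
  have hB : MeasurableSet (Metric.ball x 1) := Metric.isOpen_ball.measurableSet
  rw [rieszPot, ← lintegral_add_compl _ hB, ← lintegral_ball_sub x]
  refine add_le_add ?_ ?_
  · have hk : Measurable fun z : Space => (‖x - z‖ₑ⁻¹) ^ 2 :=
      (measurable_inv_enorm_sub measurable_const measurable_id).pow_const 2
    rw [← lintegral_const_mul _ hk]
    exact lintegral_mono fun z => mul_le_mul_left (hM z) _
  · refine le_trans (setLIntegral_mono' hB.compl fun z hz => ?_) (setLIntegral_le_lintegral _ _)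
    calc N z * (‖x - z‖ₑ⁻¹) ^ 2 ≤ N z * 1 ^ 2 := by gcongr; exact inv_enorm_le_one hz
      _ = N z := by simp

theorem le_of_pow_four_le {A K : ℝ≥0∞} (hA : A ≠ ∞) (h : A ^ 4 ≤ K ^ 2 * A ^ 2) : A ≤ K := by
  rcases eq_or_ne A 0 with rfl | h0
  · exact zero_le
  have h2 : A ^ 2 ≠ 0 := pow_ne_zero 2 h0
  have h3 : A ^ 2 ≠ ∞ := ENNReal.pow_ne_top hA
  have h4 : A ^ 2 * A ^ 2 ≤ K ^ 2 * A ^ 2 := by rwa [← pow_add]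
  have h5 := (ENNReal.mul_le_mul_iff_left h2 h3).1 h4
  exact (ENNReal.pow_le_pow_left_iff two_ne_zero).1 h5

/-- With g the potential and u = q² g, Tonelli writes A = ∫ q² g² as ∫ N J, where J = u * |·|⁻². Two
applications of Cauchy–Schwarz give A⁴ ≤ (C ∫ N²)² a H A². Boundedness and integrability of N make A
finite, so that A² may be cancelled. -/
theorem lintegral_mul_rieszPot_sq_le_of_bounded {q N : Space → ℝ≥0∞} (hq : Measurable q)
    (hN : Measurable N) {M a H : ℝ≥0∞} (hM : M ≠ ∞) (hNM : ∀ z, N z ≤ M) (hN1 : ∫⁻ z, N z ≠ ∞)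
    (ha : ∫⁻ x, q x ^ 2 = a) (ha' : a ≠ ∞) (hH : ∀ p, ∫⁻ x, q x ^ 2 * (‖x - p‖ₑ⁻¹) ^ 2 ≤ H) :
    ∫⁻ x, q x ^ 2 * rieszPot N x ^ 2 ≤
      ENNReal.ofReal (8 * radialConst) * (∫⁻ z, N z ^ 2) * (a + H) := by
  set g := rieszPot N with hg
  have hgm : Measurable g := measurable_rieszPot hN
  set A := ∫⁻ x, q x ^ 2 * g x ^ 2 with hA
  set C := ENNReal.ofReal (8 * radialConst) with hC
  have hA' : A ≠ ∞ := by
    refine ne_top_of_le_ne_top ?_ (lintegral_mono fun x =>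
      mul_le_mul_right (pow_le_pow_left₀ zero_le (rieszPot_le hNM x) 2) (q x ^ 2))
    rw [lintegral_mul_const _ (hq.pow_const 2), ha]
    exact ENNReal.mul_ne_top ha' (ENNReal.pow_ne_top (ENNReal.add_ne_top.2
      ⟨ENNReal.mul_ne_top hM ENNReal.ofReal_ne_top, hN1⟩))
  set u : Space → ℝ≥0∞ := fun x => q x ^ 2 * g x with hu
  have hum : Measurable u := (hq.pow_const 2).mul hgm
  set J : Space → ℝ≥0∞ := fun z => ∫⁻ x, u x * (‖x - z‖ₑ⁻¹) ^ 2 with hJ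
  have hkm : Measurable fun p : Space × Space => (‖p.1 - p.2‖ₑ⁻¹) ^ 2 :=
    (measurable_inv_enorm_sub measurable_fst measurable_snd).pow_const 2
  have hk2 : ∀ z : Space, Measurable fun x : Space => (‖x - z‖ₑ⁻¹) ^ 2 := fun z =>
    (measurable_inv_enorm_sub measurable_id measurable_const).pow_const 2
  have hk1 : ∀ x : Space, Measurable fun z : Space => (‖x - z‖ₑ⁻¹) ^ 2 := fun x =>
    (measurable_inv_enorm_sub measurable_const measurable_id).pow_const 2
  have huk : ∀ z : Space, Measurable fun x => u x * (‖x - z‖ₑ⁻¹) ^ 2 := fun z => hum.mul (hk2 z)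
  have hqg : Measurable fun x => q x ^ 2 * g x ^ 2 := (hq.pow_const 2).mul (hgm.pow_const 2)
  have hJm : Measurable J := Measurable.lintegral_prod_left'
    (f := fun p : Space × Space => u p.1 * (‖p.1 - p.2‖ₑ⁻¹) ^ 2) ((hum.comp measurable_fst).mul hkm)
  have e1 : A = ∫⁻ z, N z * J z := by
    calc A = ∫⁻ x, ∫⁻ z, u x * (N z * (‖x - z‖ₑ⁻¹) ^ 2) := by
          refine lintegral_congr fun x => ?_
          have hNk : Measurable fun z => N z * (‖x - z‖ₑ⁻¹) ^ 2 := hN.mul (hk1 x)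
          rw [lintegral_const_mul _ hNk]
          simp only [hu, hg, rieszPot]
          ring
      _ = ∫⁻ z, ∫⁻ x, u x * (N z * (‖x - z‖ₑ⁻¹) ^ 2) := by
          have hm : Measurable fun p : Space × Space => u p.1 * (N p.2 * (‖p.1 - p.2‖ₑ⁻¹) ^ 2) :=
            (hum.comp measurable_fst).mul ((hN.comp measurable_snd).mul hkm)
          exact lintegral_lintegral_swap hm.aemeasurable
      _ = _ := by
          refine lintegral_congr fun z => ?_
          simp only [hJ]
          rw [← lintegral_const_mul _ (huk z)]
          congr 1 with x
          ring
  have e2 : A ^ 2 ≤ (∫⁻ z, N z ^ 2) * ∫⁻ z, J z ^ 2 := by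
    rw [e1]; exact lintegral_mul_sq_le hN.aemeasurable hJm.aemeasurable
  -- Expanding the square as a double integral and integrating in z first leaves the composed kernel
  -- C/|x-y|.
  have e3 : ∫⁻ z, J z ^ 2 ≤ C * ∫⁻ p : Space × Space, u p.1 * u p.2 * ‖p.1 - p.2‖ₑ⁻¹ := by
    calc ∫⁻ z, J z ^ 2 = ∫⁻ z, ∫⁻ p : Space × Space,
          u p.1 * u p.2 * ((‖p.1 - z‖ₑ⁻¹) ^ 2 * (‖p.2 - z‖ₑ⁻¹) ^ 2) := by
          refine lintegral_congr fun z => ?_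
          simp only [hJ]
          rw [pow_two, ← lintegral_prod_mul (huk z).aemeasurable (huk z).aemeasurable]
          refine lintegral_congr fun p => ?_
          ring
      _ = ∫⁻ p : Space × Space, ∫⁻ z,
          u p.1 * u p.2 * ((‖p.1 - z‖ₑ⁻¹) ^ 2 * (‖p.2 - z‖ₑ⁻¹) ^ 2) := by
          refine lintegral_lintegral_swap (Measurable.aemeasurable ?_)
          refine ((hum.comp (measurable_fst.comp measurable_snd)).mul
            (hum.comp (measurable_snd.comp measurable_snd))).mul (((measurable_inv_enorm_sub
              (measurable_fst.comp measurable_snd) measurable_fst).pow_const 2).mul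
              ((measurable_inv_enorm_sub (measurable_snd.comp measurable_snd)
                measurable_fst).pow_const 2))
      _ ≤ ∫⁻ p : Space × Space, C * (u p.1 * u p.2 * ‖p.1 - p.2‖ₑ⁻¹) := by
          refine lintegral_mono fun p => ?_
          have hkk : Measurable fun z => (‖p.1 - z‖ₑ⁻¹) ^ 2 * (‖p.2 - z‖ₑ⁻¹) ^ 2 :=
            (hk1 _).mul (hk1 _)
          rw [lintegral_const_mul _ hkk]
          calc _ ≤ u p.1 * u p.2 * (C * ‖p.1 - p.2‖ₑ⁻¹) := by
                gcongr; exact lintegral_inv_sq_mul_inv_sq_le _ _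
            _ = _ := by ring
      _ = _ := lintegral_const_mul _ (((hum.comp measurable_fst).mul (hum.comp measurable_snd)).mul
          (measurable_inv_enorm_sub measurable_fst measurable_snd))
  -- The integrand is split as (q q / |x-y|)(q g · q g). The first factor meets the uniform Hardy
  -- bound H, while the second reproduces A².
  have e4 : (∫⁻ p : Space × Space, u p.1 * u p.2 * ‖p.1 - p.2‖ₑ⁻¹) ^ 2 ≤ a * H * A ^ 2 := by
    have m1 : Measurable fun p : Space × Space => q p.1 * q p.2 * ‖p.1 - p.2‖ₑ⁻¹ :=
      ((hq.comp measurable_fst).mul (hq.comp measurable_snd)).mul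
        (measurable_inv_enorm_sub measurable_fst measurable_snd)
    have m2 : Measurable fun p : Space × Space => (q p.1 * g p.1) * (q p.2 * g p.2) :=
      ((hq.mul hgm).comp measurable_fst).mul ((hq.mul hgm).comp measurable_snd)
    have h := lintegral_mul_sq_le (ν := (volume : Measure (Space × Space))) m1.aemeasurable m2.aemeasurable
    have l1 : ∫⁻ p : Space × Space, (q p.1 * q p.2 * ‖p.1 - p.2‖ₑ⁻¹) ^ 2 ≤ a * H := by
      rw [Measure.volume_eq_prod, lintegral_prod_symm _ (m1.pow_const 2).aemeasurable]
      calc _ ≤ ∫⁻ y, q y ^ 2 * H := by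
            refine lintegral_mono fun y => ?_
            calc _ = ∫⁻ x, q y ^ 2 * (q x ^ 2 * (‖x - y‖ₑ⁻¹) ^ 2) := by
                  refine lintegral_congr fun x => ?_
                  ring
              _ = q y ^ 2 * ∫⁻ x, q x ^ 2 * (‖x - y‖ₑ⁻¹) ^ 2 :=
                  lintegral_const_mul _ ((hq.pow_const 2).mul (hk2 y))
              _ ≤ _ := by gcongr; exact hH y
        _ = _ := by rw [lintegral_mul_const _ (hq.pow_const 2), ha]
    have l2 : ∫⁻ p : Space × Space, ((q p.1 * g p.1) * (q p.2 * g p.2)) ^ 2 = A ^ 2 := by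
      rw [pow_two A, hA, ← lintegral_prod_mul hqg.aemeasurable hqg.aemeasurable]
      refine lintegral_congr fun p => ?_
      ring
    calc _ = (∫⁻ p : Space × Space, q p.1 * q p.2 * ‖p.1 - p.2‖ₑ⁻¹ *
          ((q p.1 * g p.1) * (q p.2 * g p.2))) ^ 2 := by
          congr 1
          refine lintegral_congr fun p => ?_
          simp only [hu]
          ring
      _ ≤ _ := h
      _ ≤ _ := by rw [l2]; gcongr
  refine le_of_pow_four_le hA' ?_
  calc A ^ 4 = (A ^ 2) ^ 2 := by ring
    _ ≤ ((∫⁻ z, N z ^ 2) * (C * ∫⁻ p : Space × Space, u p.1 * u p.2 * ‖p.1 - p.2‖ₑ⁻¹)) ^ 2 := by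
        gcongr; exact e2.trans (by gcongr)
    _ = (C * ∫⁻ z, N z ^ 2) ^ 2 * (∫⁻ p : Space × Space, u p.1 * u p.2 * ‖p.1 - p.2‖ₑ⁻¹) ^ 2 := by ring
    _ ≤ (C * ∫⁻ z, N z ^ 2) ^ 2 * (a * H * A ^ 2) := by gcongr
    -- Replacing a H by (a + H)² makes the right side a perfect square times A², as the cancellation
    -- lemma requires.
    _ ≤ (C * ∫⁻ z, N z ^ 2) ^ 2 * ((a + H) * (a + H) * A ^ 2) := by
        gcongr
        · exact le_self_add
        · exact le_add_self
    _ = _ := by ring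

/-- Truncate N at height n and apply monotone convergence, first inside the potential and then
outside. The bound for truncations involves only ∫ N², not the height. -/
theorem lintegral_mul_rieszPot_sq_le {q N : Space → ℝ≥0∞} (hq : Measurable q)
    (hqt : ∀ x, q x ≠ ∞) (hN : Measurable N) (hN1 : ∫⁻ z, N z ≠ ∞) {a H : ℝ≥0∞}
    (ha : ∫⁻ x, q x ^ 2 = a) (ha' : a ≠ ∞) (hH : ∀ p, ∫⁻ x, q x ^ 2 * (‖x - p‖ₑ⁻¹) ^ 2 ≤ H) :
    ∫⁻ x, q x ^ 2 * rieszPot N x ^ 2 ≤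
      ENNReal.ofReal (8 * radialConst) * (∫⁻ z, N z ^ 2) * (a + H) := by
  set T : ℕ → Space → ℝ≥0∞ := fun n z => min (N z) n with hT
  have hTm : ∀ n, Measurable (T n) := fun n => hN.min measurable_const
  have hTN : ∀ n z, T n z ≤ N z := fun n z => min_le_left _ _
  have hTmono : ∀ z, Monotone fun n => T n z := fun z m n hmn => by
    exact min_le_min le_rfl (by exact_mod_cast hmn)
  have hTlim : ∀ z, Tendsto (fun n => T n z) atTop (𝓝 (N z)) := by
    intro z
    have : Tendsto (fun n : ℕ => min (N z) (n : ℝ≥0∞)) atTop (𝓝 (min (N z) ∞)) :=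
      tendsto_const_nhds.min ENNReal.tendsto_nat_nhds_top
    simpa using this
  have hb : ∀ n, ∫⁻ x, q x ^ 2 * rieszPot (T n) x ^ 2 ≤
      ENNReal.ofReal (8 * radialConst) * (∫⁻ z, N z ^ 2) * (a + H) := by
    intro n
    refine (lintegral_mul_rieszPot_sq_le_of_bounded hq (hTm n) (M := n) (ENNReal.natCast_ne_top n)
      (fun z => min_le_right _ _) (ne_top_of_le_ne_top hN1 (lintegral_mono (hTN n))) ha ha' hH).trans ?_
    gcongr
    exact hTN n _
  have hk : ∀ x : Space, Measurable fun z : Space => (‖x - z‖ₑ⁻¹) ^ 2 := fun x =>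
    (measurable_inv_enorm_sub measurable_const measurable_id).pow_const 2
  have hRlim : ∀ᵐ x : Space, Tendsto (fun n => q x ^ 2 * rieszPot (T n) x ^ 2) atTop
      (𝓝 (q x ^ 2 * rieszPot N x ^ 2)) := by
    refine .of_forall fun x => ?_
    refine ENNReal.Tendsto.const_mul (ENNReal.Tendsto.pow ?_) (Or.inr (ENNReal.pow_ne_top (hqt x)))
    refine lintegral_tendsto_of_tendsto_of_monotone (fun n => ((hTm n).mul (hk x)).aemeasurable)
      (.of_forall fun z m n hmn => mul_le_mul_left (hTmono z hmn) _) ?_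
    have : ∀ᵐ z : Space, z ≠ x := by simp [ae_iff]
    filter_upwards [this] with z hz
    refine ENNReal.Tendsto.mul_const (hTlim z) (Or.inr (ENNReal.pow_ne_top ?_))
    rw [ENNReal.inv_ne_top, ne_eq, enorm_eq_zero, sub_eq_zero]
    exact fun h => hz h.symm
  refine le_of_tendsto' (lintegral_tendsto_of_tendsto_of_monotone (fun n =>
    ((hq.pow_const 2).mul ((measurable_rieszPot (hTm n)).pow_const 2)).aemeasurable)
    (.of_forall fun x m n hmn => ?_) hRlim) hb
  have : rieszPot (T m) x ≤ rieszPot (T n) x :=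
    lintegral_mono fun z => mul_le_mul_left (hTmono z hmn) _
  exact mul_le_mul_right (pow_le_pow_left₀ zero_le this 2) _

/-! ### Slices with fixed relative coordinate r = x - y -/

theorem lintegral_eq_lintegral_slices {h : Space × Space → ℝ≥0∞} (hh : Measurable h) :
    ∫⁻ p, h p = ∫⁻ r, ∫⁻ x, h (x, x - r) := by
  have hm : Measurable fun p : Space × Space => h (p.1, p.1 - p.2) :=
    hh.comp (measurable_fst.prodMk (measurable_fst.sub measurable_snd))
  rw [Measure.volume_eq_prod, lintegral_prod _ hh.aemeasurable]
  calc ∫⁻ x, ∫⁻ y, h (x, y) = ∫⁻ x, ∫⁻ r, h (x, x - r) :=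
        lintegral_congr fun x => (lintegral_sub_left_eq_self (fun y => h (x, y)) x).symm
    _ = _ := lintegral_lintegral_swap hm.aemeasurable

theorem measurable_slice {β : Type*} [MeasurableSpace β] {h : Space × Space → β} (hh : Measurable h)
    (r : Space) : Measurable fun x => h (x, x - r) :=
  hh.comp (measurable_id.prodMk (measurable_id.sub measurable_const))

theorem measurable_lintegral_slice {h : Space × Space → ℝ≥0∞} (hh : Measurable h) :
    Measurable fun r => ∫⁻ x, h (x, x - r) :=
  Measurable.lintegral_prod_left' (f := fun p : Space × Space => h (p.1, p.1 - p.2))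
    (hh.comp (measurable_fst.prodMk (measurable_fst.sub measurable_snd)))

theorem ae_slice {P : Space × Space → Prop} (h : ∀ᵐ p, P p) : ∀ᵐ r, ∀ᵐ x : Space, P (x, x - r) := by
  -- P need not be measurable, so the slices are taken of a measurable null set containing the
  -- exceptional set.
  set U := toMeasurable volume {p | ¬ P p} with hU
  have hUm : MeasurableSet U := measurableSet_toMeasurable _ _
  have hU0 : volume U = 0 := by rw [measure_toMeasurable]; exact h
  have hi : Measurable (U.indicator fun _ => (1 : ℝ≥0∞)) := measurable_const.indicator hUm
  have h1 := lintegral_eq_lintegral_slices hi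
  rw [lintegral_indicator_const hUm, hU0, mul_zero] at h1
  have h2 := (lintegral_eq_zero_iff (measurable_lintegral_slice hi)).1 h1.symm
  filter_upwards [h2] with r hr
  have h3 := (lintegral_eq_zero_iff (measurable_slice hi r)).1 hr
  filter_upwards [h3] with x hx
  by_contra hP
  have : (x, x - r) ∈ U := subset_toMeasurable _ _ hP
  simp [Set.indicator_of_mem this] at hx

theorem integral_norm_sq_eq_toReal {f : Space → ℂ} (hf : Measurable f) :
    ∫ x, ‖f x‖ ^ 2 = (∫⁻ x, ‖f x‖ₑ ^ 2).toReal := by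
  rw [integral_eq_lintegral_of_nonneg_ae (.of_forall fun x => by positivity)
    (hf.norm.pow_const 2).aestronglyMeasurable]
  congr 2 with x
  rw [ENNReal.ofReal_pow (norm_nonneg _), ofReal_norm]

/-- The two-body form of the product estimate: `b` is controlled along the centre-of-mass variable
by `c`. -/
theorem lintegral_rieszPot_sq_mul_le {N : Space → ℝ≥0∞} (hN : Measurable N) (hN1 : ∫⁻ z, N z ≠ ∞)
    {b : Space × Space → ℂ} {c : Fin 3 → Space × Space → ℂ} (hb : Measurable b)
    (hb2 : ∫⁻ p, ‖b p‖ₑ ^ 2 ≠ ∞) (hc : ∀ j, Measurable (c j)) (hc2 : ∀ j, ∫⁻ p, ‖c j p‖ₑ ^ 2 ≠ ∞)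
    (hbc : ∀ j (t : ℝ), 0 < t → ∀ᵐ p : Space × Space,
      ‖b (p + t • (EuclideanSpace.single j (1 : ℝ), EuclideanSpace.single j (1 : ℝ))) - b p‖ₑ ^ 2 ≤
      ENNReal.ofReal t * ∫⁻ s in Set.Ioc 0 t,
        ‖c j (p + s • (EuclideanSpace.single j (1 : ℝ), EuclideanSpace.single j (1 : ℝ)))‖ₑ ^ 2) :
    ∫⁻ p : Space × Space, (rieszPot N p.1 ^ 2 + rieszPot N p.2 ^ 2) * ‖b p‖ₑ ^ 2 ≤
      2 * (ENNReal.ofReal (8 * radialConst) * ∫⁻ z, N z ^ 2) *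
        ((∫⁻ p, ‖b p‖ₑ ^ 2) + 4 * ∑ j, ∫⁻ p, ‖c j p‖ₑ ^ 2) := by
  set K := ENNReal.ofReal (8 * radialConst) * ∫⁻ z, N z ^ 2 with hK
  have hI := measurable_rieszPot hN
  have hbn : Measurable fun p => ‖b p‖ₑ ^ 2 := hb.enorm.pow_const 2
  have hcn : ∀ j, Measurable fun p => ‖c j p‖ₑ ^ 2 := fun j => (hc j).enorm.pow_const 2
  set τ : ℕ → ℝ := fun n => 1 / ((n : ℝ) + 1) with hτ
  have hτ0 : ∀ n, 0 < τ n := fun n => by positivity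
  have hτt : Tendsto τ atTop (𝓝 0) := tendsto_one_div_add_atTop_nhds_zero_nat
  have key : ∀ᵐ r : Space, ∫⁻ x, (rieszPot N x ^ 2 + rieszPot N (x - r) ^ 2) * ‖b (x, x - r)‖ₑ ^ 2 ≤
      2 * K * ((∫⁻ x, ‖b (x, x - r)‖ₑ ^ 2) + 4 * ∑ j, ∫⁻ x, ‖c j (x, x - r)‖ₑ ^ 2) := by
    have f1 : ∀ᵐ r : Space, ∫⁻ x, ‖b (x, x - r)‖ₑ ^ 2 < ∞ :=
      ae_lt_top (measurable_lintegral_slice hbn) (by rwa [← lintegral_eq_lintegral_slices hbn])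
    have f2 : ∀ᵐ r : Space, ∀ j, ∫⁻ x, ‖c j (x, x - r)‖ₑ ^ 2 < ∞ := ae_all_iff.2 fun j =>
      ae_lt_top (measurable_lintegral_slice (hcn j)) (by
        rw [← lintegral_eq_lintegral_slices (hcn j)]; exact hc2 j)
    -- Increments are used only along the sequence τ, so countably many null sets are discarded.
    have f3 := ae_all_iff.2 fun j => ae_all_iff.2 fun n => ae_slice (hbc j (τ n) (hτ0 n))
    filter_upwards [f1, f2, f3] with r h1 h2 h3
    set f : Space → ℂ := fun x => b (x, x - r) with hf
    have hfm : Measurable f := measurable_slice hb r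
    have hf2 : MemLp f 2 volume := memLp_two_of_lintegral hfm.aestronglyMeasurable h1.ne
    set γ : Fin 3 → ℝ≥0∞ := fun j => ∫⁻ x, ‖c j (x, x - r)‖ₑ ^ 2 with hγ
    have hfd : ∀ j n, ∫ x, ‖f (x + τ n • EuclideanSpace.single j (1 : ℝ)) - f x‖ ^ 2 ≤
        τ n ^ 2 * (γ j).toReal := by
      intro j n
      set e : Space := EuclideanSpace.single j (1 : ℝ) with he
      have hm : Measurable fun p : Space × ℝ => ‖c j (p.1 + p.2 • e, p.1 + p.2 • e - r)‖ₑ ^ 2 := by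
        have hw : Measurable fun p : Space × ℝ => p.1 + p.2 • e :=
          measurable_fst.add (measurable_snd.smul_const e)
        exact (hcn j).comp (hw.prodMk (hw.sub measurable_const))
      have hle : ∫⁻ x, ‖f (x + τ n • e) - f x‖ₑ ^ 2 ≤ ENNReal.ofReal (τ n ^ 2) * γ j := by
        calc _ ≤ ∫⁻ x, ENNReal.ofReal (τ n) * ∫⁻ s in Set.Ioc 0 (τ n),
              ‖c j (x + s • e, x + s • e - r)‖ₑ ^ 2 := by
              refine lintegral_mono_ae ?_
              filter_upwards [h3 j n] with x hx
              simpa only [Prod.smul_mk, Prod.mk_add_mk, hf, add_sub_right_comm] using hx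
          _ = ENNReal.ofReal (τ n) * ∫⁻ s in Set.Ioc 0 (τ n), ∫⁻ x,
              ‖c j (x + s • e, x + s • e - r)‖ₑ ^ 2 := by
              rw [lintegral_const_mul _ hm.lintegral_prod_right',
                lintegral_lintegral_swap hm.aemeasurable]
          _ = ENNReal.ofReal (τ n) * ∫⁻ s in Set.Ioc 0 (τ n), γ j := by
              congr 2 with s
              exact lintegral_add_right_eq_self (fun x => ‖c j (x, x - r)‖ₑ ^ 2) (s • e)
          _ = _ := by
              rw [setLIntegral_const, Real.volume_Ioc, sub_zero, pow_two,
                ENNReal.ofReal_mul (hτ0 n).le]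
              ring
      have hgm : Measurable fun x => f (x + τ n • e) - f x :=
        (hfm.comp (measurable_id.add_const _)).sub hfm
      rw [integral_norm_sq_eq_toReal hgm]
      refine (ENNReal.toReal_mono (ENNReal.mul_ne_top ENNReal.ofReal_ne_top (h2 j).ne) hle).trans_eq ?_
      rw [ENNReal.toReal_mul, ENNReal.toReal_ofReal (by positivity)]
    have hH : ENNReal.ofReal (4 * ∑ j, (γ j).toReal) = 4 * ∑ j, γ j := by
      rw [ENNReal.ofReal_mul (by norm_num), ENNReal.ofReal_sum_of_nonneg fun j _ => ENNReal.toReal_nonneg]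
      have h4 : ∀ j, ENNReal.ofReal (γ j).toReal = γ j := fun j => ENNReal.ofReal_toReal (h2 j).ne
      simp [h4]
    have hardy := lintegral_mul_inv_sq_le hfm hf2 hτt hτ0 hfd
    rw [hH] at hardy
    have r1 := lintegral_mul_rieszPot_sq_le (q := fun x => ‖f x‖ₑ) hfm.enorm (fun x => enorm_ne_top) hN
      hN1 rfl h1.ne hardy
    have hsh : ∫⁻ x, ‖f (x + r)‖ₑ ^ 2 = ∫⁻ x, ‖f x‖ₑ ^ 2 :=
      lintegral_add_right_eq_self (fun x => ‖f x‖ₑ ^ 2) r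
    -- The weight at y = x - r becomes the weight at x once f is translated by r. The Hardy bound is
    -- uniform in the centre p and survives the translation.
    have r2 := lintegral_mul_rieszPot_sq_le (q := fun x => ‖f (x + r)‖ₑ)
      (hfm.comp (measurable_id.add_const r)).enorm (fun x => enorm_ne_top) hN hN1 hsh h1.ne
      (H := 4 * ∑ j, γ j) fun p => by
        refine le_trans (le_of_eq ?_) (hardy (p + r))
        rw [← lintegral_add_right_eq_self (fun x => ‖f x‖ₑ ^ 2 * (‖x - (p + r)‖ₑ⁻¹) ^ 2) r]
        simp
    have hsh2 : ∫⁻ x, ‖f (x + r)‖ₑ ^ 2 * rieszPot N x ^ 2 =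
        ∫⁻ x, ‖f x‖ₑ ^ 2 * rieszPot N (x - r) ^ 2 := by
      rw [← lintegral_add_right_eq_self (fun x => ‖f x‖ₑ ^ 2 * rieszPot N (x - r) ^ 2) r]
      simp
    rw [hsh2] at r2
    have hm1 : Measurable fun x => ‖f x‖ₑ ^ 2 * rieszPot N x ^ 2 :=
      (hfm.enorm.pow_const 2).mul (hI.pow_const 2)
    calc _ = ∫⁻ x, (‖f x‖ₑ ^ 2 * rieszPot N x ^ 2 + ‖f x‖ₑ ^ 2 * rieszPot N (x - r) ^ 2) := by
          refine lintegral_congr fun x => ?_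
          simp only [hf]; ring
      _ = (∫⁻ x, ‖f x‖ₑ ^ 2 * rieszPot N x ^ 2) + ∫⁻ x, ‖f x‖ₑ ^ 2 * rieszPot N (x - r) ^ 2 :=
          lintegral_add_left hm1 _
      _ ≤ _ := add_le_add r1 r2
      _ = _ := by simp only [hK, hf]; ring
  have hm2 : Measurable fun p : Space × Space =>
      (rieszPot N p.1 ^ 2 + rieszPot N p.2 ^ 2) * ‖b p‖ₑ ^ 2 :=
    (((hI.comp measurable_fst).pow_const 2).add ((hI.comp measurable_snd).pow_const 2)).mul hbn
  rw [lintegral_eq_lintegral_slices hm2]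
  refine (lintegral_mono_ae key).trans (le_of_eq ?_)
  have hms : Measurable fun r : Space => ∑ j, ∫⁻ x, ‖c j (x, x - r)‖ₑ ^ 2 :=
    Finset.measurable_sum _ fun j _ => measurable_lintegral_slice (hcn j)
  have hms2 : Measurable fun r : Space =>
      (∫⁻ x, ‖b (x, x - r)‖ₑ ^ 2) + 4 * ∑ j, ∫⁻ x, ‖c j (x, x - r)‖ₑ ^ 2 :=
    (measurable_lintegral_slice hbn).add (hms.const_mul 4)
  rw [lintegral_const_mul _ hms2, lintegral_add_left (measurable_lintegral_slice hbn),
    lintegral_const_mul _ hms, lintegral_finsetSum _ fun j _ => measurable_lintegral_slice (hcn j),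
    ← lintegral_eq_lintegral_slices hbn]
  simp only [← lintegral_eq_lintegral_slices (hcn _)]

/-! ### The mean-field potential -/

section MeanField

variable {σ : ℝ} {n : Space → ℝ}

theorem enorm_kernel_mul_le (hσ : |σ| = 1) (x z : Space) :
    ‖σ / (4 * Real.pi * ‖x - z‖) * n z‖ₑ ≤ ‖n z‖ₑ * ‖x - z‖ₑ⁻¹ := by
  rw [enorm_mul, mul_comm]
  refine mul_le_mul_right ?_ _
  rcases eq_or_ne x z with rfl | h
  · simp
  have h0 : 0 < ‖x - z‖ := norm_pos_iff.2 (sub_ne_zero.2 h)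
  rw [← ofReal_norm, ← ofReal_norm, ← ENNReal.ofReal_inv_of_pos h0]
  refine ENNReal.ofReal_le_ofReal ?_
  rw [Real.norm_eq_abs, abs_div, hσ, abs_of_pos (by positivity), one_div]
  refine inv_anti₀ h0 ?_
  nlinarith [Real.pi_gt_three]

/-- Near x use st ≤ s² + t², away from x the kernel is at most 1. This only makes the potential a
bounded, absolutely convergent integral and does not enter the final constant. -/
theorem lintegral_mul_inv_le (hn : Measurable n) (x : Space) :
    ∫⁻ z, ‖n z‖ₑ * ‖x - z‖ₑ⁻¹ ≤
      (∫⁻ z, ‖n z‖ₑ ^ 2) + ENNReal.ofReal radialConst + ∫⁻ z, ‖n z‖ₑ := by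
  have hB : MeasurableSet (Metric.ball x 1) := Metric.isOpen_ball.measurableSet
  rw [← lintegral_add_compl _ hB, ← lintegral_ball_sub x]
  refine add_le_add ?_ ?_
  · calc _ ≤ ∫⁻ z in Metric.ball x 1, (‖n z‖ₑ ^ 2 + (‖x - z‖ₑ⁻¹) ^ 2) := by
          refine lintegral_mono fun z => ?_
          rcases le_total ‖n z‖ₑ (‖x - z‖ₑ⁻¹) with h | h
          · refine le_trans ?_ le_add_self
            rw [pow_two]; gcongr
          · refine le_trans ?_ le_self_add
            rw [pow_two]; gcongr
      _ = _ := lintegral_add_left (hn.enorm.pow_const 2) _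
      _ ≤ _ := add_le_add (setLIntegral_le_lintegral _ _) le_rfl
  · refine le_trans (setLIntegral_mono' hB.compl fun z hz => ?_) (setLIntegral_le_lintegral _ _)
    calc _ ≤ ‖n z‖ₑ * 1 := by gcongr; exact inv_enorm_le_one hz
      _ = _ := mul_one _

theorem measurable_meanField_integrand (hn : Measurable n) :
    Measurable fun p : Space × Space => σ / (4 * Real.pi * ‖p.1 - p.2‖) * n p.2 :=
  (measurable_const.div (measurable_const.mul (measurable_fst.sub measurable_snd).norm)).mul
    (hn.comp measurable_snd)

theorem measurable_meanField (hn : Measurable n) : Measurable (meanField σ n) :=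
  ((measurable_meanField_integrand hn).stronglyMeasurable.integral_prod_right).measurable

theorem integrable_meanField_integrand (hσ : |σ| = 1) (hn : Measurable n) (h1 : ∫⁻ z, ‖n z‖ₑ ≠ ∞)
    (h2 : ∫⁻ z, ‖n z‖ₑ ^ 2 ≠ ∞) (x : Space) :
    Integrable fun z => σ / (4 * Real.pi * ‖x - z‖) * n z := by
  refine ⟨((measurable_meanField_integrand hn).comp measurable_prodMk_left).aestronglyMeasurable, ?_⟩
  refine (lintegral_mono (enorm_kernel_mul_le hσ x)).trans_lt
    ((lintegral_mul_inv_le hn x).trans_lt ?_)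
  exact (ENNReal.add_ne_top.2 ⟨ENNReal.add_ne_top.2 ⟨h2, ENNReal.ofReal_ne_top⟩, h1⟩).lt_top

theorem exists_meanField_bound (hσ : |σ| = 1) (hn : Measurable n) (h1 : ∫⁻ z, ‖n z‖ₑ ≠ ∞)
    (h2 : ∫⁻ z, ‖n z‖ₑ ^ 2 ≠ ∞) : ∃ M : ℝ, ∀ x, |meanField σ n x| ≤ M := by
  refine ⟨((∫⁻ z, ‖n z‖ₑ ^ 2) + ENNReal.ofReal radialConst + ∫⁻ z, ‖n z‖ₑ).toReal, fun x => ?_⟩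
  have h := (enorm_integral_le_lintegral_enorm fun z => σ / (4 * Real.pi * ‖x - z‖) * n z).trans
    ((lintegral_mono (enorm_kernel_mul_le hσ x)).trans (lintegral_mul_inv_le hn x))
  have := ENNReal.toReal_mono (ENNReal.add_ne_top.2 ⟨ENNReal.add_ne_top.2 ⟨h2, ENNReal.ofReal_ne_top⟩, h1⟩) h
  rwa [toReal_enorm, Real.norm_eq_abs] at this

/-- The difference of the two kernels is ±(|y-z| - |x-z|)/(4π |x-z| |y-z|). The triangle inequality
extracts |x-y|, and st ≤ s² + t² separates the reciprocal distances. Only |σ| = 1 is used, so both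
signs are covered. -/
theorem enorm_meanField_sub_le (hσ : |σ| = 1) (hn : Measurable n) (h1 : ∫⁻ z, ‖n z‖ₑ ≠ ∞)
    (h2 : ∫⁻ z, ‖n z‖ₑ ^ 2 ≠ ∞) (x y : Space) :
    ‖meanField σ n x - meanField σ n y‖ₑ ≤
      ‖x - y‖ₑ * (rieszPot (fun z => ‖n z‖ₑ) x + rieszPot (fun z => ‖n z‖ₑ) y) := by
  have hk : ∀ x : Space, Measurable fun z : Space => ‖n z‖ₑ * (‖x - z‖ₑ⁻¹) ^ 2 := fun x =>
    hn.enorm.mul ((measurable_inv_enorm_sub measurable_const measurable_id).pow_const 2)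
  have hkk : Measurable fun z : Space => ‖n z‖ₑ * (‖x - z‖ₑ⁻¹) ^ 2 + ‖n z‖ₑ * (‖y - z‖ₑ⁻¹) ^ 2 :=
    (hk x).add (hk y)
  rw [meanField, meanField, ← integral_sub (integrable_meanField_integrand hσ hn h1 h2 x)
    (integrable_meanField_integrand hσ hn h1 h2 y), rieszPot, rieszPot, ← lintegral_add_left (hk x),
    ← lintegral_const_mul _ hkk]
  refine (enorm_integral_le_lintegral_enorm _).trans (lintegral_mono_ae ?_)
  have hx : ∀ᵐ z : Space, z ≠ x := by simp [ae_iff]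
  have hy : ∀ᵐ z : Space, z ≠ y := by simp [ae_iff]
  filter_upwards [hx, hy] with z hx hy
  have a0 : 0 < ‖x - z‖ := norm_pos_iff.2 (sub_ne_zero.2 hx.symm)
  have b0 : 0 < ‖y - z‖ := norm_pos_iff.2 (sub_ne_zero.2 hy.symm)
  rw [← sub_mul, enorm_mul, ← mul_add, mul_left_comm, mul_comm]
  refine mul_le_mul_right ?_ _
  rw [← ofReal_norm, ← ofReal_norm, ← ofReal_norm, ← ofReal_norm, ← ENNReal.ofReal_inv_of_pos a0,
    ← ENNReal.ofReal_inv_of_pos b0, ← ENNReal.ofReal_pow (by positivity),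
    ← ENNReal.ofReal_pow (by positivity), ← ENNReal.ofReal_add (by positivity) (by positivity),
    ← ENNReal.ofReal_mul (by positivity)]
  refine ENNReal.ofReal_le_ofReal ?_
  have e : σ / (4 * Real.pi * ‖x - z‖) - σ / (4 * Real.pi * ‖y - z‖) =
      σ * (1 / (4 * Real.pi)) * ((‖y - z‖ - ‖x - z‖) * (‖x - z‖⁻¹ * ‖y - z‖⁻¹)) := by
    field_simp
  have hπ : 1 / (4 * Real.pi) ≤ 1 := by
    rw [div_le_one (by positivity)]; nlinarith [Real.pi_gt_three]
  have hd : |‖y - z‖ - ‖x - z‖| ≤ ‖x - y‖ := by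
    have := abs_norm_sub_norm_le (y - z) (x - z)
    rwa [sub_sub_sub_cancel_right, norm_sub_rev y x] at this
  rw [e, Real.norm_eq_abs, abs_mul, abs_mul, hσ, one_mul, abs_of_pos (by positivity : 0 < 1 / (4 * Real.pi)),
    abs_mul, abs_of_pos (by positivity : 0 < ‖x - z‖⁻¹ * ‖y - z‖⁻¹)]
  calc _ ≤ 1 * (‖x - y‖ * (‖x - z‖⁻¹ * ‖y - z‖⁻¹)) := by gcongr
    _ ≤ _ := by
        rw [one_mul]
        refine mul_le_mul_of_nonneg_left ?_ (norm_nonneg _)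
        nlinarith [sq_nonneg (‖x - z‖⁻¹ - ‖y - z‖⁻¹), sq_nonneg (‖x - z‖⁻¹), sq_nonneg (‖y - z‖⁻¹)]

end MeanField

/-! ### Uniqueness of commutators and kernels of the quantum gradient -/

/-- Two candidates agree on the dense set of Schwartz functions. Hence each infimum defining a
commutator norm runs over at most one operator and is attained there when one exists. -/
theorem IsCommutator.unique {A : L2 → L2 → Prop} {T B B' : L2 →L[ℂ] L2}
    (hs : ∀ ψ ψ' ψ'', A ψ ψ' → A ψ ψ'' → ψ' = ψ'')
    (hd : ∀ φ : 𝓢(Space, ℂ), ∃ ψ', A (φ.toLp 2) ψ') (h : IsCommutator A T B)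
    (h' : IsCommutator A T B') : B = B' := by
  ext1 f
  refine dense_schwartz (fun f => B f = B' f) (isClosed_eq B.continuous B'.continuous) (fun φ => ?_) f
  obtain ⟨ψ', hψ⟩ := hd φ
  exact add_right_cancel (hs _ _ _ (h _ _ hψ) (h' _ _ hψ))

theorem derivGraph_unique (j : Fin 3) (ψ ψ' ψ'' : L2) (h : derivGraph j ψ ψ')
    (h' : derivGraph j ψ ψ'') : ψ' = ψ'' := by
  refine ext_inner_left ℂ fun f => ?_
  refine dense_schwartz (fun f => ⟪f, ψ'⟫_ℂ = ⟪f, ψ''⟫_ℂ) (isClosed_eq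
    (continuous_id.inner continuous_const) (continuous_id.inner continuous_const)) (fun φ => ?_) f
  rw [h.inner_eq, h'.inner_eq]

theorem mulGraph_unique (m : Space → ℂ) (ψ ψ' ψ'' : L2) (h : mulGraph m ψ ψ')
    (h' : mulGraph m ψ ψ'') : ψ' = ψ'' :=
  Lp.ext (h.trans h'.symm)

/-- The function `x_k / (i ħ)` as a linear map. -/
noncomputable def momentumCLM (ħ : ℝ) (k : Fin 3) : Space →L[ℝ] ℂ :=
  ((Complex.I * ħ)⁻¹) • (Complex.ofRealCLM ∘L (EuclideanSpace.proj (𝕜 := ℝ) k : Space →L[ℝ] ℝ))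

theorem momentumCLM_apply (ħ : ℝ) (k : Fin 3) (x : Space) :
    momentumCLM ħ k x = (x k : ℂ) / (Complex.I * ħ) := by
  simp [momentumCLM, div_eq_inv_mul]

theorem exists_momentumGraph_toLp (ħ : ℝ) (k : Fin 3) (φ : 𝓢(Space, ℂ)) :
    ∃ ψ', momentumGraph ħ k (φ.toLp 2) ψ' := by
  have hg : (momentumCLM ħ k : Space → ℂ).HasTemperateGrowth :=
    (momentumCLM ħ k).hasTemperateGrowth
  refine ⟨(SchwartzMap.smulLeftCLM ℂ (momentumCLM ħ k) φ).toLp 2, ?_⟩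
  filter_upwards [(SchwartzMap.smulLeftCLM ℂ (momentumCLM ħ k) φ).coeFn_toLp 2,
    φ.coeFn_toLp 2] with x h1 h2
  rw [h1, h2, SchwartzMap.smulLeftCLM_apply_apply hg, momentumCLM_apply, smul_eq_mul]

theorem commutatorNorm_deriv_eq {ħ : ℝ} {j : Fin 3} {T B : L2 →L[ℂ] L2}
    (h : IsCommutator (derivGraph j) T B) :
    commutatorNorm ħ (derivGraph j) T = schattenNorm ħ 2 B := by
  refine le_antisymm (iInf₂_le B h) (le_iInf₂ fun B' h' => ?_)
  rw [h.unique (derivGraph_unique j) (fun φ => ⟨_, derivGraph_toLp j φ⟩) h']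

theorem iInf_momentum_eq {ħ : ℝ} {k : Fin 3} {T B : L2 →L[ℂ] L2} {F : (L2 →L[ℂ] L2) → ℝ≥0∞}
    (h : IsCommutator (momentumGraph ħ k) T B) :
    ⨅ (B : L2 →L[ℂ] L2) (_ : IsCommutator (momentumGraph ħ k) T B), F B = F B := by
  refine le_antisymm (iInf₂_le B h) (le_iInf₂ fun B' h' => ?_)
  rw [h.unique (mulGraph_unique _) (exists_momentumGraph_toLp ħ k) h']

/-- An infimum over the empty family is ∞, so finiteness yields actual operators. The terms with
[x_j/(iħ), B] are discarded, since only spatial derivatives are needed. -/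
theorem exists_commutators_of_sobolevNormSq_ne_top {ħ : ℝ} {B : L2 →L[ℂ] L2}
    (h : sobolevNormSq ħ B ≠ ∞) : ∃ C : Fin 3 → L2 →L[ℂ] L2,
      (∀ j, IsCommutator (derivGraph j) B (C j)) ∧
      schattenNorm ħ 2 B ^ 2 + ∑ j, schattenNorm ħ 2 (C j) ^ 2 ≤ sobolevNormSq ħ B := by
  have h1 : ∀ j : Fin 3, commutatorNorm ħ (derivGraph j) B < ∞ := by
    intro j
    rw [sobolevNormSq, ENNReal.add_ne_top, ENNReal.add_ne_top, ENNReal.sum_ne_top] at h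
    refine lt_top_iff_ne_top.2 fun hj => h.1.2 j (Finset.mem_univ j) ?_
    rw [hj, ENNReal.top_pow two_ne_zero]
  have h2 : ∀ j : Fin 3, ∃ C, IsCommutator (derivGraph j) B C := by
    intro j
    have := h1 j
    simp only [commutatorNorm, iInf_lt_iff] at this
    obtain ⟨C, hC, -⟩ := this
    exact ⟨C, hC⟩
  choose C hC using h2
  refine ⟨C, hC, ?_⟩
  rw [sobolevNormSq]
  simp only [commutatorNorm_deriv_eq (hC _)]
  exact le_self_add

theorem momentumGradientSobolevNorm_sq (ħ : ℝ) (T : L2 →L[ℂ] L2) :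
    momentumGradientSobolevNorm ħ T ^ 2 =
      ∑ k : Fin 3, ⨅ (B : L2 →L[ℂ] L2) (_ : IsCommutator (momentumGraph ħ k) T B),
        sobolevNormSq ħ B := by
  rw [momentumGradientSobolevNorm, ← ENNReal.rpow_natCast, ← ENNReal.rpow_mul]
  norm_num

theorem exists_commutators {ħ : ℝ} {T : L2 →L[ℂ] L2} (h : momentumGradientSobolevNorm ħ T ≠ ∞) :
    ∃ (B : Fin 3 → L2 →L[ℂ] L2) (C : Fin 3 → Fin 3 → L2 →L[ℂ] L2),
      (∀ k, IsCommutator (momentumGraph ħ k) T (B k)) ∧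
      (∀ k j, IsCommutator (derivGraph j) (B k) (C k j)) ∧
      ∑ k, (schattenNorm ħ 2 (B k) ^ 2 + ∑ j, schattenNorm ħ 2 (C k j) ^ 2) ≤
        momentumGradientSobolevNorm ħ T ^ 2 := by
  have h0 := ENNReal.pow_ne_top (n := 2) h
  rw [momentumGradientSobolevNorm_sq, ENNReal.sum_ne_top] at h0
  have h1 : ∀ k : Fin 3, ∃ B, IsCommutator (momentumGraph ħ k) T B := by
    intro k
    have := (h0 k (Finset.mem_univ k)).lt_top
    simp only [iInf_lt_iff] at this
    obtain ⟨B, hB, -⟩ := this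
    exact ⟨B, hB⟩
  choose B hB using h1
  have h2 : ∀ k, sobolevNormSq ħ (B k) ≠ ∞ := fun k => by
    have := h0 k (Finset.mem_univ k)
    rwa [iInf_momentum_eq (hB k)] at this
  choose C hC hle using fun k => exists_commutators_of_sobolevNormSq_ne_top (h2 k)
  refine ⟨B, C, hB, hC, ?_⟩
  rw [momentumGradientSobolevNorm_sq]
  simp only [iInf_momentum_eq (hB _)]
  exact Finset.sum_le_sum fun k _ => hle k

theorem momentumGraph_kernel_eq {ħ : ℝ} {k : Fin 3} {T B : L2 →L[ℂ] L2} {m b : Space × Space → ℂ}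
    (hB : IsCommutator (momentumGraph ħ k) T B) (hm : IsKernel T m) (hb : IsKernel B b) :
    ∀ᵐ p : Space × Space, b p = ((p.1 - p.2) k : ℂ) / (Complex.I * ħ) * m p := by
  have e : (fun x : Space => (x k : ℂ) / (Complex.I * ħ)) = momentumCLM ħ k := by
    ext x; rw [momentumCLM_apply]
  have hB' : IsCommutator (mulGraph (momentumCLM ħ k)) T B := e ▸ hB
  have := hB'.kernel_eq (momentumCLM ħ k).continuous.measurable (fun R =>
    ⟨‖momentumCLM ħ k‖ * |R|, fun x hx => ((momentumCLM ħ k).le_opNorm x).trans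
      (mul_le_mul_of_nonneg_left ((mem_ball_zero_iff.1 hx).le.trans (le_abs_self R))
        (norm_nonneg _))⟩) hm hb
  filter_upwards [this] with p hp
  rw [hp, ← map_sub, momentumCLM_apply]

theorem enorm_sq_eq_sum (x : Space) : ‖x‖ₑ ^ 2 = ∑ k, ‖x k‖ₑ ^ 2 := by
  rw [← ofReal_norm, ← ENNReal.ofReal_pow (norm_nonneg _), EuclideanSpace.norm_sq_eq,
    ENNReal.ofReal_sum_of_nonneg fun k _ => by positivity]
  simp only [ENNReal.ofReal_pow (norm_nonneg _), ofReal_norm]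

/-- The kernels of the quantum gradient in the momentum variable. -/
theorem exists_momentum_kernels {ħ : ℝ} (hħ : 0 < ħ) {T : L2 →L[ℂ] L2} {m : Space × Space → ℂ}
    (hm : IsKernel T m) (h : momentumGradientSobolevNorm ħ T ≠ ∞) :
    ∃ (b : Fin 3 → Space × Space → ℂ) (c : Fin 3 → Fin 3 → Space × Space → ℂ),
      (∀ k, Measurable (b k)) ∧ (∀ k, ∫⁻ p, ‖b k p‖ₑ ^ 2 ≠ ∞) ∧
      (∀ k j, Measurable (c k j)) ∧ (∀ k j, ∫⁻ p, ‖c k j p‖ₑ ^ 2 ≠ ∞) ∧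
      (∀ k j (t : ℝ), 0 < t → ∀ᵐ p : Space × Space,
        ‖b k (p + t • (EuclideanSpace.single j (1 : ℝ), EuclideanSpace.single j (1 : ℝ))) -
          b k p‖ₑ ^ 2 ≤ ENNReal.ofReal t * ∫⁻ s in Set.Ioc 0 t,
        ‖c k j (p + s • (EuclideanSpace.single j (1 : ℝ), EuclideanSpace.single j (1 : ℝ)))‖ₑ ^ 2) ∧
      (∀ᵐ p : Space × Space,
        ∑ k, ‖b k p‖ₑ ^ 2 = ENNReal.ofReal (1 / ħ) ^ 2 * ‖p.1 - p.2‖ₑ ^ 2 * ‖m p‖ₑ ^ 2) ∧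
      ENNReal.ofReal (2 * Real.pi * ħ) ^ 3 *
        ∑ k, ((∫⁻ p, ‖b k p‖ₑ ^ 2) + ∑ j, ∫⁻ p, ‖c k j p‖ₑ ^ 2) ≤
          momentumGradientSobolevNorm ħ T ^ 2 := by
  obtain ⟨B, C, hB, hC, hle⟩ := exists_commutators h
  have hh0 : ENNReal.ofReal (2 * Real.pi * ħ) ^ 3 ≠ 0 :=
    pow_ne_zero 3 (by simpa using by positivity)
  have hle' : ENNReal.ofReal (2 * Real.pi * ħ) ^ 3 * ∑ k, (hsSq (B k) + ∑ j, hsSq (C k j)) ≤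
      momentumGradientSobolevNorm ħ T ^ 2 := by
    refine le_trans (le_of_eq ?_) hle
    simp only [schattenNorm_two_sq, Finset.mul_sum, mul_add]
  have hfin : ∀ k, hsSq (B k) + ∑ j, hsSq (C k j) ≠ ∞ := by
    intro k hk
    refine (ne_top_of_le_ne_top (ENNReal.pow_ne_top h) hle') ?_
    have : ∑ k, (hsSq (B k) + ∑ j, hsSq (C k j)) = ∞ :=
      ENNReal.sum_eq_top.2 ⟨k, Finset.mem_univ k, hk⟩
    rw [this, ENNReal.mul_top hh0]
  have hBf : ∀ k, hsSq (B k) ≠ ∞ := fun k => (ENNReal.add_ne_top.1 (hfin k)).1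
  have hCf : ∀ k j, hsSq (C k j) ≠ ∞ := fun k j =>
    ENNReal.sum_ne_top.1 (ENNReal.add_ne_top.1 (hfin k)).2 j (Finset.mem_univ j)
  choose b hb hbn using fun k => exists_isKernel (hBf k)
  choose c hc hcn using fun k j => exists_isKernel (hCf k j)
  refine ⟨b, c, fun k => (hb k).measurable, fun k => by rw [hbn]; exact hBf k,
    fun k j => (hc k j).measurable, fun k j => by rw [hcn]; exact hCf k j,
    fun k j t ht => kernel_sub_shift_sq_le (hC k j) (hb k) (hc k j) ht rfl, ?_, ?_⟩
  · filter_upwards [ae_all_iff.2 fun k => momentumGraph_kernel_eq (hB k) hm (hb k)] with p hp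
    have e : ‖Complex.I * (ħ : ℂ)‖ₑ⁻¹ = ENNReal.ofReal (1 / ħ) := by
      rw [one_div, ENNReal.ofReal_inv_of_pos hħ, ← ofReal_norm]
      simp [abs_of_pos hħ]
    rw [enorm_sq_eq_sum, Finset.mul_sum, Finset.sum_mul]
    refine Finset.sum_congr rfl fun k _ => ?_
    have h0 : Complex.I * (ħ : ℂ) ≠ 0 := by simp [hħ.ne']
    rw [hp k, enorm_mul, div_eq_mul_inv, enorm_mul, enorm_inv h0, e, mul_pow, mul_pow]
    have : ‖((p.1 - p.2) k : ℂ)‖ₑ = ‖(p.1 - p.2) k‖ₑ := by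
      rw [← ofReal_norm, ← ofReal_norm, Complex.norm_real]
    rw [this]
    ring
  · simp only [hbn, hcn]
    exact hle'

/-! ### Degenerate cases -/

theorem isCommutator_zero (m : Space → ℂ) : IsCommutator (mulGraph m) 0 0 := by
  intro ψ ψ' _
  simp only [zero_apply, add_zero]
  exact .of_forall fun x => by simp

theorem hsSq_zero : hsSq 0 = 0 := by simp [hsSq]

theorem schattenNorm_zero (ħ : ℝ) : schattenNorm ħ 2 0 = 0 := by
  have := schattenNorm_two_sq ħ 0
  rw [hsSq_zero, mul_zero] at this
  exact pow_eq_zero_iff two_ne_zero |>.1 this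

theorem isCommutator_mulGraph_zero (T : L2 →L[ℂ] L2) : IsCommutator (mulGraph fun _ => 0) T 0 := by
  intro ψ ψ' h
  have : ψ' = 0 := by
    refine Lp.ext (h.trans ?_)
    exact .of_forall fun x => by simp
  rw [this, map_zero, zero_apply, add_zero]
  exact .of_forall fun x => by simp

theorem ae_fst_ne_snd : ∀ᵐ p : Space × Space, p.1 ≠ p.2 := by
  have hm : MeasurableSet {p : Space × Space | p.1 = p.2} :=
    measurableSet_eq_fun measurable_fst measurable_snd
  have : (volume : Measure (Space × Space)) {p : Space × Space | p.1 = p.2} = 0 := by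
    rw [Measure.volume_eq_prod, Measure.measure_prod_null hm]
    refine .of_forall fun x => ?_
    have : Prod.mk x ⁻¹' {p : Space × Space | p.1 = p.2} = {x} := by ext y; simp [eq_comm]
    simp [this]
  simpa [ae_iff] using this

theorem eq_zero_of_hsSq_eq_zero {T : L2 →L[ℂ] L2} (h : hsSq T = 0) : T = 0 := by
  rw [hsSq, ENNReal.tsum_eq_zero] at h
  have h1 : ∀ i, T (onb i) = 0 := fun i => by simpa using h i
  ext1 f
  refine ext_inner_left ℂ fun g => ?_
  have := onb.hasSum_inner_mul_inner (T.adjoint g) f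
  simp only [ContinuousLinearMap.adjoint_inner_left, h1, inner_zero_right, zero_mul] at this
  simpa using this.unique hasSum_zero

/-- All kernels b_k vanish, so |x-y| |m| = 0 almost everywhere. The diagonal is a null set, hence m
= 0. -/
theorem eq_zero_of_momentumGradientSobolevNorm_eq_zero {ħ : ℝ} (hħ : 0 < ħ) {T : L2 →L[ℂ] L2}
    (hT : hsSq T ≠ ∞) (h : momentumGradientSobolevNorm ħ T = 0) : T = 0 := by
  obtain ⟨m, hm, -⟩ := exists_isKernel hT
  obtain ⟨b, c, hb, -, -, -, -, hsum, hle⟩ := exists_momentum_kernels hħ hm (by simp [h])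
  have hh0 : ENNReal.ofReal (2 * Real.pi * ħ) ^ 3 ≠ 0 :=
    pow_ne_zero 3 (by simpa using by positivity)
  rw [h, zero_pow two_ne_zero, nonpos_iff_eq_zero, mul_eq_zero, or_iff_right hh0,
    Finset.sum_eq_zero_iff] at hle
  have hb0 : ∀ k, ∀ᵐ p, b k p = 0 := by
    intro k
    have h1 := (add_eq_zero.1 (hle k (Finset.mem_univ k))).1
    rw [lintegral_eq_zero_iff ((hb k).enorm.pow_const 2)] at h1
    filter_upwards [h1] with p hp
    simpa using hp
  have hm0 : ∀ᵐ p, m p = 0 := by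
    filter_upwards [ae_all_iff.2 hb0, hsum, ae_fst_ne_snd] with p h1 h2 h3
    have h4 : ENNReal.ofReal (1 / ħ) ^ 2 * ‖p.1 - p.2‖ₑ ^ 2 * ‖m p‖ₑ ^ 2 = 0 := by
      rw [← h2]; simp [h1]
    have h5 : ENNReal.ofReal (1 / ħ) ^ 2 ≠ 0 := pow_ne_zero 2 (by simpa using hħ)
    have h6 : ‖p.1 - p.2‖ₑ ^ 2 ≠ 0 := pow_ne_zero 2 (by simpa [sub_eq_zero] using h3)
    rw [mul_eq_zero, or_iff_right (mul_ne_zero h5 h6)] at h4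
    simpa using h4
  refine eq_zero_of_hsSq_eq_zero (nonpos_iff_eq_zero.1 (hm.hsSq_le.trans (le_of_eq ?_)))
  rw [lintegral_eq_zero_iff (hm.measurable.enorm.pow_const 2)]
  filter_upwards [hm0] with p hp
  simp [hp]

/-! ### The commutator estimate -/

theorem ennreal_add_sq_le (a b : ℝ≥0∞) : (a + b) ^ 2 ≤ 2 * (a ^ 2 + b ^ 2) := by
  rcases eq_or_ne a ∞ with rfl | ha
  · simp
  rcases eq_or_ne b ∞ with rfl | hb
  · simp
  lift a to NNReal using ha
  lift b to NNReal using hb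
  have h : (a + b) ^ 2 ≤ 2 * (a ^ 2 + b ^ 2) := add_sq_le
  exact_mod_cast h

/-- The commutator estimate for a measurable and square integrable density. -/
theorem commutatorNorm_meanField_sq_le {σ ħ : ℝ} (hσ : |σ| = 1) (hħ : 0 < ħ) {T : L2 →L[ℂ] L2}
    (hT : hsSq T ≠ ∞) {n : Space → ℝ} (hn : Measurable n) (hn1 : ∫⁻ z, ‖n z‖ₑ ≠ ∞)
    (hn2 : ∫⁻ z, ‖n z‖ₑ ^ 2 ≠ ∞) (hS : momentumGradientSobolevNorm ħ T ≠ ∞) :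
    (ENNReal.ofReal (1 / ħ) *
      commutatorNorm ħ (mulGraph fun x => (meanField σ n x : ℂ)) T) ^ 2 ≤
      16 * ENNReal.ofReal (8 * radialConst) * (∫⁻ z, ‖n z‖ₑ ^ 2) *
        momentumGradientSobolevNorm ħ T ^ 2 := by
  obtain ⟨m, hm, -⟩ := exists_isKernel hT
  obtain ⟨b, c, hb, hb2, hc, hc2, hbc, hsum, hle⟩ := exists_momentum_kernels hħ hm hS
  have hVm := measurable_meanField (σ := σ) hn
  obtain ⟨M, hM⟩ := exists_meanField_bound hσ hn hn1 hn2
  set V := meanField σ n with hV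
  set N : Space → ℝ≥0∞ := fun z => ‖n z‖ₑ with hN
  have hNm : Measurable N := hn.enorm
  have hI := measurable_rieszPot hNm
  set K := ENNReal.ofReal (8 * radialConst) * ∫⁻ z, N z ^ 2 with hK
  set h3 := ENNReal.ofReal (2 * Real.pi * ħ) ^ 3 with hh3
  have hpt : ∀ᵐ p : Space × Space,
      ENNReal.ofReal (1 / ħ) ^ 2 * ‖((V p.1 - V p.2 : ℝ) : ℂ) * m p‖ₑ ^ 2 ≤
        2 * ∑ k, (rieszPot N p.1 ^ 2 + rieszPot N p.2 ^ 2) * ‖b k p‖ₑ ^ 2 := by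
    filter_upwards [hsum] with p hp
    rw [← Finset.mul_sum, hp, enorm_mul]
    have e : ‖((V p.1 - V p.2 : ℝ) : ℂ)‖ₑ = ‖V p.1 - V p.2‖ₑ := by
      rw [← ofReal_norm, ← ofReal_norm, Complex.norm_real]
    have h1 := enorm_meanField_sub_le hσ hn hn1 hn2 p.1 p.2
    have h2 : (rieszPot N p.1 + rieszPot N p.2) ^ 2 ≤
        2 * (rieszPot N p.1 ^ 2 + rieszPot N p.2 ^ 2) := ennreal_add_sq_le _ _
    calc _ ≤ ENNReal.ofReal (1 / ħ) ^ 2 *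
          (‖p.1 - p.2‖ₑ * (rieszPot N p.1 + rieszPot N p.2) * ‖m p‖ₑ) ^ 2 := by
          rw [e]; gcongr
      _ = ENNReal.ofReal (1 / ħ) ^ 2 * ‖p.1 - p.2‖ₑ ^ 2 * ‖m p‖ₑ ^ 2 *
          (rieszPot N p.1 + rieszPot N p.2) ^ 2 := by ring
      _ ≤ ENNReal.ofReal (1 / ħ) ^ 2 * ‖p.1 - p.2‖ₑ ^ 2 * ‖m p‖ₑ ^ 2 *
          (2 * (rieszPot N p.1 ^ 2 + rieszPot N p.2 ^ 2)) := by gcongr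
      _ = _ := by ring
  have hmk : ∀ k, Measurable fun p : Space × Space =>
      (rieszPot N p.1 ^ 2 + rieszPot N p.2 ^ 2) * ‖b k p‖ₑ ^ 2 := fun k =>
    (((hI.comp measurable_fst).pow_const 2).add ((hI.comp measurable_snd).pow_const 2)).mul
      ((hb k).enorm.pow_const 2)
  have hkern := isKernel_commutator_mulOp hVm hM hm
  have hint : ENNReal.ofReal (1 / ħ) ^ 2 * hsSq (mulOp hVm hM * T - T * mulOp hVm hM) ≤
      16 * K * ∑ k, ((∫⁻ p, ‖b k p‖ₑ ^ 2) + ∑ j, ∫⁻ p, ‖c k j p‖ₑ ^ 2) := by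
    calc _ ≤ ENNReal.ofReal (1 / ħ) ^ 2 *
          ∫⁻ p : Space × Space, ‖((V p.1 - V p.2 : ℝ) : ℂ) * m p‖ₑ ^ 2 := by
          gcongr; exact hkern.hsSq_le
      _ = ∫⁻ p : Space × Space,
          ENNReal.ofReal (1 / ħ) ^ 2 * ‖((V p.1 - V p.2 : ℝ) : ℂ) * m p‖ₑ ^ 2 :=
          (lintegral_const_mul _ (hkern.measurable.enorm.pow_const 2)).symm
      _ ≤ ∫⁻ p : Space × Space,
          2 * ∑ k, (rieszPot N p.1 ^ 2 + rieszPot N p.2 ^ 2) * ‖b k p‖ₑ ^ 2 := lintegral_mono_ae hpt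
      _ = 2 * ∑ k, ∫⁻ p : Space × Space,
          (rieszPot N p.1 ^ 2 + rieszPot N p.2 ^ 2) * ‖b k p‖ₑ ^ 2 := by
          rw [lintegral_const_mul _ (Finset.measurable_sum _ fun k _ => hmk k),
            lintegral_finsetSum _ fun k _ => hmk k]
      _ ≤ 2 * ∑ k, 2 * K * ((∫⁻ p, ‖b k p‖ₑ ^ 2) + 4 * ∑ j, ∫⁻ p, ‖c k j p‖ₑ ^ 2) := by
          gcongr with k
          exact lintegral_rieszPot_sq_mul_le hNm hn1 (hb k) (hb2 k) (hc k) (hc2 k) (hbc k)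
      -- The constant 16 arises as 2 from (I(x) + I(y))², 2 from the two potentials, and 4 from
      -- Hardy's inequality.
      _ ≤ 2 * ∑ k, 2 * K * (4 * (∫⁻ p, ‖b k p‖ₑ ^ 2) + 4 * ∑ j, ∫⁻ p, ‖c k j p‖ₑ ^ 2) := by
          gcongr with k
          exact le_mul_of_one_le_left zero_le (by norm_num)
      _ = _ := by
          simp only [← mul_add, ← Finset.mul_sum]
          ring
  -- The potential is bounded, so the operator difference is an admissible commutator and bounds the
  -- infimum.
  have hcomm : commutatorNorm ħ (mulGraph fun x => (V x : ℂ)) T ≤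
      schattenNorm ħ 2 (mulOp hVm hM * T - T * mulOp hVm hM) :=
    iInf₂_le _ (isCommutator_mulOp hVm hM T)
  calc _ ≤ (ENNReal.ofReal (1 / ħ) * schattenNorm ħ 2 (mulOp hVm hM * T - T * mulOp hVm hM)) ^ 2 := by
        gcongr
    _ = h3 * (ENNReal.ofReal (1 / ħ) ^ 2 * hsSq (mulOp hVm hM * T - T * mulOp hVm hM)) := by
        rw [mul_pow, schattenNorm_two_sq]; ring
    _ ≤ h3 * (16 * K * ∑ k, ((∫⁻ p, ‖b k p‖ₑ ^ 2) + ∑ j, ∫⁻ p, ‖c k j p‖ₑ ^ 2)) := by gcongr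
    _ = 16 * K * (h3 * ∑ k, ((∫⁻ p, ‖b k p‖ₑ ^ 2) + ∑ j, ∫⁻ p, ‖c k j p‖ₑ ^ 2)) := by ring
    _ ≤ 16 * K * momentumGradientSobolevNorm ħ T ^ 2 := by gcongr
    _ = _ := by rw [hK]; ring

theorem meanField_congr {n n' : Space → ℝ} (h : n =ᵐ[volume] n') (σ : ℝ) :
    meanField σ n = meanField σ n' := by
  ext x
  refine integral_congr_ae ?_
  filter_upwards [h] with z hz
  rw [hz]

theorem eLpNorm_two_sq (n : Space → ℝ) : eLpNorm n 2 volume ^ 2 = ∫⁻ z, ‖n z‖ₑ ^ 2 := by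
  rw [eLpNorm_eq_lintegral_rpow_enorm_toReal (by norm_num) (by norm_num),
    ← ENNReal.rpow_natCast, ← ENNReal.rpow_mul]
  simp

end Hartree

theorem lemma2p3 :
    ∃ C : ℝ, 0 < C ∧
      ∀ σ ħ : ℝ, (σ = 1 ∨ σ = -1) → 0 < ħ →
      ∀ ρ μ : Hartree.L2 →L[ℂ] Hartree.L2,
        IsSelfAdjoint ρ → Hartree.IsTraceClass ρ →
        IsSelfAdjoint μ → Hartree.IsTraceClass μ →
      ∀ n : Hartree.Space → ℝ, Hartree.IsSpatialDensity ħ ρ n →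
        ENNReal.ofReal (1 / ħ) *
            Hartree.commutatorNorm ħ (Hartree.mulGraph fun x => (Hartree.meanField σ n x : ℂ)) μ ≤
          ENNReal.ofReal C * eLpNorm n 2 volume * Hartree.momentumGradientSobolevNorm ħ μ := by
  have hR := Hartree.radialConst_pos
  set C := Real.sqrt (16 * (8 * Hartree.radialConst)) with hC
  have hC0 : 0 < C := Real.sqrt_pos.2 (by positivity)
  have hC2 : ENNReal.ofReal C ^ 2 = 16 * ENNReal.ofReal (8 * Hartree.radialConst) := by
    rw [← ENNReal.ofReal_pow hC0.le, hC, Real.sq_sqrt (by positivity),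
      ENNReal.ofReal_mul (by norm_num)]
    norm_num
  refine ⟨C, hC0, fun σ ħ hσ hħ ρ μ _ _ hμ hμ1 n hn => ?_⟩
  have hσ1 : |σ| = 1 := by rcases hσ with rfl | rfl <;> simp
  have hT := Hartree.hsSq_ne_top_of_isTraceClass hμ hμ1
  have hCt : ENNReal.ofReal C ≠ 0 := by simpa using hC0
  -- The convention 0 · ∞ = 0 forces a separate check of the products with a zero factor: here the
  -- potential vanishes identically.
  rcases eq_or_ne (eLpNorm n 2 volume) 0 with h0 | h0
  · have hz := (eLpNorm_eq_zero_iff hn.integrable.aestronglyMeasurable two_ne_zero).1 h0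
    have hV : Hartree.meanField σ n = fun _ => 0 := by
      rw [Hartree.meanField_congr hz]
      ext x
      simp [Hartree.meanField]
    have h1 : Hartree.commutatorNorm ħ
        (Hartree.mulGraph fun x => (Hartree.meanField σ n x : ℂ)) μ ≤ 0 := by
      rw [← Hartree.schattenNorm_zero ħ, hV]
      simp only [Complex.ofReal_zero]
      exact iInf₂_le _ (Hartree.isCommutator_mulGraph_zero μ)
    rw [nonpos_iff_eq_zero.1 h1, mul_zero]
    exact zero_le
  rcases eq_or_ne (Hartree.momentumGradientSobolevNorm ħ μ) ∞ with hS | hS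
  · rw [hS, ENNReal.mul_top (mul_ne_zero hCt h0)]
    exact le_top
  rcases eq_or_ne (eLpNorm n 2 volume) ∞ with ht | ht
  -- For ‖n‖₂ = ∞ the right side is still 0 if the gradient norm vanishes; then μ = 0 and so is its
  -- commutator.
  · rcases eq_or_ne (Hartree.momentumGradientSobolevNorm ħ μ) 0 with hS0 | hS0
    · have hμ0 := Hartree.eq_zero_of_momentumGradientSobolevNorm_eq_zero hħ hT hS0
      have h1 : Hartree.commutatorNorm ħ
          (Hartree.mulGraph fun x => (Hartree.meanField σ n x : ℂ)) μ ≤ 0 := by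
        rw [← Hartree.schattenNorm_zero ħ, hμ0]
        exact iInf₂_le _ (Hartree.isCommutator_zero _)
      rw [nonpos_iff_eq_zero.1 h1, mul_zero]
      exact zero_le
    · rw [ht, ENNReal.mul_top hCt, ENNReal.top_mul hS0]
      exact le_top
  -- A measurable representative of the density gives the same potential at every point, since the
  -- potential is an integral of n.
  set n' := hn.integrable.aestronglyMeasurable.mk n with hn'
  have hnn : n =ᵐ[volume] n' := hn.integrable.aestronglyMeasurable.ae_eq_mk
  have hn'm : Measurable n' := hn.integrable.aestronglyMeasurable.stronglyMeasurable_mk.measurable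
  rw [Hartree.meanField_congr hnn, eLpNorm_congr_ae hnn]
  rw [eLpNorm_congr_ae hnn] at ht
  have hn1 : ∫⁻ z, ‖n' z‖ₑ ≠ ∞ := (hn.integrable.congr hnn).2.ne
  have hn2 : ∫⁻ z, ‖n' z‖ₑ ^ 2 ≠ ∞ := by
    rw [← Hartree.eLpNorm_two_sq]; exact ENNReal.pow_ne_top ht
  refine (ENNReal.pow_le_pow_left_iff two_ne_zero).1 ?_
  rw [mul_pow (ENNReal.ofReal C * _), mul_pow (ENNReal.ofReal C), hC2, Hartree.eLpNorm_two_sq]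
  exact Hartree.commutatorNorm_meanField_sq_le hσ1 hħ hT hn'm hn1 hn2 hS
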